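/- **Definitions.** *Boolean network logic (BNL).* Let $\mathcal T$ be a finite nonempty linearly ordered set of variables. Formulas are $\psi ::= \top \mid X \mid \neg\psi \mid \psi\wedge\psi$ with $X\in\mathcal T$. A BNL-program $\Lambda$ over $\mathcal T$ has, for every $X\in\mathcal T$, exactly one iteration clause $X :- \psi_X$ and at most one terminal clause, $X(0) :- \top$ or $X(0) :- \bot$ (with $\bot=\neg\top$), together with a set of print predicates and a set of attention predicates contained in $\mathcal T$. Variables without terminal clause are the input predicates. Given a bit string $\mathbf i$ with one bit for each input predicate (in the order of $\mathcal T$), the variables get their round-$0$ values from $\mathbf i$ and the terminal clauses, and in round $t+1$ the variable $X$ gets the value of $\psi_X$ in round $t$. The program is *halting* if on every input the run reaches a fixed point and, for every round $t$, some attention predicate is true in round $t$ if and only if the configuration in round $t$ is a fixed point; $\Lambda(\mathbf i)$ is then the string of fixed-point values of the print predicates (in the order of $\mathcal T$), and the *computation time* is the maximum, over all reachable configurations, of the number of rounds needed to reach the fixed point. The *size* is the number of occurrences of $\top$, variables, $\neg$ and $\wedge$ in all clauses (heads included). *Floating-point systems.* For integers $p,q\ge 1$, $\beta\ge 2$, let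 $S=S(p,q,\beta)$ be the set of numbers in normalized form $\pm 0.d_1\cdots d_p\times\beta^{\pm e_1\cdots e_q}$ with digits $d_i,e_i\in\{0,\dots,\beta-1\}$ in base $\beta$, where either $d_1\neq 0$, or all $d_i=0$, the sign of the fraction is $+$ and the exponent is the smallest possible one; the exponent $0$ is written with sign $+$. The sum and the product of two elements of $S$ are the exact sum and product rounded to the nearest element of $S$; in case of a tie one takes the nearest element that is smaller in absolute value if its digit $d_p$ is even, and the other one if that digit is odd. The *one-hot representation* of an element of $S$ is the bit string of length $2+\beta(p+q)$ consisting of one bit for the sign of the exponent, one bit for the sign of the fraction ($1$ means $+$), and then for each of the digits $e_1,\dots,e_q,d_1,\dots,d_p$ in this order the block of $\beta$ bits, in positions $0,\dots,\beta-1$, whose only $1$ is in the position given by the digit. A halting BNL-program $\Lambda$ *simulates* $\alpha\colon S\to S$ if it has $2+\beta(p+q)$ input predicates and as many print predicates, and for every $F\in S$ it maps the one-hot representation of $F$ to that of $\alpha(F)$. *Piecewise polynomial functions.* A function $\alpha\colon S\to S$ is piecewise polynomial with $P$ pieces if there are $P$ real intervals such that every element of $S$ lies in exactly one of them, and for each interval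 an $n\in\mathbb N$ and coefficients $a_0,\dots,a_n\in S$ such that on the elements of $S$ in that interval $\alpha(x)$ is $a_nx^n+\dots+a_1x+a_0$, evaluated with the rounded operations in the following order. First each term $a_i\cdot x\cdots x$ ($i$ factors $x$) is computed by repeatedly combining neighbours in pairs: $y_1=x_1x_2$, $y_2=x_3x_4,\dots$ (an unpaired last factor is kept), then $z_1=y_1y_2$, and so on. Then the terms, in the order $a_nx^n,\dots,a_1x,a_0$, are added in the same pairwise fashion. Let $\Omega$ be the maximum of the orders $n$ of the pieces, or $1$ if this maximum is $0$. **Theorem.** There is an absolute constant $C>0$ such that the following holds for all integers $p,q\ge 1$, $\beta\ge 2$, with $r=\max\{p,q\}$. For every piecewise polynomial function $\alpha\colon S(p,q,\beta)\to S(p,q,\beta)$ with $P$ pieces and maximum order $\Omega$ there is a halting BNL-program $\Lambda$ that simulates $\alpha$ such that 1. the size of $\Lambda$ is at most $C\cdot P\,\Omega^2\,(r^4+r^3\beta^2+r\beta^4)$, and 2. the computation time of $\Lambda$ is at most $C\cdot(\log\Omega+1)(\log r+\log\beta)$. -/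

import Mathlib

/-! ## Boolean network logic -/

namespace BNL

/-- Formulas of Boolean network logic over a set `T` of schema variables:
`ψ ::= ⊤ | X | ¬ψ | ψ ∧ ψ`. -/
inductive Formula (T : Type) : Type
  | top : Formula T
  | var : T → Formula T
  | neg : Formula T → Formula T
  | conj : Formula T → Formula T → Formula T

namespace Formula

variable {T : Type}

/-- Truth value of a formula in a global configuration `g`. -/
def eval (g : T → Bool) : Formula T → Bool
  | top => true
  | var X => g X
  | neg ψ => !(eval g ψ)
  | conj ψ θ => eval g ψ && eval g θ

/-- Number of appearances of `⊤`, schema variables, `¬` and `∧`. -/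
def size : Formula T → ℕ
  | top => 1
  | var _ => 1
  | neg ψ => size ψ + 1
  | conj ψ θ => size ψ + size θ + 1

end Formula

/-- A `T`-program of Boolean network logic with attention predicates. The finite nonempty set `T` of
schema variables is linearly ordered. Every variable `X` has exactly one iteration clause
`X :- iteration X` and at most one terminal clause: `terminal X = some true` is the clause
`X(0) :- ⊤`, `terminal X = some false` is `X(0) :- ⊥`, and `terminal X = none` says that `X` has no
terminal clause, i.e. that `X` is an input predicate. -/
structure Program (T : Type) [Fintype T] [LinearOrder T] where
  nonempty : Nonempty T
  terminal : T → Option Bool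
  iteration : T → Formula T
  print : Finset T
  attention : Finset T

namespace Program

variable {T : Type} [Fintype T] [LinearOrder T] (Λ : Program T)

/-- The set of input predicates. -/
def inputs : Finset T := Finset.univ.filter fun X => Λ.terminal X = none

/-- A model is a valuation of the input predicates. -/
abbrev Model : Type := {X : T // Λ.terminal X = none} → Bool

/-- The model induced by an input string `w`: the `j`-th input predicate (in the order of the schema
variables, counting from `0`) receives the `j`-th letter. Used only for strings `w` whose length is
the number of input predicates. -/
def modelOf (w : List Bool) : Λ.Model :=
  fun X => w.getD (Λ.inputs.filter fun Y => Y < X.1).card false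

/-- The global configuration in round `0`. -/
def init (M : Λ.Model) : T → Bool := fun X =>
  match h : Λ.terminal X with
  | some b => b
  | none => M ⟨X, h⟩

/-- One synchronous update: every variable takes the value of the body of its iteration clause. -/
def step (g : T → Bool) : T → Bool := fun X => (Λ.iteration X).eval g

/-- The global configuration in round `t`. -/
def config (M : Λ.Model) (t : ℕ) : T → Bool := Λ.step^[t] (Λ.init M)

/-- Round `t` is an output round if some attention predicate is true in it. -/
def OutputsAt (M : Λ.Model) (t : ℕ) : Prop := ∃ X ∈ Λ.attention, Λ.config M t X = true

/-- A halting program: no input leads to a cycle attractor of several states (so every run reaches a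
fixed point), and the output rounds are precisely the rounds in a fixed point. -/
def IsHalting : Prop :=
  (∀ M : Λ.Model, ∃ t : ℕ, Function.IsFixedPt Λ.step (Λ.config M t)) ∧
  ∀ (M : Λ.Model) (t : ℕ), Λ.OutputsAt M t ↔ Function.IsFixedPt Λ.step (Λ.config M t)

/-- The transient time of a state: the least time in which an attractor (a fixed point or a cycle,
i.e. a periodic point of the update) is reached from it. -/
noncomputable def transientTimeOf (g : T → Bool) : ℕ :=
  sInf {t : ℕ | Λ.step^[t] g ∈ Function.periodicPts Λ.step}

open Classical in
/-- The transient time of a program: the maximum transient time of a reachable state. For a halting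
program this is its computation time. -/
noncomputable def transientTime : ℕ :=
  (Finset.univ.filter fun g : T → Bool => ∃ (M : Λ.Model) (t : ℕ), Λ.config M t = g).sup
    Λ.transientTimeOf

/-- The output of a halting program: the string of the values of the print predicates, in the order
of the schema variables, in the fixed point that the run reaches. -/
noncomputable def output (M : Λ.Model) : List Bool :=
  (Λ.print.sort (· ≤ ·)).map (Λ.config M (Λ.transientTimeOf (Λ.init M)))

/-- Size of the terminal clause (if any) of a variable; `⊥` abbreviates `¬⊤`, and the head of the
clause is counted. -/
def terminalSize : Option Bool → ℕ
  | none => 0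
  | some true => 2
  | some false => 3

/-- The size of a program: the number of appearances of `⊤`, schema variables (in heads and in
bodies), `¬` and `∧` in its terminal and iteration clauses. -/
def size : ℕ := ∑ X : T, (terminalSize (Λ.terminal X) + (1 + (Λ.iteration X).size))

end Program

end BNL

/-! ## Floating-point systems -/

/-- The parameters of a floating-point system `S(p, q, β)`: fraction precision `p`, exponent
precision `q` and base `β`. -/
structure FPSystem where
  p : ℕ
  q : ℕ
  β : ℕ
  p_pos : 1 ≤ p
  q_pos : 1 ≤ q
  two_le_β : 2 ≤ β

namespace FPSystem

/-- A representation `± 0.d₁d₂⋯d_p × β^(± e₁⋯e_q)`. The sign `+` is `true`; `frac i` is `d_{i+1}`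
and `exp i` is `e_{i+1}`. -/
structure Rep (S : FPSystem) where
  expSign : Bool
  fracSign : Bool
  exp : Fin S.q → Fin S.β
  frac : Fin S.p → Fin S.β
  deriving DecidableEq, Fintype

namespace Rep

variable {S : FPSystem} (F : Rep S)

/-- The natural number `e₁⋯e_q` in base `β`. -/
def expNat : ℕ := ∑ i : Fin S.q, (F.exp i : ℕ) * S.β ^ (S.q - 1 - (i : ℕ))

/-- The exponent `± e₁⋯e_q`. -/
def exponent : ℤ := if F.expSign then (F.expNat : ℤ) else -(F.expNat : ℤ)

/-- The fraction `0.d₁⋯d_p` in base `β`. -/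
def fraction : ℚ := ∑ i : Fin S.p, ((F.frac i : ℕ) : ℚ) / (S.β : ℚ) ^ ((i : ℕ) + 1)

/-- The represented number. -/
def value : ℚ := (if F.fracSign then 1 else -1) * F.fraction * (S.β : ℚ) ^ F.exponent

/-- Normalized representations: the first digit `d₁` of the fraction is nonzero, or the fraction is
`0`, its sign is `+` and the exponent is the smallest possible one. So that every number has a single
form, the exponent `0` is written with the sign `+`. -/
def IsNormalized : Prop :=
  ((∃ i : Fin S.p, (i : ℕ) = 0 ∧ (F.frac i : ℕ) ≠ 0) ∨
    ((∀ i, (F.frac i : ℕ) = 0) ∧ F.fracSign = true ∧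
      F.expSign = false ∧ ∀ i, (F.exp i : ℕ) = S.β - 1)) ∧
  (F.expNat = 0 → F.expSign = true)

instance : DecidablePred (IsNormalized (S := S)) := fun F => by
  unfold IsNormalized; infer_instance

/-- The one-hot block of length `β` of a digit. -/
def oneHot {b : ℕ} (d : Fin b) : List Bool := List.ofFn fun c : Fin b => decide (c = d)

/-- The one-hot representation: exponent sign, fraction sign, one-hot blocks of `e₁, …, e_q`, one-hot
blocks of `d₁, …, d_p`. It is a string of length `2 + β(p + q)`. -/
def encode : List Bool :=
  F.expSign :: F.fracSign ::
    ((List.ofFn F.exp).flatMap oneHot ++ (List.ofFn F.frac).flatMap oneHot)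

end Rep

/-- The floating-point numbers of the system, in normalized form. -/
abbrev Num (S : FPSystem) : Type := {F : Rep S // F.IsNormalized}

variable {S : FPSystem}

/-- The number `0`. -/
def zero (S : FPSystem) : Num S :=
  ⟨{ expSign := false
     fracSign := true
     exp := fun _ => ⟨S.β - 1, by have := S.two_le_β; omega⟩
     frac := fun _ => ⟨0, by have := S.two_le_β; omega⟩ }, by
    have hβ := S.two_le_β
    have hq := S.q_pos
    refine ⟨Or.inr ⟨fun _ => rfl, rfl, rfl, fun _ => rfl⟩, fun h => ?_⟩
    exfalso
    have h0 := (Finset.sum_eq_zero_iff.mp h) ⟨0, by omega⟩ (Finset.mem_univ _)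
    rcases Nat.mul_eq_zero.mp h0 with h1 | h1
    · simp only at h1; omega
    · exact absurd h1 (pow_ne_zero _ (by omega))⟩

/-- The value of a floating-point number. -/
def Num.val (x : Num S) : ℚ := x.1.value

/-- The least significant digit `d_p` of the fraction. -/
def Num.lastDigit (x : Num S) : ℕ :=
  x.1.frac ⟨S.p - 1, by have := S.p_pos; omega⟩

/-- The floating-point numbers of the system that are nearest to `x`: one number, or two numbers of
different absolute value in the case of a tie. -/
def nearest (S : FPSystem) (x : ℚ) : Finset (Num S) :=
  Finset.univ.filter fun F => ∀ G : Num S, |F.val - x| ≤ |G.val - x|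

theorem nearest_nonempty (S : FPSystem) (x : ℚ) : (nearest S x).Nonempty := by
  obtain ⟨F, -, hF⟩ := Finset.exists_min_image (Finset.univ : Finset (Num S))
    (fun F => |F.val - x|) ⟨zero S, Finset.mem_univ _⟩
  exact ⟨F, Finset.mem_filter.mpr ⟨Finset.mem_univ _, fun G => hF G (Finset.mem_univ _)⟩⟩

/-- Among the nearest numbers, the one closer to zero. -/
noncomputable def nearestLow (S : FPSystem) (x : ℚ) : Num S :=
  Classical.choose (Finset.exists_min_image (nearest S x) (fun F => |F.val|)
    (nearest_nonempty S x))

/-- Among the nearest numbers, the one farther from zero. -/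
noncomputable def nearestHigh (S : FPSystem) (x : ℚ) : Num S :=
  Classical.choose (Finset.exists_max_image (nearest S x) (fun F => |F.val|)
    (nearest_nonempty S x))

/-- Round-to-nearest, ties-to-even: the nearest number of the system; in the case of a tie the number
closer to zero is taken if its least significant digit is even, and the other one (the next larger in
absolute value) if that digit is odd. Numbers beyond the range of the system are rounded to
the largest, respectively to the smallest, number of the system. -/
noncomputable def round (S : FPSystem) (x : ℚ) : Num S :=
  if Even (nearestLow S x).lastDigit then nearestLow S x else nearestHigh S x

/-- Floating-point addition: the exact sum, rounded. -/
noncomputable def add (x y : Num S) : Num S := round S (x.val + y.val)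

/-- Floating-point multiplication: the exact product, rounded. -/
noncomputable def mul (x y : Num S) : Num S := round S (x.val * y.val)

/-- One level of the canonical order of evaluation: combine the first with the second entry, the
third with the fourth, and so on; an unpaired last entry is kept. -/
def pairUp {A : Type} (op : A → A → A) : List A → List A
  | a :: b :: l => op a b :: pairUp op l
  | [a] => [a]
  | [] => []

/-- Combine the entries of a nonempty list by pairing up until a single entry remains (`l.length`
levels are always enough and further levels change nothing; `d` is returned for the empty list). -/
def treeFold {A : Type} (op : A → A → A) (d : A) (l : List A) : A :=
  ((pairUp op)^[l.length] l).headD d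

/-- The term `a * x * ⋯ * x` with `i` factors `x`, in floating-point arithmetic. -/
noncomputable def monomial (a : Num S) (i : ℕ) (x : Num S) : Num S :=
  treeFold mul (zero S) (a :: List.replicate i x)

/-- The polynomial `a_n x^n + ⋯ + a_1 x + a_0` in floating-point arithmetic: first every term is
computed, then the terms are summed in this order. -/
noncomputable def evalPoly {n : ℕ} (a : Fin (n + 1) → Num S) (x : Num S) : Num S :=
  treeFold add (zero S) (List.ofFn fun i : Fin (n + 1) => monomial (a i) i x).reverse

/-- A piecewise polynomial with `P` pieces over the system: `P` intervals of real numbers such that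
every number of the system lies in exactly one of them, and for every interval a polynomial (given by
its order and its coefficients from the system). -/
structure PiecewisePoly (S : FPSystem) (P : ℕ) where
  piece : Fin P → Set ℝ
  isInterval : ∀ i, (piece i).OrdConnected
  cover : ∀ x : Num S, ∃! i, (x.val : ℝ) ∈ piece i
  order : Fin P → ℕ
  coeff : ∀ i, Fin (order i + 1) → Num S

namespace PiecewisePoly

variable {P : ℕ} (D : PiecewisePoly S P)

/-- The highest order of the polynomials, or `1` if the highest order is `0`. -/
def maxOrder : ℕ := max 1 (Finset.univ.sup D.order)

/-- `α` is the function that is given by the pieces, evaluated in floating-point arithmetic. -/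
def Defines (α : Num S → Num S) : Prop :=
  ∀ (i : Fin P) (x : Num S), (x.val : ℝ) ∈ D.piece i → α x = evalPoly (D.coeff i) x

end PiecewisePoly

end FPSystem

/-- A halting program simulates `α : S → S`: it has `2 + β(p + q)` input and print predicates, and on
the one-hot representation of any floating-point number `F` of the system it outputs the one-hot
representation of `α F`. -/
def BNL.Program.Simulates {T : Type} [Fintype T] [LinearOrder T] (Λ : BNL.Program T)
    {S : FPSystem} (α : S.Num → S.Num) : Prop :=
  Λ.IsHalting ∧
  Λ.inputs.card = 2 + S.β * (S.p + S.q) ∧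
  Λ.print.card = 2 + S.β * (S.p + S.q) ∧
  ∀ F : S.Num, Λ.output (Λ.modelOf F.1.encode) = (α F).1.encode

/-! The function is computed by a Boolean circuit, and the circuit is run as a program. In a circuit
of depth `d` whose inputs are held constant, each gate is re-evaluated every round, so a gate of
rank below `r` no longer changes from round `r` on. After `d + 1` rounds the outputs are final as
well. A clock, that is, a chain of bits switched on one per round, changes the configuration in each
round up to that moment. Hence no earlier configuration is a fixed point, and the last clock bit can
serve as attention predicate. This is `Computes.exists_program`. The size of the program is linear
in the size of the circuit, and its computation time is at most the depth plus one.

It remains to build small and shallow circuits. Integers are given by the one-hot predicates of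
their lowest `width` base-`β` digits, `width` being `16 * max p q`. Floor division makes negative
numbers appear in complement form. Carry look-ahead gives addition in constant depth with cost O(W²
+ Wβ³), W being the width. Comparison is the sign of a difference, and shifting by a fixed amount is
mere rewiring. For a product zw all multiples of z by a digit are formed by repeated doubling (depth
O(log β)), each digit of w selects one of them, and the W shifted rows are added in a binary tree
(depth O(log W)). By the inequality Wβ ≤ W² + β² the cost is O(W⁴ + W³β² + Wβ⁴), the `unit` of all
later estimates.

A rounded sum or product is an exact integer times a power of the base, followed by rounding. For
sums, if the exponents differ by at least p + 2, the summand with the larger exponent is already the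
result (`round_add_of_far`). Otherwise the aligned sum, like every product of two fractions, has
fewer than 2p + 3 digits. Rounding (`round_spec`, `round_parts`) normalizes this integer and then
needs only finitely many comparisons and case distinctions, so its depth is constant. Thus both
operations cost O(1) units. Addition has constant depth, and multiplication has depth O(log r + log
β).

A polynomial of order n takes O(n²) operations, arranged in two successive stages of trees of depth
O(log n). All P pieces are evaluated in parallel. Membership in a piece amounts to two comparisons
with constants after the numbers have been mapped monotonically to integers (`Num.key`), and the
right value is then selected. -/

/-! ## Families of predicates computed by layered circuits -/

namespace BNL

/-- `Definable U n p`: the predicate `p` is a Boolean combination with at most `n` occurrences of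
predicates from `U`. -/
inductive Definable {A : Type} (U : Set (A → Prop)) : ℕ → (A → Prop) → Prop
  | const (b : Prop) : Definable U 0 (fun _ => b)
  | var {u : A → Prop} : u ∈ U → Definable U 1 u
  | not {n : ℕ} {p : A → Prop} : Definable U n p → Definable U n (fun a => ¬ p a)
  | and {m n : ℕ} {p q : A → Prop} : Definable U m p → Definable U n q →
      Definable U (m + n) (fun a => p a ∧ q a)
  | mono {m n : ℕ} {p : A → Prop} : m ≤ n → Definable U m p → Definable U n p

namespace Definable

variable {A : Type} {U V : Set (A → Prop)} {m n : ℕ} {p q : A → Prop}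

theorem of_iff (h : Definable U n p) (e : ∀ a, q a ↔ p a) : Definable U n q := by
  have : q = p := funext fun a => propext (e a)
  rwa [this]

theorem or (hp : Definable U m p) (hq : Definable U n q) :
    Definable U (m + n) (fun a => p a ∨ q a) :=
  (hp.not.and hq.not).not.of_iff fun a => by tauto

theorem trivial (b : Prop) : Definable U n (fun _ => b) := (const b).mono (Nat.zero_le n)

/-- Replacing an atom by a literal or a constant does not raise the count, since negations and
constants are free. This is what makes the composition of circuits cost exactly the sum of the
costs. -/
theorem subst (h : Definable V n p) (hV : ∀ v ∈ V, Definable U 1 v) : Definable U n p := by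
  induction h with
  | const b => exact const b
  | var hu => exact hV _ hu
  | not _ ih => exact ih.not
  | and _ _ ih₁ ih₂ => exact ih₁.and ih₂
  | mono hmn _ ih => exact ih.mono hmn

theorem superset (h : Definable U n p) (hUV : U ⊆ V) : Definable V n p :=
  h.subst fun _ hv => var (hUV hv)

theorem exists_lt {N c : ℕ} {r : ℕ → A → Prop} (h : ∀ k < N, Definable U c (r k)) :
    Definable U (N * c) (fun a => ∃ k < N, r k a) := by
  induction N with
  | zero => exact (trivial False).of_iff fun a => by simp
  | succ N ih =>
    have h₁ := (ih fun k hk => h k (by omega)).or (h N (by omega))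
    refine (h₁.mono (by rw [Nat.succ_mul])).of_iff fun a => ?_
    constructor
    · rintro ⟨k, hk, hr⟩
      rcases Nat.lt_succ_iff_lt_or_eq.mp hk with hk | rfl
      · exact Or.inl ⟨k, hk, hr⟩
      · exact Or.inr hr
    · rintro (⟨k, hk, hr⟩ | hr)
      · exact ⟨k, by omega, hr⟩
      · exact ⟨N, by omega, hr⟩

theorem forall_lt {N c : ℕ} {r : ℕ → A → Prop} (h : ∀ k < N, Definable U c (r k)) :
    Definable U (N * c) (fun a => ∀ k < N, r k a) :=
  (exists_lt fun k hk => (h k hk).not).not.of_iff fun a => by push Not; rfl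

/-- Formulas realizing a definable predicate and its negation over the variables in `R`, whose
meaning is given by `sem`. -/
theorem exists_formula_aux {I : Type} {R : Set I} {sem : I → A → Prop}
    (hU : ∀ u ∈ U, ∃ X ∈ R, sem X = u) (h : Definable U n p) :
    (∃ b : Prop, p = fun _ => b) ∨ ∃ φ : Bool → Formula I, ∀ s : Bool,
      (φ s).size + 2 ≤ 4 * n ∧
      (∀ g g' : I → Bool, (∀ X ∈ R, g X = g' X) → (φ s).eval g = (φ s).eval g') ∧
      ∀ (a : A) (g : I → Bool), (∀ X ∈ R, (g X = true ↔ sem X a)) →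
        ((φ s).eval g = s ↔ p a) := by
  -- `φ true` expresses `p` and `φ false` expresses its negation, so a negation only swaps the two.
  -- Constants form a case of their own and are folded away, because the bound 4n - 2 on the size
  -- leaves no room for them. A conjunction adds at most one `∧` and one `¬`, and (4m - 2) + (4n -
  -- 2) + 2 = 4(m + n) - 2.
  induction h with
  | const b => exact Or.inl ⟨b, rfl⟩
  | @var u hu =>
    obtain ⟨X, hX, rfl⟩ := hU _ hu
    refine Or.inr ⟨fun s => if s then .var X else .neg (.var X), fun s => ?_⟩
    cases s
    · refine ⟨by simp [Formula.size], fun g g' h => by simp [Formula.eval, h X hX],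
        fun a g h => by simp [Formula.eval, h X hX]⟩
    · refine ⟨by simp [Formula.size], fun g g' h => by simp [Formula.eval, h X hX],
        fun a g h => by simp [Formula.eval, h X hX]⟩
  | @not n p _ ih =>
    rcases ih with ⟨b, rfl⟩ | ⟨φ, hφ⟩
    · exact Or.inl ⟨¬ b, rfl⟩
    · refine Or.inr ⟨fun s => φ (!s), fun s => ⟨(hφ _).1, (hφ _).2.1, fun a g h => ?_⟩⟩
      change (φ (!s)).eval g = s ↔ ¬ p a
      rw [← (hφ (!s)).2.2 a g h]
      cases s <;> simp
  | @and m n p q _ _ ih₁ ih₂ =>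
    rcases ih₁ with ⟨b, rfl⟩ | ⟨φ, hφ⟩
    · by_cases hb : b
      · rcases ih₂ with ⟨c, rfl⟩ | ⟨ψ, hψ⟩
        · exact Or.inl ⟨b ∧ c, rfl⟩
        · refine Or.inr ⟨ψ, fun s => ⟨by have := (hψ s).1; omega, (hψ s).2.1, fun a g h => ?_⟩⟩
          rw [(hψ s).2.2 a g h]; simp [hb]
      · exact Or.inl ⟨False, by funext a; simp [hb]⟩
    · rcases ih₂ with ⟨c, rfl⟩ | ⟨ψ, hψ⟩
      · by_cases hc : c
        · refine Or.inr ⟨φ, fun s => ⟨by have := (hφ s).1; omega, (hφ s).2.1, fun a g h => ?_⟩⟩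
          rw [(hφ s).2.2 a g h]; simp [hc]
        · exact Or.inl ⟨False, by funext a; simp [hc]⟩
      · have e := fun s => (hφ s).2.1
        have e' := fun s => (hψ s).2.1
        refine Or.inr ⟨fun s => if s then .conj (φ true) (ψ true) else
          .neg (.conj (φ true) (ψ true)), fun s => ⟨?_, ?_, ?_⟩⟩
        · have h₁ := (hφ true).1
          have h₂ := (hψ true).1
          cases s <;> simp [Formula.size] <;> omega
        · intro g g' h
          have h₁ := e true g g' h
          have h₂ := e' true g g' h
          cases s <;> simp [Formula.eval, h₁, h₂]
        · intro a g h
          have h₁ := (hφ true).2.2 a g h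
          have h₂ := (hψ true).2.2 a g h
          change _ ↔ p a ∧ q a
          rw [← h₁, ← h₂]
          cases s <;> simp [Formula.eval]
  | mono hmn _ ih =>
    rcases ih with hb | ⟨φ, hφ⟩
    · exact Or.inl hb
    · exact Or.inr ⟨φ, fun s => ⟨by have := (hφ s).1; omega, (hφ s).2⟩⟩

/-- The additive 2 pays for `⊤` or `¬⊤`. The middle clause, that only variables in `R` matter, holds
for all configurations and not only for those that come from some `a`. It is needed because a
program must halt on every input string, including strings that encode nothing. -/
theorem exists_formula {I : Type} {R : Set I} {sem : I → A → Prop}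
    (hU : ∀ u ∈ U, ∃ X ∈ R, sem X = u) (h : Definable U n p) :
    ∃ φ : Formula I, φ.size ≤ 4 * n + 2 ∧
      (∀ g g' : I → Bool, (∀ X ∈ R, g X = g' X) → φ.eval g = φ.eval g') ∧
      ∀ (a : A) (g : I → Bool), (∀ X ∈ R, (g X = true ↔ sem X a)) → (φ.eval g = true ↔ p a) := by
  rcases exists_formula_aux hU h with ⟨b, rfl⟩ | ⟨φ, hφ⟩
  · by_cases hb : b
    · exact ⟨.top, by simp [Formula.size], fun _ _ _ => rfl, fun _ _ _ => by simp [Formula.eval, hb]⟩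
    · exact ⟨.neg .top, by simp [Formula.size], fun _ _ _ => rfl,
        fun _ _ _ => by simp [Formula.eval, hb]⟩
  · exact ⟨φ true, by have := (hφ true).1; omega, (hφ true).2⟩

end Definable

/-- `Computes U V s d`: there is an acyclic family of gates over the predicates in `U`, of total cost
at most `s` and depth at most `d`, such that every predicate in `V` is a literal over `U` and the
gates. -/
def Computes {A : Type} (U V : Set (A → Prop)) (s d : ℕ) : Prop :=
  ∃ (ι : Type) (_ : Fintype ι) (g : ι → A → Prop) (rk c : ι → ℕ),
    (∀ i, Definable (U ∪ {f | ∃ j, rk j < rk i ∧ g j = f}) (c i) (g i)) ∧ (∀ i, rk i < d) ∧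
    ∑ i, (c i + 1) ≤ s ∧ ∀ v ∈ V, Definable (U ∪ Set.range g) 1 v

namespace Computes

variable {A : Type} {U V W : Set (A → Prop)} {s s' d d' : ℕ}

theorem of_literal (h : ∀ v ∈ V, Definable U 1 v) : Computes U V s d :=
  ⟨Empty, inferInstance, Empty.elim, Empty.elim, Empty.elim, fun i => i.elim, fun i => i.elim,
    by simp, fun v hv => (h v hv).superset Set.subset_union_left⟩

theorem of_subset (h : V ⊆ U) : Computes U V s d := of_literal fun _ hv => .var (h hv)

theorem mono (h : Computes U V s d) (hs : s ≤ s') (hd : d ≤ d') : Computes U V s' d' := by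
  obtain ⟨ι, _, g, rk, c, h₁, h₂, h₃, h₄⟩ := h
  exact ⟨ι, _, g, rk, c, h₁, fun i => (h₂ i).trans_le hd, h₃.trans hs, h₄⟩

theorem literal (h : Computes U V s d) (hW : ∀ v ∈ W, Definable V 1 v) : Computes U W s d := by
  obtain ⟨ι, _, g, rk, c, h₁, h₂, h₃, h₄⟩ := h
  exact ⟨ι, _, g, rk, c, h₁, h₂, h₃, fun v hv => (hW v hv).subst h₄⟩

theorem subset (h : Computes U V s d) (hW : W ⊆ V) : Computes U W s d :=
  h.literal fun _ hv => .var (hW hv)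

theorem layer {κ : Type} [Fintype κ] (v : κ → A → Prop) {c : ℕ} (h : ∀ k, Definable U c (v k)) :
    Computes U (Set.range v) (Fintype.card κ * (c + 1)) 1 :=
  ⟨κ, inferInstance, v, fun _ => 0, fun _ => c, fun k => (h k).superset Set.subset_union_left,
    fun _ => one_pos, by simp, fun v hv => .var (Or.inr hv)⟩

theorem single {p : A → Prop} {c : ℕ} (h : Definable U c p) : Computes U {p} (c + 1) 1 := by
  have := layer (κ := Unit) (fun _ => p) fun _ => h
  refine (this.mono (by simp) le_rfl).subset ?_
  rintro _ rfl
  exact ⟨(), rfl⟩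

theorem union (h : Computes U V s d) (h' : Computes U W s' d') :
    Computes U (V ∪ W) (s + s') (max d d') := by
  obtain ⟨ι, _, g, rk, c, h₁, h₂, h₃, h₄⟩ := h
  obtain ⟨ι', _, g', rk', c', h₁', h₂', h₃', h₄'⟩ := h'
  refine ⟨ι ⊕ ι', inferInstance, Sum.elim g g', Sum.elim rk rk', Sum.elim c c', ?_, ?_, ?_, ?_⟩
  · rintro (i | i)
    · refine (h₁ i).superset (Set.union_subset_union_right _ ?_)
      rintro f ⟨j, hj, hf⟩
      exact ⟨Sum.inl j, hj, hf⟩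
    · refine (h₁' i).superset (Set.union_subset_union_right _ ?_)
      rintro f ⟨j, hj, hf⟩
      exact ⟨Sum.inr j, hj, hf⟩
  · rintro (i | i)
    · exact lt_max_of_lt_left (h₂ i)
    · exact lt_max_of_lt_right (h₂' i)
  · rw [Fintype.sum_sum_type]
    exact Nat.add_le_add h₃ h₃'
  · rintro v (hv | hv)
    · refine (h₄ v hv).superset (Set.union_subset_union_right _ ?_)
      rintro f ⟨j, hf⟩
      exact ⟨Sum.inl j, hf⟩
    · refine (h₄' v hv).superset (Set.union_subset_union_right _ ?_)
      rintro f ⟨j, hf⟩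
      exact ⟨Sum.inr j, hf⟩

/-- The ranks of the second circuit are raised by `d`, which puts its gates above all gates of the
first. Its atoms from `V` are literals over the first circuit and are substituted at no cost. -/
theorem trans_union (h : Computes U V s d) (h' : Computes (U ∪ V) W s' d') :
    Computes U (V ∪ W) (s + s') (d + d') := by
  obtain ⟨ι, _, g, rk, c, h₁, h₂, h₃, h₄⟩ := h
  obtain ⟨ι', _, g', rk', c', h₁', h₂', h₃', h₄'⟩ := h'
  refine ⟨ι ⊕ ι', inferInstance, Sum.elim g g', Sum.elim rk (fun i => d + rk' i), Sum.elim c c',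
    ?_, ?_, ?_, ?_⟩
  · rintro (i | i)
    · refine (h₁ i).superset (Set.union_subset_union_right _ ?_)
      rintro f ⟨j, hj, hf⟩
      exact ⟨Sum.inl j, hj, hf⟩
    · refine (h₁' i).subst ?_
      rintro v ((hv | hv) | ⟨j, hj, rfl⟩)
      · exact .var (Or.inl hv)
      · refine (h₄ v hv).superset (Set.union_subset_union_right _ ?_)
        rintro f ⟨j, rfl⟩
        exact ⟨Sum.inl j, (h₂ j).trans_le (Nat.le_add_right _ _), rfl⟩
      · exact .var (Or.inr ⟨Sum.inr j, Nat.add_lt_add_left hj d, rfl⟩)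
  · rintro (i | i)
    · exact (h₂ i).trans_le (Nat.le_add_right _ _)
    · exact Nat.add_lt_add_left (h₂' i) d
  · rw [Fintype.sum_sum_type]
    exact Nat.add_le_add h₃ h₃'
  · have key : ∀ v ∈ U ∪ V, Definable (U ∪ Set.range (Sum.elim g g')) 1 v := by
      rintro v (hv | hv)
      · exact .var (Or.inl hv)
      · refine (h₄ v hv).superset (Set.union_subset_union_right _ ?_)
        rintro f ⟨j, rfl⟩
        exact ⟨Sum.inl j, rfl⟩
    rintro v (hv | hv)
    · exact key v (Or.inr hv)
    · refine (h₄' v hv).subst ?_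
      rintro v (hv | ⟨j, rfl⟩)
      · exact key v hv
      · exact .var (Or.inr ⟨Sum.inr j, rfl⟩)

theorem superset (h : Computes U V s d) (hU : U ⊆ W) : Computes W V s d := by
  obtain ⟨ι, _, g, rk, c, h₁, h₂, h₃, h₄⟩ := h
  exact ⟨ι, _, g, rk, c, fun i => (h₁ i).superset (Set.union_subset_union_left _ hU), h₂, h₃,
    fun v hv => (h₄ v hv).superset (Set.union_subset_union_left _ hU)⟩

theorem trans (h : Computes U V s d) (h' : Computes V W s' d') :
    Computes U W (s + s') (d + d') :=
  (h.trans_union (h'.superset Set.subset_union_right)).subset Set.subset_union_right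

theorem exists_lt {N : ℕ} {Z : ℕ → Set (A → Prop)} (h : ∀ k < N, Computes U (Z k) s d) :
    Computes U {f | ∃ k < N, f ∈ Z k} (N * s) d := by
  induction N with
  | zero => exact of_literal (by simp)
  | succ N ih =>
    have := (ih fun k hk => h k (by omega)).union (h N (by omega))
    refine (this.mono (Nat.succ_mul N s).ge (max_self d).le).subset ?_
    rintro f ⟨k, hk, hf⟩
    rcases Nat.lt_succ_iff_lt_or_eq.mp hk with hk | rfl
    · exact Or.inl ⟨k, hk, hf⟩
    · exact Or.inr hf

end Computes

end BNL

/-! ## From circuits to halting programs -/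

namespace BNL

/-- Renaming of variables. -/
def Formula.rename {I T : Type} (f : I → T) : Formula I → Formula T
  | top => top
  | var X => var (f X)
  | neg ψ => neg (rename f ψ)
  | conj ψ θ => conj (rename f ψ) (rename f θ)

theorem Formula.eval_rename {I T : Type} (f : I → T) (g : T → Bool) (ψ : Formula I) :
    (ψ.rename f).eval g = ψ.eval (fun i => g (f i)) := by
  induction ψ <;> simp_all [Formula.rename, Formula.eval]

theorem Formula.size_rename {I T : Type} (f : I → T) (ψ : Formula I) :
    (ψ.rename f).size = ψ.size := by
  induction ψ <;> simp_all [Formula.rename, Formula.size]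

namespace Program

variable {I T : Type} [Fintype T] [LinearOrder T]

/-- The program whose clauses are given along an enumeration of its variables. -/
def ofEquiv (E : I ≃ T) (a : I) (term : I → Option Bool) (body : I → Formula I)
    (pr : Finset I) : Program T where
  nonempty := ⟨E a⟩
  terminal X := term (E.symm X)
  iteration X := (body (E.symm X)).rename E
  print := pr.map E.toEmbedding
  attention := {E a}

variable (E : I ≃ T) (a : I) (term : I → Option Bool) (body : I → Formula I) (pr : Finset I)

theorem config_succ (Λ : Program T) (M : Λ.Model) (t : ℕ) :
    Λ.config M (t + 1) = Λ.step (Λ.config M t) := Function.iterate_succ_apply' _ _ _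

theorem ofEquiv_config_succ (M : (ofEquiv E a term body pr).Model) (t : ℕ) (i : I) :
    (ofEquiv E a term body pr).config M (t + 1) (E i) =
      (body i).eval fun j => (ofEquiv E a term body pr).config M t (E j) := by
  rw [config_succ]
  simp [step, ofEquiv, Formula.eval_rename]

theorem init_of_some (Λ : Program T) (M : Λ.Model) {X : T} {b : Bool} (h : Λ.terminal X = some b) :
    Λ.init M X = b := by
  unfold init
  split
  · rename_i b' h'
    rw [h] at h'
    exact (Option.some.inj h').symm
  · rename_i h'
    rw [h] at h'
    cases h'

theorem init_of_none (Λ : Program T) (M : Λ.Model) {X : T} (h : Λ.terminal X = none) :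
    Λ.init M X = M ⟨X, h⟩ := by
  unfold init
  split
  · rename_i b' h'
    rw [h] at h'
    cases h'
  · rfl

theorem config_add (Λ : Program T) (M : Λ.Model) (s t : ℕ) :
    Λ.step^[s] (Λ.config M t) = Λ.config M (s + t) :=
  (Function.iterate_add_apply _ _ _ _).symm

variable {Λ : Program T} {D : ℕ}

theorem config_eq_of_stable (h : ∀ (M : Λ.Model) (t : ℕ), D ≤ t →
    Function.IsFixedPt Λ.step (Λ.config M t)) (M : Λ.Model) {t : ℕ} (ht : D ≤ t) :
    Λ.config M t = Λ.config M D := by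
  obtain ⟨k, rfl⟩ := Nat.exists_eq_add_of_le' ht
  rw [← config_add]
  exact (h M D le_rfl).iterate k

theorem transientTime_le (h : ∀ (M : Λ.Model) (t : ℕ), D ≤ t →
    Function.IsFixedPt Λ.step (Λ.config M t)) : Λ.transientTime ≤ D := by
  classical
  refine Finset.sup_le fun g hg => ?_
  obtain ⟨M, t, rfl⟩ := (Finset.mem_filter.mp hg).2
  refine Nat.sInf_le ⟨1, one_pos, ?_⟩
  rw [config_add]
  exact h M _ (Nat.le_add_right _ _)

theorem output_eq (h : ∀ (M : Λ.Model) (t : ℕ), D ≤ t →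
    Function.IsFixedPt Λ.step (Λ.config M t)) (M : Λ.Model) :
    Λ.output M = (Λ.print.sort (· ≤ ·)).map (Λ.config M D) := by
  have hne : {t : ℕ | Λ.step^[t] (Λ.init M) ∈ Function.periodicPts Λ.step}.Nonempty :=
    ⟨D, 1, one_pos, h M D le_rfl⟩
  obtain ⟨k, hk, hp⟩ := Nat.sInf_mem hne
  have hfix : Λ.config M (Λ.transientTimeOf (Λ.init M)) = Λ.config M D := by
    -- At the transient time the configuration is only known to be periodic, with some period `k`.
    -- Another `k * D` rounds return to it and end no earlier than round `D`, where everything is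
    -- constant.
    have hp' : Λ.step^[k * D] (Λ.config M (Λ.transientTimeOf (Λ.init M))) = _ :=
      (hp.mul_const D : Function.IsPeriodicPt _ _ _)
    rw [config_add] at hp'
    refine hp'.symm.trans (config_eq_of_stable h M ?_)
    exact (Nat.le_mul_of_pos_left D hk).trans (Nat.le_add_right _ _)
  rw [output, hfix]

end Program

open Program in
/-- A circuit between two families of `n` predicates gives a halting program with `n` input and `n`
print predicates. -/
theorem Computes.exists_program {A : Type} {n s d : ℕ} {u v : Fin n → A → Prop}
    (h : Computes (Set.range u) (Set.range v) s d) :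
    ∃ (T : Finset ℕ) (Λ : Program T), Λ.IsHalting ∧ Λ.inputs.card = n ∧ Λ.print.card = n ∧
      (∀ (a : A) (w w' : List Bool), w.length = n → w'.length = n →
        (∀ j : Fin n, w.getD j false = true ↔ u j a) →
        (∀ j : Fin n, w'.getD j false = true ↔ v j a) → Λ.output (Λ.modelOf w) = w') ∧
      Λ.size ≤ 6 * s + 12 * n + 5 * (d + 2) ∧ Λ.transientTime ≤ d + 1 := by
  classical
  obtain ⟨ι, _, g, rk, c, hg, hrk, hs, hv⟩ := h
  -- The four kinds of variables are inputs, gates, outputs and clock bits. Clock bit `k` is true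
  -- exactly from round `k` on, so some bit changes after each round `t ≤ d`, and the last bit
  -- signals round `d + 1`.
  let I := Fin n ⊕ ι ⊕ Fin n ⊕ Fin (d + 2)
  let sem : I → A → Prop := Sum.elim u (Sum.elim g fun _ _ => False)
  have hφ : ∀ i : ι, ∃ φ : Formula I, φ.size ≤ 4 * c i + 2 ∧
      (∀ x y : I → Bool, (∀ X ∈ Set.range Sum.inl ∪ {X | ∃ j, rk j < rk i ∧ Sum.inr (Sum.inl j) = X},
        x X = y X) → φ.eval x = φ.eval y) ∧
      ∀ (a : A) (x : I → Bool), (∀ X ∈ Set.range Sum.inl ∪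
        {X | ∃ j, rk j < rk i ∧ Sum.inr (Sum.inl j) = X}, (x X = true ↔ sem X a)) →
        (φ.eval x = true ↔ g i a) := fun i => by
    refine (hg i).exists_formula (R := Set.range Sum.inl ∪
        {X | ∃ j, rk j < rk i ∧ Sum.inr (Sum.inl j) = X}) (sem := sem) ?_
    rintro f (⟨j, rfl⟩ | ⟨j, hj, rfl⟩)
    · exact ⟨Sum.inl j, Or.inl ⟨j, rfl⟩, rfl⟩
    · exact ⟨Sum.inr (Sum.inl j), Or.inr ⟨j, hj, rfl⟩, rfl⟩
  have hψ : ∀ k : Fin n, ∃ φ : Formula I, φ.size ≤ 4 * 1 + 2 ∧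
      (∀ x y : I → Bool, (∀ X ∈ Set.range Sum.inl ∪ Set.range fun j => Sum.inr (Sum.inl j),
        x X = y X) → φ.eval x = φ.eval y) ∧
      ∀ (a : A) (x : I → Bool), (∀ X ∈ Set.range Sum.inl ∪ Set.range fun j => Sum.inr (Sum.inl j),
        (x X = true ↔ sem X a)) → (φ.eval x = true ↔ v k a) := fun k => by
    refine (hv (v k) ⟨k, rfl⟩).exists_formula (R := Set.range Sum.inl ∪
        Set.range fun j => Sum.inr (Sum.inl j)) (sem := sem) ?_
    rintro f (⟨j, rfl⟩ | ⟨j, rfl⟩)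
    · exact ⟨Sum.inl j, Or.inl ⟨j, rfl⟩, rfl⟩
    · exact ⟨Sum.inr (Sum.inl j), Or.inr ⟨j, rfl⟩, rfl⟩
  choose φ hφs hφd hφe using hφ
  choose ψ hψs hψd hψe using hψ
  let m := Fintype.card ι
  let N := n + (m + (n + (d + 2)))
  -- The blocks are numbered consecutively, each increasingly. Thus the order of the variables
  -- reproduces the order of the input string and of the output string.
  let E₀ : I ≃ Fin N := (Equiv.sumCongr (Equiv.refl _) ((Equiv.sumCongr (Fintype.equivFin ι)
    finSumFinEquiv).trans finSumFinEquiv)).trans finSumFinEquiv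
  let E : I ≃ ↥(Finset.range N) := E₀.trans
    { toFun := fun k => ⟨k.1, Finset.mem_range.mpr k.2⟩
      invFun := fun k => ⟨k.1, Finset.mem_range.mp k.2⟩
      left_inv := fun _ => rfl
      right_inv := fun _ => rfl }
  have hE₂ : ∀ j : Fin n, (E (Sum.inr (Sum.inr (Sum.inl j))) : ℕ) = n + (m + j) := fun j => rfl
  let term : I → Option Bool := Sum.elim (fun _ => none) (Sum.elim (fun _ => some false)
    (Sum.elim (fun _ => some false) fun k => some (decide (k = 0))))
  let body : I → Formula I := Sum.elim (fun j => .var (Sum.inl j)) (Sum.elim φ (Sum.elim ψ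
    fun k => if k = 0 then .top else .var (Sum.inr (Sum.inr (Sum.inr (k - 1))))))
  let att : I := Sum.inr (Sum.inr (Sum.inr (Fin.last (d + 1))))
  let prt : Fin n ↪ I := ⟨fun j => Sum.inr (Sum.inr (Sum.inl j)), fun i j h =>
    Sum.inl_injective (Sum.inr_injective (Sum.inr_injective h))⟩
  let Λ : Program ↥(Finset.range N) := ofEquiv E att term body (Finset.univ.map prt)
  have hterm : ∀ i, Λ.terminal (E i) = term i := fun i => by simp [Λ, ofEquiv]
  have hsucc : ∀ (M : Λ.Model) (t : ℕ) (i : I), Λ.config M (t + 1) (E i) =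
      (body i).eval fun j => Λ.config M t (E j) :=
    fun M t i => ofEquiv_config_succ E att term body _ M t i
  have hinp : ∀ (M : Λ.Model) (t : ℕ) (j : Fin n),
      Λ.config M (t + 1) (E (Sum.inl j)) = Λ.config M t (E (Sum.inl j)) :=
    fun M t j => hsucc M t _
  have hinp' : ∀ (M : Λ.Model) (t : ℕ) (j : Fin n),
      Λ.config M t (E (Sum.inl j)) = Λ.config M 0 (E (Sum.inl j)) := fun M t j => by
    induction t with
    | zero => rfl
    | succ t ih => rw [hinp, ih]
  have hclk : ∀ (M : Λ.Model) (t : ℕ) (k : Fin (d + 2)),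
      Λ.config M t (E (Sum.inr (Sum.inr (Sum.inr k)))) = decide ((k : ℕ) ≤ t) := fun M t => by
    induction t with
    | zero =>
      intro k
      have h₀ := Λ.init_of_some M (hterm (Sum.inr (Sum.inr (Sum.inr k))))
      refine h₀.trans (decide_eq_decide.mpr ?_)
      rw [Fin.ext_iff]
      exact Nat.le_zero.symm
    | succ t ih =>
      intro k
      rw [hsucc]
      by_cases hk : k = 0
      · simp [body, hk, Formula.eval]
      · have hk' : ((k - 1 : Fin (d + 2)) : ℕ) = k - 1 := Fin.val_sub_one_of_ne_zero hk
        have h₁ : (k : ℕ) ≠ 0 := fun h => hk (Fin.ext h)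
        have : (body (Sum.inr (Sum.inr (Sum.inr k)))) =
          .var (Sum.inr (Sum.inr (Sum.inr (k - 1)))) := by simp [body, hk]
        rw [this]
        change Λ.config M t (E (Sum.inr (Sum.inr (Sum.inr (k - 1))))) = _
        rw [ih, hk', decide_eq_decide]
        omega
  -- Stabilization is proved for every valuation of the inputs from the locality of the formulas
  -- alone. Correctness, in `hsem`, additionally requires the inputs to represent some `a`.
  have hgate : ∀ (M : Λ.Model) (r : ℕ) (i : ι), rk i < r → ∀ t, r ≤ t →
      Λ.config M (t + 1) (E (Sum.inr (Sum.inl i))) = Λ.config M t (E (Sum.inr (Sum.inl i))) := by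
    intro M r
    induction r with
    | zero => intro i hi; omega
    | succ r ih =>
      intro i hi t ht
      obtain ⟨t, rfl⟩ : ∃ t', t = t' + 1 := ⟨t - 1, by omega⟩
      rw [hsucc, hsucc]
      refine hφd i _ _ ?_
      rintro X (⟨j, rfl⟩ | ⟨j, hj, rfl⟩)
      · exact hinp M t j
      · exact ih j (by omega) t (by omega)
  have hfix : ∀ (M : Λ.Model) (t : ℕ), d + 1 ≤ t → Function.IsFixedPt Λ.step (Λ.config M t) := by
    intro M t ht
    obtain ⟨t, rfl⟩ : ∃ t', t = t' + 1 := ⟨t - 1, by omega⟩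
    change Λ.step _ = _
    rw [← config_succ]
    funext X
    obtain ⟨X, rfl⟩ := E.surjective X
    obtain j | i | j | k := X
    · exact hinp M _ j
    · exact hgate M d i (hrk i) _ (by omega)
    · rw [hsucc, hsucc]
      refine hψd j _ _ ?_
      rintro X (⟨j, rfl⟩ | ⟨i, rfl⟩)
      · exact hinp M t j
      · exact hgate M d i (hrk i) _ (by omega)
    · rw [hclk, hclk, decide_eq_decide]
      omega
  have hnfix : ∀ (M : Λ.Model) (t : ℕ), t < d + 1 → ¬ Function.IsFixedPt Λ.step (Λ.config M t) := by
    intro M t ht hf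
    have h₁ : Λ.config M (t + 1) = Λ.config M t := (config_succ Λ M t).trans hf
    have h₂ := congrFun h₁ (E (Sum.inr (Sum.inr (Sum.inr ⟨t + 1, by omega⟩))))
    rw [hclk, hclk, decide_eq_decide] at h₂
    simp at h₂
  have hsem : ∀ (a : A) (w : List Bool), (∀ j : Fin n, w.getD j false = true ↔ u j a) →
      (∀ j : Fin n, Λ.config (Λ.modelOf w) 0 (E (Sum.inl j)) = true ↔ u j a) →
      ∀ (r : ℕ) (i : ι), rk i < r → ∀ t, r ≤ t →
        (Λ.config (Λ.modelOf w) t (E (Sum.inr (Sum.inl i))) = true ↔ g i a) := by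
    intro a w hw hw0 r
    induction r with
    | zero => intro i hi; omega
    | succ r ih =>
      intro i hi t ht
      obtain ⟨t, rfl⟩ : ∃ t', t = t' + 1 := ⟨t - 1, by omega⟩
      rw [hsucc]
      refine hφe i a _ ?_
      rintro X (⟨j, rfl⟩ | ⟨j, hj, rfl⟩)
      · rw [hinp']; exact hw0 j
      · exact ih j (by omega) t (by omega)
  have hinputs : Λ.inputs = Finset.univ.map ((Function.Embedding.inl : Fin n ↪ I).trans
      E.toEmbedding) := by
    ext X
    obtain ⟨X, rfl⟩ := E.surjective X
    simp only [inputs, Finset.mem_filter, Finset.mem_univ, true_and, hterm, Finset.mem_map,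
      Function.Embedding.trans_apply, Equiv.coe_toEmbedding, EmbeddingLike.apply_eq_iff_eq]
    obtain j | i | j | k := X <;> simp [term]
  have hcount : ∀ j : Fin n, (Λ.inputs.filter fun Y => Y < E (Sum.inl j)).card = j := by
    intro j
    rw [hinputs, Finset.filter_map, Finset.card_map]
    have : (Finset.univ.filter fun i : Fin n => i < j).card = j := by
      rw [Finset.filter_gt_eq_Iio, Fin.card_Iio]
    rw [← this]
    congr 1
  have hprint : Λ.print.sort (· ≤ ·) = (List.finRange n).map fun j => E (prt j) := by
    have h₁ : Λ.print = ((List.finRange n).map fun j => E (prt j)).toFinset := by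
      ext X
      simp only [Λ, ofEquiv, Finset.mem_map, Finset.mem_univ, true_and,
        List.mem_toFinset, List.mem_map, List.mem_finRange]
      constructor
      · rintro ⟨_, ⟨j, rfl⟩, h⟩
        exact ⟨j, h⟩
      · rintro ⟨j, h⟩
        exact ⟨_, ⟨j, rfl⟩, h⟩
    have h₂ : ((List.finRange n).map fun j => E (prt j)).Nodup :=
      (List.nodup_finRange n).map (E.injective.comp prt.injective)
    rw [h₁, List.toFinset_sort _ h₂, List.pairwise_map]
    refine (List.pairwise_lt_finRange n).imp ?_
    intro i j hij
    change (E (Sum.inr (Sum.inr (Sum.inl i))) : ℕ) ≤ E (Sum.inr (Sum.inr (Sum.inl j)))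
    rw [hE₂, hE₂]
    have : (i : ℕ) < j := hij
    omega
  refine ⟨Finset.range N, Λ, ⟨fun M => ⟨_, hfix M _ le_rfl⟩, fun M t => ?_⟩, ?_, ?_, ?_, ?_,
    transientTime_le hfix⟩
  · have h₁ : Λ.OutputsAt M t ↔ Λ.config M t (E att) = true := by
      simp [OutputsAt, Λ, ofEquiv]
    rw [h₁, hclk]
    simp only [decide_eq_true_eq, Fin.val_last]
    exact ⟨hfix M t, fun h => by by_contra h'; exact hnfix M t (by omega) h⟩
  · rw [hinputs, Finset.card_map, Finset.card_univ, Fintype.card_fin]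
  · simp [Λ, ofEquiv]
  · intro a w w' hw hw' hu hv'
    have hw0 : ∀ j : Fin n, Λ.config (Λ.modelOf w) 0 (E (Sum.inl j)) = true ↔ u j a := by
      intro j
      have h₀ : Λ.config (Λ.modelOf w) 0 (E (Sum.inl j)) = w.getD j false :=
        (Λ.init_of_none _ (hterm (Sum.inl j))).trans (by
          change w.getD (Λ.inputs.filter fun Y => Y < E (Sum.inl j)).card false = _
          rw [hcount])
      rw [h₀, hu]
    rw [output_eq hfix, hprint, List.map_map]
    refine List.ext_getElem (by simp [hw']) fun k hk hk' => ?_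
    have hkn : k < n := hw' ▸ hk'
    have h₁ := hv' ⟨k, hkn⟩
    have h₂ : w'.getD k false = w'[k] := by simp [hk']
    simp only [h₂] at h₁
    simp only [List.getElem_map, List.getElem_finRange, Function.comp_apply]
    rw [Bool.eq_iff_iff, h₁]
    change Λ.config (Λ.modelOf w) (d + 1) (E (Sum.inr (Sum.inr (Sum.inl ⟨k, hkn⟩)))) = true ↔ _
    rw [hsucc]
    refine hψe _ a _ ?_
    rintro X (⟨j, rfl⟩ | ⟨i, rfl⟩)
    · rw [hinp']; exact hw0 j
    · exact hsem a w hu hw0 d i (hrk i) d le_rfl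
  · have h₁ : Λ.size = ∑ i : I, (terminalSize (term i) + (1 + (body i).size)) := by
      rw [size, ← E.sum_comp]
      refine Finset.sum_congr rfl fun i _ => ?_
      simp [Λ, ofEquiv, Formula.size_rename]
    rw [h₁, Fintype.sum_sum_type, Fintype.sum_sum_type, Fintype.sum_sum_type]
    have b₁ : ∑ j : Fin n, (terminalSize (term (Sum.inl j)) + (1 + (body (Sum.inl j)).size)) ≤
        2 * n := by
      refine (Finset.sum_le_card_nsmul _ _ 2 fun j _ => ?_).trans (by simp [mul_comm])
      simp [term, body, terminalSize, Formula.size]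
    -- A gate pays 3 for its terminal clause, 1 for the head and at most 4c + 2 for the body, in
    -- total at most 6(c + 1).
    have b₂ : ∑ j : ι, (terminalSize (term (Sum.inr (Sum.inl j))) +
        (1 + (body (Sum.inr (Sum.inl j))).size)) ≤ 6 * s := by
      refine le_trans ?_ (Nat.mul_le_mul_left 6 hs)
      rw [Finset.mul_sum]
      refine Finset.sum_le_sum fun j _ => ?_
      have := hφs j
      simp only [term, body, terminalSize, Sum.elim_inr, Sum.elim_inl]
      omega
    have b₃ : ∑ j : Fin n, (terminalSize (term (Sum.inr (Sum.inr (Sum.inl j)))) +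
        (1 + (body (Sum.inr (Sum.inr (Sum.inl j)))).size)) ≤ 10 * n := by
      refine (Finset.sum_le_card_nsmul _ _ 10 fun j _ => ?_).trans (by simp [mul_comm])
      have := hψs j
      simp only [term, body, terminalSize, Sum.elim_inr, Sum.elim_inl]
      omega
    have b₄ : ∑ j : Fin (d + 2), (terminalSize (term (Sum.inr (Sum.inr (Sum.inr j)))) +
        (1 + (body (Sum.inr (Sum.inr (Sum.inr j)))).size)) ≤ 5 * (d + 2) := by
      refine (Finset.sum_le_card_nsmul _ _ 5 fun j _ => ?_).trans (by simp [mul_comm])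
      by_cases hj : j = 0 <;> simp [term, body, terminalSize, hj, Formula.size]
    omega

end BNL

/-! ## Integer arithmetic in base `β`, with negative numbers in complement form -/

namespace FPSystem

open BNL

variable {A : Type} {U V : Set (A → Prop)} (S : FPSystem)

/-- The number of digits of all intermediate integers. -/
def width : ℕ := 16 * max S.p S.q

/-- The unit in which circuit sizes are measured. -/
def unit : ℕ := S.width ^ 4 + S.width ^ 3 * S.β ^ 2 + S.width * S.β ^ 4

/-- A bound for the size of an adder. -/
def addCost : ℕ := 20 * (S.width ^ 2 + S.width * S.β ^ 3)

theorem width_pos : 1 ≤ S.width := by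
  have := S.p_pos
  have := le_max_left S.p S.q
  unfold width; omega

theorem β_pos : 0 < S.β := by have := S.two_le_β; omega

theorem addCost_le : S.addCost ≤ 40 * S.unit := by
  have h₁ : S.width ^ 2 ≤ S.width ^ 4 := Nat.pow_le_pow_right S.width_pos (by norm_num)
  have h₂ : S.width * S.β ^ 3 ≤ S.width * S.β ^ 4 :=
    Nat.mul_le_mul_left _ (Nat.pow_le_pow_right S.β_pos (by norm_num))
  unfold addCost unit
  omega

/-- The predicates `digit i of z is c` for all positions `i` below the width. -/
def digits (z : A → ℤ) : Set (A → Prop) :=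
  {f | ∃ i < S.width, ∃ c : ℕ, f = fun a => z a / (S.β : ℤ) ^ i % S.β = c}

variable {S} {w y z : A → ℤ} {c : A → Prop}

theorem β_cast_pos : (0 : ℤ) < S.β := by exact_mod_cast S.β_pos

theorem β_pow_pos (i : ℕ) : (0 : ℤ) < (S.β : ℤ) ^ i := pow_pos β_cast_pos i

theorem emod_pow_succ (x : ℤ) (i : ℕ) :
    x % (S.β : ℤ) ^ (i + 1) = x % (S.β : ℤ) ^ i + (S.β : ℤ) ^ i * (x / (S.β : ℤ) ^ i % S.β) := by
  rw [pow_succ, Int.emod_def, Int.emod_def x, Int.emod_def (x / _),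
    ← Int.ediv_ediv_of_nonneg (β_pow_pos i).le]
  ring

/-- With `P` the power `β ^ i`, the low parts together with `g` sum to less than 2P, so they
contribute a carry of 0 or 1 to position `i`. A digit sum of at least β generates a carry, a digit
sum of β - 1 propagates the incoming one, and a smaller digit sum absorbs it. -/
theorem carry_succ (x x' g : ℤ) (i : ℕ) (hg : 0 ≤ g) (hg' : g ≤ 1) :
    (S.β : ℤ) ^ (i + 1) ≤ x % (S.β : ℤ) ^ (i + 1) + x' % (S.β : ℤ) ^ (i + 1) + g ↔
      ((S.β : ℤ) ≤ x / (S.β : ℤ) ^ i % S.β + x' / (S.β : ℤ) ^ i % S.β ∨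
        ((S.β : ℤ) - 1 ≤ x / (S.β : ℤ) ^ i % S.β + x' / (S.β : ℤ) ^ i % S.β ∧
          (S.β : ℤ) ^ i ≤ x % (S.β : ℤ) ^ i + x' % (S.β : ℤ) ^ i + g)) := by
  have hp := β_pow_pos (S := S) i
  rw [emod_pow_succ, emod_pow_succ, pow_succ]
  have h₁ := Int.emod_nonneg x hp.ne'
  have h₂ := Int.emod_lt_of_pos x hp
  have h₃ := Int.emod_nonneg x' hp.ne'
  have h₄ := Int.emod_lt_of_pos x' hp
  generalize x / (S.β : ℤ) ^ i % S.β = u at *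
  generalize x' / (S.β : ℤ) ^ i % S.β = u' at *
  generalize x % (S.β : ℤ) ^ i = r at *
  generalize x' % (S.β : ℤ) ^ i = r' at *
  generalize (S.β : ℤ) ^ i = P at *
  generalize (S.β : ℤ) = b at *
  constructor
  · intro h
    by_contra! hc
    obtain ⟨hc₁, hc₂⟩ := hc
    rcases lt_or_ge (u + u') (b - 1) with hlt | hge
    · nlinarith [mul_le_mul_of_nonneg_left (show u + u' ≤ b - 2 by omega) hp.le]
    · have := hc₂ hge
      have e : u + u' = b - 1 := by omega
      have : P * u + P * u' = P * b - P := by rw [← mul_add, e]; ring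
      linarith
  · rintro (h | ⟨h, h'⟩)
    · nlinarith [mul_le_mul_of_nonneg_left h hp.le]
    · nlinarith [mul_le_mul_of_nonneg_left h hp.le]

open Classical in
theorem digit_add (x x' g : ℤ) (i : ℕ) (hg : 0 ≤ g) (hg' : g ≤ 1) :
    (x + x' + g) / (S.β : ℤ) ^ i % S.β =
      (x / (S.β : ℤ) ^ i % S.β + x' / (S.β : ℤ) ^ i % S.β +
        if (S.β : ℤ) ^ i ≤ x % (S.β : ℤ) ^ i + x' % (S.β : ℤ) ^ i + g then 1 else 0) % S.β := by
  have hp := β_pow_pos (S := S) i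
  have h₁ := Int.emod_nonneg x hp.ne'
  have h₂ := Int.emod_lt_of_pos x hp
  have h₃ := Int.emod_nonneg x' hp.ne'
  have h₄ := Int.emod_lt_of_pos x' hp
  have e₁ := Int.mul_ediv_add_emod x ((S.β : ℤ) ^ i)
  have e₂ := Int.mul_ediv_add_emod x' ((S.β : ℤ) ^ i)
  have e : x + x' + g = (x % (S.β : ℤ) ^ i + x' % (S.β : ℤ) ^ i + g) +
      (S.β : ℤ) ^ i * (x / (S.β : ℤ) ^ i + x' / (S.β : ℤ) ^ i) := by
    rw [mul_add]; linarith
  rw [e, Int.add_mul_ediv_left _ _ hp.ne']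
  have hq : (x % (S.β : ℤ) ^ i + x' % (S.β : ℤ) ^ i + g) / (S.β : ℤ) ^ i =
      if (S.β : ℤ) ^ i ≤ x % (S.β : ℤ) ^ i + x' % (S.β : ℤ) ^ i + g then 1 else 0 := by
    split_ifs with h
    · rw [Int.ediv_eq_iff_of_pos hp]
      constructor <;> linarith
    · exact Int.ediv_eq_zero_of_lt (by linarith) (by linarith)
  rw [hq, add_comm]
  simp [Int.add_emod]

theorem mem_digits {i : ℕ} (hi : i < S.width) (c : ℕ) :
    (fun a => z a / (S.β : ℤ) ^ i % S.β = c) ∈ S.digits z := ⟨i, hi, c, rfl⟩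

theorem exists_digit (x : ℤ) (i : ℕ) : ∃ c < S.β, x / (S.β : ℤ) ^ i % S.β = (c : ℕ) := by
  have h₁ := Int.emod_nonneg (x / (S.β : ℤ) ^ i) (β_cast_pos (S := S)).ne'
  have h₂ := Int.emod_lt_of_pos (x / (S.β : ℤ) ^ i) (β_cast_pos (S := S))
  exact ⟨(x / (S.β : ℤ) ^ i % S.β).toNat, by omega, by omega⟩

theorem literal_of_lt (h : ∀ i < S.width, ∀ c < S.β,
    Definable U 1 (fun a => z a / (S.β : ℤ) ^ i % S.β = (c : ℕ))) :
    ∀ f ∈ S.digits z, Definable U 1 f := by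
  rintro f ⟨i, hi, c, rfl⟩
  by_cases hc : c < S.β
  · exact h i hi c hc
  · refine (Definable.trivial False).of_iff fun a => ?_
    have h₂ := Int.emod_lt_of_pos (z a / (S.β : ℤ) ^ i) (β_cast_pos (S := S))
    simp only [iff_false]
    omega

theorem computes_digits {k : ℕ} (h : ∀ i < S.width, ∀ c < S.β,
    Definable U k (fun a => z a / (S.β : ℤ) ^ i % S.β = (c : ℕ))) :
    Computes U (S.digits z) (S.width * S.β * (k + 1)) 1 := by
  have := Computes.layer (U := U) (κ := Fin S.width × Fin S.β) (c := k)
    (fun x a => z a / (S.β : ℤ) ^ (x.1 : ℕ) % S.β = ((x.2 : ℕ) : ℤ)) fun x => h _ x.1.2 _ x.2.2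
  refine (this.mono (by simp) le_rfl).literal (literal_of_lt fun i hi c hc => .var ?_)
  exact ⟨(⟨i, hi⟩, ⟨c, hc⟩), rfl⟩

-- Carry look-ahead in three layers. The first computes for each position whether it generates a
-- carry and whether it at least propagates one. In the second, the recursion for the carry is
-- unfolded into a single formula; each step mentions the previous carry only once, so the formula
-- has 2i + 1 atoms and all carries together cost O(W²). The third reads off the digits from two
-- digits and a carry. No bound on the integers is needed, because the low digits of a sum depend
-- only on the low digits of the summands.
open Classical in
theorem computes_add_aux (hz : ∀ f ∈ S.digits z, Definable U 1 f)
    (hw : ∀ f ∈ S.digits w, Definable U 1 f) (hc : Definable U 1 c)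
    (hy : ∀ a, y a = z a + w a + if c a then 1 else 0) :
    Computes U (S.digits y) S.addCost 3 := by
  let g : A → ℤ := fun a => if c a then 1 else 0
  have hg : ∀ a, 0 ≤ g a ∧ g a ≤ 1 := fun a => by simp only [g]; split_ifs <;> simp
  let pre : Fin S.width × Bool → A → Prop := fun x a =>
    (S.β : ℤ) - (if x.2 then 1 else 0) ≤
      z a / (S.β : ℤ) ^ (x.1 : ℕ) % S.β + w a / (S.β : ℤ) ^ (x.1 : ℕ) % S.β
  let carry : ℕ → A → Prop := fun i a =>
    (S.β : ℤ) ^ i ≤ z a % (S.β : ℤ) ^ i + w a % (S.β : ℤ) ^ i + g a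
  have h₁ : Computes U (Set.range pre) (S.width * 2 * (S.β * (S.β * 2) + 1)) 1 := by
    refine (Computes.layer pre (c := S.β * (S.β * 2)) fun x => ?_).mono (by simp) le_rfl
    have := Definable.exists_lt (U := U) (N := S.β) (c := S.β * 2) (r := fun c₁ a => ∃ c₂ < S.β,
      (((S.β : ℤ) - (if x.2 then 1 else 0) ≤ (c₁ : ℤ) + (c₂ : ℤ)) ∧
      (z a / (S.β : ℤ) ^ (x.1 : ℕ) % S.β = (c₁ : ℕ) ∧ w a / (S.β : ℤ) ^ (x.1 : ℕ) % S.β = (c₂ : ℕ))))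
      fun c₁ _ => Definable.exists_lt fun c₂ _ => ((Definable.const _).and
        ((hz _ (mem_digits x.1.2 c₁)).and (hw _ (mem_digits x.1.2 c₂)))).mono (by simp)
    refine this.of_iff fun a => ?_
    constructor
    · intro h
      obtain ⟨c₁, hc₁, e₁⟩ := exists_digit (S := S) (z a) x.1
      obtain ⟨c₂, hc₂, e₂⟩ := exists_digit (S := S) (w a) x.1
      exact ⟨c₁, hc₁, c₂, hc₂, by rw [← e₁, ← e₂]; exact h, e₁, e₂⟩
    · rintro ⟨c₁, _, c₂, _, h, e₁, e₂⟩
      change _ ≤ _ + _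
      rw [e₁, e₂]
      exact h
  have h₂ : ∀ i < S.width, Definable (U ∪ Set.range pre) (2 * i + 1) (carry i) := by
    intro i
    induction i with
    | zero =>
      intro _
      refine (hc.superset Set.subset_union_left).of_iff fun a => ?_
      simp only [carry, g, pow_zero, Int.emod_one]
      split_ifs with h <;> simp [h]
    | succ i ih =>
      intro hi
      have hi' : i < S.width := by omega
      have p₁ : Definable (U ∪ Set.range pre) 1 (pre (⟨i, hi'⟩, false)) := .var (Or.inr ⟨_, rfl⟩)
      have p₂ : Definable (U ∪ Set.range pre) 1 (pre (⟨i, hi'⟩, true)) := .var (Or.inr ⟨_, rfl⟩)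
      refine ((p₁.or (p₂.and (ih hi'))).mono (by omega)).of_iff fun a => ?_
      simp only [carry, pre]
      rw [carry_succ _ _ _ _ (hg a).1 (hg a).2]
      simp
  have h₃ := Computes.layer (U := U ∪ Set.range pre) (κ := Fin S.width) (c := 2 * S.width)
    (fun i => carry i) fun i => (h₂ i i.2).mono (by have := i.2; omega)
  have h₄ := h₁.trans_union h₃
  have h₅ : Computes (U ∪ (Set.range pre ∪ Set.range fun i : Fin S.width => carry i))
      (S.digits y) (S.width * S.β * (S.β * (S.β * 4) + 1)) 1 := by
    refine computes_digits fun i hi d hd => ?_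
    have hC : Definable (U ∪ (Set.range pre ∪ Set.range fun i : Fin S.width => carry i)) 1
      (carry i) := .var (Or.inr (Or.inr ⟨⟨i, hi⟩, rfl⟩))
    have := Definable.exists_lt (N := S.β) (c := S.β * 4) (r := fun c₁ a => ∃ c₂ < S.β,
      (((((c₁ + c₂ + 1) % S.β = d) ∧ carry i a) ∨ (((c₁ + c₂) % S.β = d) ∧ ¬ carry i a)) ∧
      (z a / (S.β : ℤ) ^ i % S.β = (c₁ : ℕ) ∧ w a / (S.β : ℤ) ^ i % S.β = (c₂ : ℕ))))
      fun c₁ _ => Definable.exists_lt fun c₂ _ => (((((Definable.const _).and hC).or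
        ((Definable.const _).and hC.not))).and
        (((hz _ (mem_digits hi c₁)).superset Set.subset_union_left).and
          ((hw _ (mem_digits hi c₂)).superset Set.subset_union_left))).mono (by simp)
    refine this.of_iff fun a => ?_
    have key : y a / (S.β : ℤ) ^ i % S.β = (z a / (S.β : ℤ) ^ i % S.β +
      w a / (S.β : ℤ) ^ i % S.β + if carry i a then 1 else 0) % S.β := by
      rw [hy]
      exact digit_add _ _ _ _ (hg a).1 (hg a).2
    rw [key]
    constructor
    · intro h
      obtain ⟨c₁, hc₁, e₁⟩ := exists_digit (S := S) (z a) i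
      obtain ⟨c₂, hc₂, e₂⟩ := exists_digit (S := S) (w a) i
      refine ⟨c₁, hc₁, c₂, hc₂, ?_, e₁, e₂⟩
      rw [e₁, e₂] at h
      by_cases hca : carry i a
      · rw [if_pos hca] at h
        exact Or.inl ⟨by exact_mod_cast h, hca⟩
      · rw [if_neg hca, add_zero] at h
        exact Or.inr ⟨by exact_mod_cast h, hca⟩
    · rintro ⟨c₁, _, c₂, _, h, e₁, e₂⟩
      rw [e₁, e₂]
      rcases h with ⟨h, hca⟩ | ⟨h, hca⟩
      · rw [if_pos hca]; exact_mod_cast h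
      · rw [if_neg hca, add_zero]; exact_mod_cast h
  have h₆ := (h₄.trans_union h₅).subset Set.subset_union_right
  refine h₆.mono ?_ le_rfl
  have hW := S.width_pos
  have hβ := S.β_pos
  rw [Fintype.card_fin]
  unfold addCost
  have a₁ : S.width * S.β ^ 2 ≤ S.width * S.β ^ 3 :=
    Nat.mul_le_mul_left _ (Nat.pow_le_pow_right S.β_pos (by norm_num))
  have a₂ : S.width * S.β ≤ S.width * S.β ^ 3 :=
    Nat.mul_le_mul_left _ (Nat.le_self_pow (by norm_num) _)
  have a₃ : S.width ≤ S.width ^ 2 := Nat.le_self_pow (by norm_num) _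
  nlinarith

end FPSystem

/-! ### Circuits measured in units: sums, comparisons, selections, shifts, products -/

namespace FPSystem

open BNL

variable {A : Type} {U V : Set (A → Prop)} {S : FPSystem}
variable {w y z : A → ℤ} {c p q : A → Prop} {k k' k'' d d' d'' : ℕ}

variable (S) in
/-- `V` is computed from `U` by a circuit of size at most `k` units and depth at most `d`. -/
def Circuit (U V : Set (A → Prop)) (k d : ℕ) : Prop := Computes U V (k * S.unit) d

variable (S) in
/-- The depth of logarithmic stages. -/
def logDepth : ℕ := Nat.clog 2 S.β + Nat.clog 2 S.width

theorem unit_pos : 1 ≤ S.unit := by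
  have : 1 ≤ S.width ^ 4 := Nat.one_le_pow _ _ S.width_pos
  unfold unit; omega

theorem width_mul_β_le (S : FPSystem) : S.width ^ 2 * S.β ≤ S.unit := by
  have h : S.width ^ 2 * S.β ≤ S.width ^ 3 * S.β ^ 2 := Nat.mul_le_mul
    (Nat.pow_le_pow_right S.width_pos (by norm_num)) (Nat.le_self_pow (by norm_num) _)
  unfold unit; omega

theorem width_β_le (S : FPSystem) : S.width * S.β ≤ S.unit :=
  (Nat.mul_le_mul_right _ (Nat.le_self_pow (by norm_num) _)).trans S.width_mul_β_le

theorem width_le_unit (S : FPSystem) : S.width ≤ S.unit :=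
  (Nat.le_mul_of_pos_right _ S.β_pos).trans S.width_β_le

namespace Circuit

theorem mono (h : S.Circuit U V k d) (hk : k ≤ k') (hd : d ≤ d') : S.Circuit U V k' d' :=
  Computes.mono h (Nat.mul_le_mul_right _ hk) hd

theorem of_computes {s : ℕ} (h : Computes U V s d) (hs : s ≤ k * S.unit) : S.Circuit U V k d :=
  h.mono hs le_rfl

theorem of_subset (h : V ⊆ U) : S.Circuit U V 0 0 := Computes.of_subset h

theorem literal {W : Set (A → Prop)} (h : S.Circuit U V k d) (hW : ∀ v ∈ W, Definable V 1 v) :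
    S.Circuit U W k d := Computes.literal h hW

theorem subset {W : Set (A → Prop)} (h : S.Circuit U V k d) (hW : W ⊆ V) : S.Circuit U W k d :=
  Computes.subset h hW

theorem union {W : Set (A → Prop)} (h : S.Circuit U V k d) (h' : S.Circuit U W k' d') :
    S.Circuit U (V ∪ W) (k + k') (max d d') :=
  of_computes (Computes.union h h') (by rw [add_mul])

theorem trans {W : Set (A → Prop)} (h : S.Circuit U V k d) (h' : S.Circuit V W k' d') :
    S.Circuit U W (k + k') (d + d') :=
  of_computes (Computes.trans h h') (by rw [add_mul])

theorem trans_computes {W : Set (A → Prop)} {s : ℕ} (h : S.Circuit U V k d)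
    (h' : Computes V W s d') (hs : s ≤ k' * S.unit) : S.Circuit U W (k + k') (d + d') :=
  h.trans (of_computes h' hs)

theorem single {n : ℕ} (h : S.Circuit U V k d) (hp : Definable V n p) (hn : n < S.unit) :
    S.Circuit U {p} (k + 1) (d + 1) :=
  h.trans_computes (Computes.single hp) (by omega)

theorem of_singleton (h : S.Circuit U {p} k d) (hq : ∀ a, q a ↔ p a) : S.Circuit U {q} k d :=
  h.literal fun v hv => by
    rw [Set.mem_singleton_iff.mp hv]
    exact (Definable.var (Set.mem_singleton p)).of_iff hq

theorem not (h : S.Circuit U {p} k d) (hq : ∀ a, q a ↔ ¬ p a) : S.Circuit U {q} k d :=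
  h.literal fun v hv => by
    rw [Set.mem_singleton_iff.mp hv]
    exact (Definable.var (Set.mem_singleton p)).not.of_iff hq

theorem two_lt_unit (S : FPSystem) : 2 < S.unit := by
  have := S.width_le_unit
  have := S.p_pos
  have := le_max_left S.p S.q
  unfold width at *
  omega

theorem and {r : A → Prop} (h : S.Circuit U {p} k d) (h' : S.Circuit U {q} k' d')
    (hr : ∀ a, r a ↔ p a ∧ q a) : S.Circuit U {r} (k + k' + 1) (max d d' + 1) :=
  ((h.union h').single ((Definable.var (Or.inl rfl)).and (Definable.var (Or.inr rfl)))
    (two_lt_unit S)).of_singleton hr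

theorem or {r : A → Prop} (h : S.Circuit U {p} k d) (h' : S.Circuit U {q} k' d')
    (hr : ∀ a, r a ↔ p a ∨ q a) : S.Circuit U {r} (k + k' + 1) (max d d' + 1) :=
  ((h.union h').single ((Definable.var (Or.inl rfl)).or (Definable.var (Or.inr rfl)))
    (two_lt_unit S)).of_singleton hr

theorem const_prop (b : Prop) (h : ∀ a, p a ↔ b) : S.Circuit U {p} k d :=
  Computes.of_literal fun v hv => by
    rw [Set.mem_singleton_iff.mp hv]
    exact (Definable.trivial b).of_iff h

theorem const (n : ℤ) (h : ∀ a, z a = n) : S.Circuit U (S.digits z) k d :=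
  Computes.of_literal (literal_of_lt fun i _ c _ =>
    (Definable.trivial (n / (S.β : ℤ) ^ i % S.β = (c : ℕ))).of_iff fun a => by rw [h])

open Classical in
theorem add_carry (hz : S.Circuit U (S.digits z) k d) (hw : S.Circuit U (S.digits w) k' d')
    (hc : S.Circuit U {c} k'' d'') (hy : ∀ a, y a = z a + w a + if c a then 1 else 0) :
    S.Circuit U (S.digits y) (k + k' + k'' + 40) (max (max d d') d'' + 3) :=
  ((hz.union hw).union hc).trans_computes
    (computes_add_aux (fun _ hf => .var (Or.inl (Or.inl hf))) (fun _ hf => .var (Or.inl (Or.inr hf)))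
      (.var (Or.inr rfl)) hy) S.addCost_le

theorem add (hz : S.Circuit U (S.digits z) k d) (hw : S.Circuit U (S.digits w) k' d')
    (hy : ∀ a, y a = z a + w a) : S.Circuit U (S.digits y) (k + k' + 40) (max d d' + 3) :=
  (hz.add_carry (k'' := 0) (d'' := 0) hw (const_prop (p := fun _ => False) False fun _ => Iff.rfl)
    (fun a => by simp [hy])).mono le_rfl (by simp)

/-- If x = bq + r, then -x - 1 = b(-q - 1) + (b - 1 - r). Digitwise complementation only renames the
one-hot predicates, so subtraction is an addition of the complement with incoming carry 1. -/
theorem digit_compl (x : ℤ) (i : ℕ) :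
    (-x - 1) / (S.β : ℤ) ^ i % S.β = S.β - 1 - x / (S.β : ℤ) ^ i % S.β := by
  have key : ∀ (x b : ℤ), 0 < b → (-x - 1) / b = -(x / b) - 1 ∧ (-x - 1) % b = b - 1 - x % b := by
    intro x b hb
    have h₁ := Int.emod_nonneg x hb.ne'
    have h₂ := Int.emod_lt_of_pos x hb
    have h₃ := Int.mul_ediv_add_emod x b
    rw [Int.ediv_emod_unique hb]
    refine ⟨?_, by omega, by omega⟩
    linarith [show b * (-(x / b) - 1) = -(b * (x / b)) - b by ring]
  rw [(key x _ (β_pow_pos i)).1, (key _ _ β_cast_pos).2]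

theorem compl (hz : S.Circuit U (S.digits z) k d) (hy : ∀ a, y a = -z a - 1) :
    S.Circuit U (S.digits y) k d := by
  refine hz.literal (literal_of_lt fun i hi c hc => ?_)
  refine (Definable.var (mem_digits hi (S.β - 1 - c))).of_iff fun a => ?_
  rw [hy, digit_compl]
  have : ((S.β - 1 - c : ℕ) : ℤ) = S.β - 1 - c := by omega
  rw [this]
  constructor <;> intro h <;> linarith

theorem sub (hz : S.Circuit U (S.digits z) k d) (hw : S.Circuit U (S.digits w) k' d')
    (hy : ∀ a, y a = z a - w a) : S.Circuit U (S.digits y) (k + k' + 40) (max d d' + 3) :=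
  (hz.add_carry (k'' := 0) (d'' := 0) (hw.compl fun _ => rfl)
    (const_prop (p := fun _ => True) True fun _ => Iff.rfl)
    (fun a => by simp [hy]; ring)).mono le_rfl (by simp)

/-- The sign of an integer is visible in its leading digit. -/
theorem neg_iff_digit {x : ℤ} (h₁ : -(S.β : ℤ) ^ (S.width - 1) ≤ x)
    (h₂ : x < (S.β : ℤ) ^ (S.width - 1)) :
    x < 0 ↔ x / (S.β : ℤ) ^ (S.width - 1) % S.β = ((S.β - 1 : ℕ) : ℤ) := by
  have hβ := S.two_le_β
  have hp := β_pow_pos (S := S) (S.width - 1)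
  have e : ((S.β - 1 : ℕ) : ℤ) = S.β - 1 := by omega
  rw [e]
  rcases lt_or_ge x 0 with hx | hx
  · have : x / (S.β : ℤ) ^ (S.width - 1) = -1 := by
      rw [Int.ediv_eq_iff_of_pos hp]; constructor <;> linarith
    rw [this]
    have := (Int.ediv_emod_unique (a := -1) (q := -1) (r := (S.β : ℤ) - 1)
      (β_cast_pos (S := S))).mpr ⟨by ring, by omega, by omega⟩
    exact ⟨fun _ => this.2, fun _ => hx⟩
  · rw [Int.ediv_eq_zero_of_lt hx h₂, Int.zero_emod]
    constructor <;> intro h <;> omega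

/-- The leading digit of the difference shows its sign; the bound `hb` ensures that the difference
does not reach into that digit. -/
theorem lt (hz : S.Circuit U (S.digits z) k d) (hw : S.Circuit U (S.digits w) k' d')
    (hb : ∀ a, |z a - w a| < (S.β : ℤ) ^ (S.width - 1)) (hp : ∀ a, p a ↔ z a < w a) :
    S.Circuit U {p} (k + k' + 40) (max d d' + 3) := by
  refine (hz.sub hw (y := fun a => z a - w a) fun _ => rfl).literal fun v hv => ?_
  rw [Set.mem_singleton_iff.mp hv]
  refine (Definable.var (mem_digits (i := S.width - 1) (by have := S.width_pos; omega)
    (S.β - 1))).of_iff fun a => ?_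
  rw [hp, ← neg_iff_digit (abs_le.mp (hb a).le).1 (abs_lt.mp (hb a)).2, sub_neg]

theorem eq (hz : S.Circuit U (S.digits z) k d) (hw : S.Circuit U (S.digits w) k' d')
    (hb : ∀ a, |z a - w a| < (S.β : ℤ) ^ (S.width - 1)) (hp : ∀ a, p a ↔ z a = w a) :
    S.Circuit U {p} (2 * (k + k') + 81) (max d d' + 4) := by
  have h₁ := hz.lt hw hb (p := fun a => z a < w a) fun _ => Iff.rfl
  have h₂ := hw.lt hz (fun a => by rw [abs_sub_comm]; exact hb a)
    (p := fun a => w a < z a) fun _ => Iff.rfl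
  refine ((h₁.not (q := fun a => ¬ z a < w a) fun _ => Iff.rfl).and
    (h₂.not (q := fun a => ¬ w a < z a) fun _ => Iff.rfl) fun a => ?_).mono (by omega) (by omega)
  rw [hp]
  constructor
  · intro h; omega
  · intro h; omega

/-- The selectors need not exclude one another: it suffices that at least one holds and that `y`
agrees with every selected candidate. Each digit predicate is then a disjunction of `n` conjunctions
of two atoms. -/
theorem computes_select {n : ℕ} {s : ℕ → A → Prop} {x : ℕ → A → ℤ}
    (hs : ∀ j < n, Definable U 1 (s j)) (hx : ∀ j < n, ∀ f ∈ S.digits (x j), Definable U 1 f)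
    (hcover : ∀ a, ∃ j < n, s j a) (hy : ∀ a, ∀ j < n, s j a → y a = x j a) :
    Computes U (S.digits y) (S.width * S.β * (n * 2 + 1)) 1 := by
  refine computes_digits fun i hi c _ => ?_
  refine (Definable.exists_lt (r := fun j a => s j a ∧ x j a / (S.β : ℤ) ^ i % S.β = (c : ℕ))
    fun j hj => (hs j hj).and (hx j hj _ (mem_digits hi c))).of_iff fun a => ?_
  constructor
  · intro h
    obtain ⟨j, hj, hsj⟩ := hcover a
    exact ⟨j, hj, hsj, by rw [← hy a j hj hsj]; exact h⟩
  · rintro ⟨j, hj, hsj, h⟩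
    rw [hy a j hj hsj]; exact h

theorem ite (hc : S.Circuit U {c} k d) (hz : S.Circuit U (S.digits z) k' d')
    (hw : S.Circuit U (S.digits w) k'' d'') (h₁ : ∀ a, c a → y a = z a)
    (h₂ : ∀ a, ¬ c a → y a = w a) :
    S.Circuit U (S.digits y) (k + k' + k'' + 5) (max (max d d') d'' + 1) := by
  refine ((hc.union hz).union hw).trans_computes (computes_select (n := 2)
    (s := fun j a => if j = 0 then c a else ¬ c a) (x := fun j => if j = 0 then z else w)
    ?_ ?_ ?_ ?_) (by have := S.width_β_le; omega)
  · intro j hj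
    have hc' : Definable ({c} ∪ S.digits z ∪ S.digits w) 1 c := .var (Or.inl (Or.inl rfl))
    by_cases h : j = 0
    · exact hc'.of_iff fun a => by simp [h]
    · exact hc'.not.of_iff fun a => by simp [h]
  · intro j hj f hf
    by_cases h : j = 0
    · exact .var (Or.inl (Or.inr (by simpa [h] using hf)))
    · exact .var (Or.inr (by simpa [h] using hf))
  · intro a
    by_cases h : c a
    · exact ⟨0, by norm_num, by simpa using h⟩
    · exact ⟨1, by norm_num, by simpa using h⟩
  · intro a j _ hj
    by_cases h : j = 0
    · simp only [h, if_true] at hj ⊢; exact h₁ a hj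
    · simp only [h, if_false] at hj ⊢; exact h₂ a hj

/-- Multiplication by a fixed power of the base moves digits up and fills in zeros. Digits pushed
beyond the width are dropped, so no bound on `z` is required. -/
theorem literal_mul_pow {n : ℕ} (hz : ∀ f ∈ S.digits z, Definable U 1 f)
    (hy : ∀ a, y a = z a * (S.β : ℤ) ^ n) : ∀ f ∈ S.digits y, Definable U 1 f := by
  refine literal_of_lt fun i hi c _ => ?_
  rcases lt_or_ge i n with h | h
  · refine (Definable.trivial ((0 : ℤ) = (c : ℕ))).of_iff fun a => ?_
    obtain ⟨m, rfl⟩ := Nat.exists_eq_add_of_lt h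
    rw [hy, show z a * (S.β : ℤ) ^ (i + m + 1) = (z a * S.β ^ m * S.β) * S.β ^ i by ring,
      Int.mul_ediv_cancel _ (β_pow_pos i).ne', Int.mul_emod_left]
  · obtain ⟨m, rfl⟩ := Nat.exists_eq_add_of_le h
    refine (hz _ (mem_digits (i := m) (by omega) c)).of_iff fun a => ?_
    rw [hy, pow_add, mul_comm (z a), Int.mul_ediv_mul_of_pos _ _ (β_pow_pos n)]

theorem mul_pow {n : ℕ} (hz : S.Circuit U (S.digits z) k d)
    (hy : ∀ a, y a = z a * (S.β : ℤ) ^ n) : S.Circuit U (S.digits y) k d :=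
  hz.literal (literal_mul_pow (fun _ hf => .var hf) hy)

/-- Here digits from beyond the width would move in. The bounds on `z` guarantee that they are zero.
-/
theorem div_pow {n : ℕ} (hz : S.Circuit U (S.digits z) k d)
    (h₀ : ∀ a, 0 ≤ z a) (h₁ : ∀ a, z a < (S.β : ℤ) ^ S.width)
    (hy : ∀ a, y a = z a / (S.β : ℤ) ^ n) : S.Circuit U (S.digits y) k d := by
  refine hz.literal (literal_of_lt fun i _ c _ => ?_)
  have e : ∀ a, y a / (S.β : ℤ) ^ i = z a / (S.β : ℤ) ^ (n + i) := fun a => by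
    rw [hy, Int.ediv_ediv_of_nonneg (β_pow_pos n).le, pow_add]
  rcases lt_or_ge (n + i) S.width with h | h
  · exact (Definable.var (mem_digits h c)).of_iff fun a => by rw [e]
  · refine (Definable.trivial ((0 : ℤ) = (c : ℕ))).of_iff fun a => ?_
    rw [e, Int.ediv_eq_zero_of_lt (h₀ a) ((h₁ a).trans_le
      (pow_le_pow_right₀ (by exact_mod_cast S.β_pos) h)), Int.zero_emod]

theorem mod_pow {n : ℕ} (hz : S.Circuit U (S.digits z) k d)
    (hy : ∀ a, y a = z a % (S.β : ℤ) ^ n) : S.Circuit U (S.digits y) k d := by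
  refine hz.literal (literal_of_lt fun i hi c _ => ?_)
  rcases lt_or_ge i n with h | h
  · refine (Definable.var (mem_digits hi c)).of_iff fun a => ?_
    obtain ⟨m, rfl⟩ := Nat.exists_eq_add_of_lt h
    have hP := β_pow_pos (S := S) i
    have e := Int.mul_ediv_add_emod (z a) ((S.β : ℤ) ^ (i + m + 1))
    rw [hy]
    have : z a = z a % (S.β : ℤ) ^ (i + m + 1) +
        S.β ^ i * (S.β * (S.β ^ m * (z a / (S.β : ℤ) ^ (i + m + 1)))) := by
      conv_lhs => rw [← e]
      ring
    conv_rhs => rw [this, Int.add_mul_ediv_left _ _ hP.ne', Int.add_mul_emod_self_left]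
  · refine (Definable.trivial ((0 : ℤ) = (c : ℕ))).of_iff fun a => ?_
    rw [hy, Int.ediv_eq_zero_of_lt (Int.emod_nonneg _ (β_pow_pos n).ne')
      ((Int.emod_lt_of_pos _ (β_pow_pos n)).trans_le
      (pow_le_pow_right₀ (by exact_mod_cast S.β_pos) h)), Int.zero_emod]

/-- Repeated doubling: for j ≤ 2^(n+1) both `j / 2` and `j - j / 2` are at most 2^n, so one further
layer of adders yields all multiples up to twice the previous limit. The numbers of adders form a
geometric sum. -/
theorem computes_multiples (hz : ∀ f ∈ S.digits z, Definable U 1 f) (n : ℕ) :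
    Computes U {f | ∃ j : ℕ, j < 2 ^ n + 1 ∧ f ∈ S.digits fun a => (j : ℤ) * z a}
      (2 ^ (n + 2) * S.addCost) (3 * n) := by
  induction n with
  | zero =>
    refine Computes.of_literal ?_
    rintro f ⟨j, hj, hf⟩
    have : j = 0 ∨ j = 1 := by omega
    rcases this with rfl | rfl
    · refine literal_of_lt (z := fun a => ((0 : ℕ) : ℤ) * z a) (fun i _ c _ => ?_) f hf
      exact (Definable.trivial ((0 : ℤ) / (S.β : ℤ) ^ i % S.β = (c : ℕ))).of_iff fun a => by simp
    · exact hz f (by simpa using hf)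
  | succ n ih =>
    have step : ∀ j : ℕ, j < 2 ^ (n + 1) + 1 → Computes {f | ∃ j : ℕ, j < 2 ^ n + 1 ∧
        f ∈ S.digits fun a => (j : ℤ) * z a} (S.digits fun a => (j : ℤ) * z a) S.addCost 3 := by
      intro j hj
      have h2 : 2 ^ (n + 1) = 2 * 2 ^ n := by ring
      refine computes_add_aux (z := fun a => ((j / 2 : ℕ) : ℤ) * z a)
        (w := fun a => ((j - j / 2 : ℕ) : ℤ) * z a) (c := fun _ => False)
        (fun f hf => .var ⟨j / 2, by omega, hf⟩) (fun f hf => .var ⟨j - j / 2, by omega, hf⟩)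
        (.trivial False) fun a => ?_
      rw [← add_mul, if_neg not_false, add_zero, ← Nat.cast_add]
      congr 2
      omega
    refine (ih.trans (Computes.exists_lt step)).mono ?_ (by omega)
    have h1 : 1 ≤ 2 ^ (n + 1) := Nat.one_le_two_pow
    rw [← add_mul]
    refine Nat.mul_le_mul_right _ ?_
    rw [pow_succ 2 (n + 2), pow_succ 2 (n + 1)]
    omega

theorem computes_sum (n : ℕ) : ∀ {x : ℕ → A → ℤ},
    (∀ j < 2 ^ n, ∀ f ∈ S.digits (x j), Definable U 1 f) →
    Computes U (S.digits fun a => ∑ j ∈ Finset.range (2 ^ n), x j a) ((2 ^ n - 1) * S.addCost)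
      (3 * n) := by
  induction n with
  | zero =>
    intro x hx
    exact Computes.of_literal fun f hf => hx 0 (by norm_num) f (by simpa using hf)
  | succ n ih =>
    intro x hx
    have h2 : 2 ^ (n + 1) = 2 ^ n + 2 ^ n := by ring
    have h1 : 1 ≤ 2 ^ n := Nat.one_le_two_pow
    have h₁ := ih (x := x) fun j hj => hx j (by omega)
    have h₂ := ih (x := fun j => x (2 ^ n + j)) fun j hj => hx _ (by omega)
    refine ((h₁.union h₂).trans (computes_add_aux (fun f hf => .var (Or.inl hf))
      (fun f hf => .var (Or.inr hf)) (.trivial (A := A) False) fun a => ?_)).mono ?_ (by omega)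
    · rw [h2, Finset.sum_range_add, if_neg not_false, add_zero]
    · rw [← add_mul, ← Nat.succ_mul]
      exact Nat.mul_le_mul_right _ (by omega)

theorem sum_digits (x : ℤ) (n : ℕ) :
    ∑ j ∈ Finset.range n, x / (S.β : ℤ) ^ j % S.β * S.β ^ j = x % (S.β : ℤ) ^ n := by
  induction n with
  | zero => simp
  | succ n ih => rw [Finset.sum_range_succ, ih, emod_pow_succ]; ring

theorem β_mul_addCost_le (S : FPSystem) : S.β * S.addCost ≤ 20 * S.unit := by
  have h : S.width ^ 2 * S.β ≤ S.width ^ 3 * S.β ^ 2 := Nat.mul_le_mul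
    (Nat.pow_le_pow_right S.width_pos (by norm_num)) (Nat.le_self_pow (by norm_num) _)
  have e : S.β * S.addCost = 20 * (S.width ^ 2 * S.β + S.width * S.β ^ 4) := by
    unfold addCost; ring
  rw [e]
  unfold unit
  omega

/-- The mixed term W²β³ equals Wβ² times Wβ, and Wβ ≤ W² + β² bounds it by W³β² + Wβ⁴. This is the
reason for the shape of `unit`. -/
theorem width_mul_addCost_le (S : FPSystem) : S.width * S.addCost ≤ 20 * S.unit := by
  have h₁ : S.width ^ 3 ≤ S.width ^ 4 := Nat.pow_le_pow_right S.width_pos (by norm_num)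
  have h₂ : S.width ^ 2 * S.β ^ 3 ≤ S.width ^ 3 * S.β ^ 2 + S.width * S.β ^ 4 := by
    have e₁ : S.width ^ 2 * S.β ^ 3 = (S.width * S.β ^ 2) * (S.width * S.β) := by ring
    have e₂ : S.width ^ 3 * S.β ^ 2 + S.width * S.β ^ 4 =
      (S.width * S.β ^ 2) * (S.width ^ 2 + S.β ^ 2) := by ring
    rw [e₁, e₂]
    refine Nat.mul_le_mul_left _ ?_
    nlinarith [two_mul_le_add_sq S.width S.β]
  have e : S.width * S.addCost = 20 * (S.width ^ 3 + S.width ^ 2 * S.β ^ 3) := by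
    unfold addCost; ring
  rw [e]
  unfold unit
  omega

/-- School multiplication: the digit of `w` at position `j` selects one of the precomputed multiples
of `z`, and the rows, shifted for free, are added in a binary tree padded with zero rows to a power
of two of entries. Only `w` has to be a nonnegative number of at most `width` digits; `z` may have
any sign. -/
theorem mul (hz : S.Circuit U (S.digits z) k d) (hw : S.Circuit U (S.digits w) k' d')
    (h₀ : ∀ a, 0 ≤ w a) (h₁ : ∀ a, w a < (S.β : ℤ) ^ S.width) (hy : ∀ a, y a = z a * w a) :
    S.Circuit U (S.digits y) (k + k' + 203) (max d d' + (3 * S.logDepth + 1)) := by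
  set m := Nat.clog 2 S.β with hm
  set n := Nat.clog 2 S.width with hn
  have hβm : S.β ≤ 2 ^ m := Nat.le_pow_clog (by norm_num) _
  have hWn : S.width ≤ 2 ^ n := Nat.le_pow_clog (by norm_num) _
  have hm' : 2 ^ m ≤ 2 * S.β := by
    have hpos : 0 < m := Nat.clog_pos (by norm_num) S.two_le_β
    have := Nat.pow_pred_clog_lt_self (b := 2) (by norm_num) (x := S.β) S.two_le_β
    have e : 2 ^ m = 2 * 2 ^ (m - 1) := by rw [← pow_succ']; congr 1; omega
    rw [e]
    exact Nat.mul_le_mul_left 2 this.le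
  have hW2 : 2 ≤ S.width := by
    have := S.p_pos
    have := le_max_left S.p S.q
    unfold width; omega
  have hn' : 2 ^ n ≤ 2 * S.width := by
    have hpos : 0 < n := Nat.clog_pos (by norm_num) hW2
    have := Nat.pow_pred_clog_lt_self (b := 2) (by norm_num) (x := S.width) hW2
    have e : 2 ^ n = 2 * 2 ^ (n - 1) := by rw [← pow_succ']; congr 1; omega
    rw [e]
    exact Nat.mul_le_mul_left 2 this.le
  let X : Set (A → Prop) := S.digits z ∪ S.digits w
  let Y : Set (A → Prop) := {f | ∃ j : ℕ, j < 2 ^ m + 1 ∧ f ∈ S.digits fun a => (j : ℤ) * z a}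
  have c₁ : Computes X Y (2 ^ (m + 2) * S.addCost) (3 * m) :=
    computes_multiples (fun f hf => .var (Or.inl hf)) m
  let row : ℕ → A → ℤ := fun j a => z a * (w a / (S.β : ℤ) ^ j % S.β)
  let Z : Set (A → Prop) := {f | ∃ j < S.width, f ∈ S.digits (row j)}
  have c₂ : Computes (X ∪ Y) Z (S.width * (S.width * S.β * (S.β * 2 + 1))) 1 := by
    refine Computes.exists_lt fun j hj => ?_
    refine computes_select (n := S.β) (s := fun c a => w a / (S.β : ℤ) ^ j % S.β = (c : ℕ))
      (x := fun c a => (c : ℤ) * z a) ?_ ?_ ?_ ?_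
    · exact fun c _ => .var (Or.inl (Or.inr (mem_digits hj c)))
    · exact fun c hc f hf => .var (Or.inr ⟨c, by omega, hf⟩)
    · exact fun a => exists_digit (w a) j
    · intro a c _ hc
      simp only [row, hc]
      ring
  have c₃ : Computes Z (S.digits y) ((2 ^ n - 1) * S.addCost) (3 * n) := by
    have := computes_sum (S := S) (U := Z) n
      (x := fun j a => if j < S.width then row j a * (S.β : ℤ) ^ j else 0) ?_
    · have e : y = fun a => ∑ j ∈ Finset.range (2 ^ n),
          if j < S.width then row j a * (S.β : ℤ) ^ j else 0 := by
        funext a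
        rw [← Finset.sum_filter, hy]
        have : (Finset.range (2 ^ n)).filter (· < S.width) = Finset.range S.width := by
          ext j; simp only [Finset.mem_filter, Finset.mem_range]; omega
        rw [this]
        have h := sum_digits (S := S) (w a) S.width
        rw [Int.emod_eq_of_lt (h₀ a) (h₁ a)] at h
        conv_lhs => rw [← h, Finset.mul_sum]
        exact Finset.sum_congr rfl fun j _ => by simp only [row]; ring
      rw [e]
      exact this
    · intro j hj
      by_cases hjW : j < S.width
      · refine literal_mul_pow (z := row j) (n := j) (fun f hf => .var ⟨j, hjW, hf⟩) fun a => ?_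
        simp [hjW]
      · refine literal_of_lt fun i _ c _ => ?_
        refine (Definable.trivial ((0 : ℤ) / (S.β : ℤ) ^ i % S.β = (c : ℕ))).of_iff fun a => ?_
        simp [hjW]
  have c₄ := ((c₁.trans_union c₂).subset (Set.subset_union_right)).trans c₃
  refine ((hz.union hw).trans_computes c₄ (k' := 203) ?_).mono le_rfl ?_
  -- The multiples cost 8 · 20 units, the tree of adders 2 · 20 and the selection of the rows 3,
  -- which gives 203.
  · have b₁ : 2 ^ (m + 2) * S.addCost ≤ 8 * (S.β * S.addCost) := by
      have : 2 ^ (m + 2) ≤ 8 * S.β := by rw [pow_add]; omega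
      rw [← mul_assoc]
      exact Nat.mul_le_mul_right _ this
    have b₂ : (2 ^ n - 1) * S.addCost ≤ 2 * (S.width * S.addCost) := by
      rw [← mul_assoc]
      exact Nat.mul_le_mul_right _ (by omega)
    have b₃ : S.width * (S.width * S.β * (S.β * 2 + 1)) ≤ 3 * S.unit := by
      have h₁ : S.width ^ 2 * S.β ^ 2 ≤ S.width ^ 3 * S.β ^ 2 :=
        Nat.mul_le_mul_right _ (Nat.pow_le_pow_right S.width_pos (by norm_num))
      have h₂ : S.width ^ 2 * S.β ^ 2 ≤ S.unit := by unfold unit; omega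
      have h₃ := S.width_mul_β_le
      have e : S.width * (S.width * S.β * (S.β * 2 + 1)) =
        2 * (S.width ^ 2 * S.β ^ 2) + S.width ^ 2 * S.β := by ring
      omega
    have := β_mul_addCost_le S
    have := width_mul_addCost_le S
    omega
  · have : S.logDepth = m + n := rfl
    omega

end Circuit

end FPSystem

/-! ## Magnitudes, signs and exponents of floating-point numbers -/

namespace FPSystem

variable {S : FPSystem}

/-- The number with the given digits, the most significant digit first. -/
def ofDigits {b n : ℕ} (f : Fin n → Fin b) : ℕ := finFunctionFinEquiv fun i => f i.rev

theorem ofDigits_eq {b n : ℕ} (f : Fin n → Fin b) :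
    ofDigits f = ∑ i : Fin n, (f i : ℕ) * b ^ (n - 1 - (i : ℕ)) := by
  rw [ofDigits, finFunctionFinEquiv_apply, ← Equiv.sum_comp Fin.revPerm]
  refine Finset.sum_congr rfl fun i _ => ?_
  rw [Fin.revPerm_apply, Fin.rev_rev, Fin.val_rev]
  congr 2
  omega

theorem ofDigits_lt {b n : ℕ} (f : Fin n → Fin b) : ofDigits f < b ^ n := Fin.is_lt _

theorem ofDigits_digit {b n : ℕ} (f : Fin n → Fin b) (i : Fin n) :
    ofDigits f / b ^ (i : ℕ) % b = f i.rev := by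
  have h := congrFun (finFunctionFinEquiv.symm_apply_apply fun i => f i.rev) i
  have h' := congrArg Fin.val h
  rw [finFunctionFinEquiv_symm_apply_val] at h'
  exact h'

theorem ofDigits_injective {b n : ℕ} : Function.Injective (ofDigits (b := b) (n := n)) := by
  intro f g h
  have := finFunctionFinEquiv.injective (Fin.ext h)
  funext i
  have h' := congrFun this i.rev
  simpa using h'

theorem exists_ofDigits {b n m : ℕ} (h : m < b ^ n) : ∃ f : Fin n → Fin b, ofDigits f = m := by
  refine ⟨fun i => finFunctionFinEquiv.symm ⟨m, h⟩ i.rev, ?_⟩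
  simp [ofDigits]

variable (S) in
/-- The largest exponent. -/
def maxExp : ℤ := (S.β : ℤ) ^ S.q - 1

namespace Num

/-- The digits of the fraction, read as a natural number. -/
def mant (x : Num S) : ℕ := ofDigits x.1.frac

/-- The exponent. -/
def exponent (x : Num S) : ℤ := x.1.exponent

/-- The sign of the fraction. -/
def sign (x : Num S) : Bool := x.1.fracSign

/-- The absolute value. -/
def mag (x : Num S) : ℚ := x.mant * (S.β : ℚ) ^ (x.exponent - S.p)

end Num

/-- The sign `+` or `-` as a rational number. -/
def sgn (s : Bool) : ℚ := if s then 1 else -1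

theorem sgn_mul_self (s : Bool) : sgn s * sgn s = 1 := by cases s <;> simp [sgn]

theorem abs_sgn (s : Bool) : |sgn s| = 1 := by cases s <;> simp [sgn]

theorem β_rat_pos : (0 : ℚ) < S.β := by exact_mod_cast S.β_pos

theorem two_le_β_rat : (2 : ℚ) ≤ S.β := by exact_mod_cast S.two_le_β

theorem zpow_β_pos (i : ℤ) : (0 : ℚ) < (S.β : ℚ) ^ i := zpow_pos β_rat_pos i

theorem zpow_β_le {i j : ℤ} (h : i ≤ j) : (S.β : ℚ) ^ i ≤ (S.β : ℚ) ^ j :=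
  zpow_le_zpow_right₀ (by have := two_le_β_rat (S := S); linarith) h

theorem zpow_β_add (i j : ℤ) : (S.β : ℚ) ^ (i + j) = (S.β : ℚ) ^ i * (S.β : ℚ) ^ j :=
  zpow_add₀ β_rat_pos.ne' i j

theorem expNat_eq (F : Rep S) : F.expNat = ofDigits F.exp := (ofDigits_eq _).symm

namespace Num

theorem fraction_eq (x : Num S) : x.1.fraction = x.mant / (S.β : ℚ) ^ S.p := by
  rw [Rep.fraction, mant, ofDigits_eq, Nat.cast_sum, Finset.sum_div]
  refine Finset.sum_congr rfl fun i _ => ?_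
  have hb := (β_rat_pos (S := S)).ne'
  have h : (S.β : ℚ) ^ S.p = (S.β : ℚ) ^ (S.p - 1 - (i : ℕ)) * (S.β : ℚ) ^ ((i : ℕ) + 1) := by
    rw [← pow_add]
    congr 1
    have := i.2
    omega
  rw [h]
  push_cast
  field_simp

theorem val_eq (x : Num S) : x.val = sgn x.sign * x.mag := by
  rw [val, Rep.value, fraction_eq, mag, zpow_sub₀ β_rat_pos.ne', zpow_natCast]
  unfold sgn sign exponent
  cases x.1.fracSign
  · simp only [Bool.false_eq_true, if_false]
    ring
  · simp only [if_true]
    ring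

theorem mant_lt (x : Num S) : x.mant < S.β ^ S.p := ofDigits_lt _

theorem abs_exponent_le (x : Num S) : |x.exponent| ≤ S.maxExp := by
  have h := ofDigits_lt x.1.exp
  rw [← expNat_eq] at h
  have h' : (x.1.expNat : ℤ) < (S.β : ℤ) ^ S.q := by exact_mod_cast h
  unfold exponent Rep.exponent maxExp
  split_ifs
  · rw [Nat.abs_cast]; omega
  · rw [abs_neg, Nat.abs_cast]; omega

theorem lastDigit_eq (x : Num S) : x.lastDigit = x.mant % S.β := by
  have hp := S.p_pos
  have h := ofDigits_digit x.1.frac ⟨0, by omega⟩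
  rw [pow_zero, Nat.div_one] at h
  rw [mant, h, lastDigit]
  congr 2

theorem mag_nonneg (x : Num S) : 0 ≤ x.mag := mul_nonneg (Nat.cast_nonneg _) (zpow_β_pos _).le

theorem mant_zero : (zero S).mant = 0 := by
  rw [mant, ofDigits_eq]
  exact Finset.sum_eq_zero fun i _ => by simp [zero]

theorem mag_zero : (zero S).mag = 0 := by rw [mag, mant_zero]; simp

theorem exponent_zero : (zero S).exponent = -S.maxExp := by
  have h : ofDigits (zero S).1.exp = S.β ^ S.q - 1 := by
    rw [ofDigits, finFunctionFinEquiv_apply, ← geom_sum_mul_of_one_le S.β_pos, Finset.sum_mul,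
      Finset.sum_range]
    exact Finset.sum_congr rfl fun i _ => mul_comm _ _
  unfold exponent Rep.exponent
  rw [expNat_eq, h]
  have : 1 ≤ S.β ^ S.q := Nat.one_le_pow _ _ S.β_pos
  simp only [zero, maxExp]
  push_cast [Nat.cast_sub this]
  simp

theorem le_mant (x : Num S) (h : x ≠ zero S) : S.β ^ (S.p - 1) ≤ x.mant := by
  have hp := S.p_pos
  rcases x.2.1 with ⟨i, hi, hne⟩ | ⟨h₁, h₂, h₃, h₄⟩
  · rw [mant, ofDigits_eq]
    refine le_trans ?_ (Finset.single_le_sum (fun j _ => Nat.zero_le _) (Finset.mem_univ i))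
    rw [hi, Nat.sub_zero]
    exact Nat.le_mul_of_pos_left _ (Nat.pos_of_ne_zero hne)
  · refine absurd (Subtype.ext ?_) h
    obtain ⟨⟨es, fs, ex, fr⟩, hx⟩ := x
    simp only [zero, Rep.mk.injEq] at *
    exact ⟨h₃, h₂, funext fun i => Fin.ext (h₄ i), funext fun i => Fin.ext (h₁ i)⟩

theorem expSign_eq (x : Num S) : x.1.expSign = decide (0 ≤ x.exponent) := by
  unfold exponent Rep.exponent
  cases h : x.1.expSign
  · have : x.1.expNat ≠ 0 := fun h0 => by rw [x.2.2 h0] at h; cases h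
    simp only [Bool.false_eq_true, if_false]
    symm
    rw [decide_eq_false_iff_not]
    omega
  · simp

theorem expNat_eq_natAbs (x : Num S) : x.1.expNat = x.exponent.natAbs := by
  unfold exponent Rep.exponent
  split_ifs <;> simp

/-- The exponent as an integer determines its sign bit, because the exponent 0 is always written
with `+`. A number may therefore be handled as a triple of sign, integer fraction and integer
exponent. -/
theorem ext' {x y : Num S} (h₁ : x.sign = y.sign) (h₂ : x.mant = y.mant)
    (h₃ : x.exponent = y.exponent) : x = y := by
  have e₁ := expSign_eq x
  have e₂ := expNat_eq_natAbs x
  rw [h₃, ← expSign_eq] at e₁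
  rw [h₃, ← expNat_eq_natAbs, expNat_eq, expNat_eq] at e₂
  have e₃ := ofDigits_injective e₂
  have e₄ := ofDigits_injective h₂
  obtain ⟨⟨es, fs, ex, fr⟩, hx⟩ := x
  obtain ⟨⟨es', fs', ex', fr'⟩, hx'⟩ := y
  simp only [sign] at *
  subst h₁ e₁ e₃ e₄
  rfl

theorem exists_num (s : Bool) {m : ℕ} {e : ℤ} (h₁ : S.β ^ (S.p - 1) ≤ m) (h₂ : m < S.β ^ S.p)
    (he : |e| ≤ S.maxExp) : ∃ x : Num S, x.sign = s ∧ x.mant = m ∧ x.exponent = e := by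
  have hp := S.p_pos
  obtain ⟨fr, hfr⟩ := exists_ofDigits h₂
  have he' : e.natAbs < S.β ^ S.q := by
    have : ((e.natAbs : ℕ) : ℤ) < ((S.β ^ S.q : ℕ) : ℤ) := by
      rw [Int.natCast_natAbs]; push_cast; unfold maxExp at he; omega
    exact_mod_cast this
  obtain ⟨ex, hex⟩ := exists_ofDigits he'
  let F : Rep S := ⟨decide (0 ≤ e), s, ex, fr⟩
  have hE : F.expNat = e.natAbs := (expNat_eq F).trans hex
  have hexp : F.exponent = e := by
    unfold Rep.exponent
    rw [hE]
    by_cases h : 0 ≤ e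
    · simp [F, h]
    · simp only [F, h, decide_false, Bool.false_eq_true, if_false]
      omega
  refine ⟨⟨F, Or.inl ⟨⟨0, by omega⟩, rfl, fun h0 => ?_⟩, fun h0 => ?_⟩, rfl, hfr, hexp⟩
  · have hd := ofDigits_digit fr ⟨S.p - 1, by omega⟩
    have hr : Fin.rev (⟨S.p - 1, by omega⟩ : Fin S.p) = ⟨0, by omega⟩ := by
      ext; simp; omega
    rw [hfr, hr] at hd
    change ((fr ⟨0, by omega⟩ : Fin S.β) : ℕ) = 0 at h0
    rw [h0] at hd
    have hlt : m / S.β ^ (S.p - 1) < S.β := by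
      rw [Nat.div_lt_iff_lt_mul (Nat.pow_pos S.β_pos), ← pow_succ']
      rwa [show S.p - 1 + 1 = S.p by omega]
    have hge : 1 ≤ m / S.β ^ (S.p - 1) := (Nat.one_le_div_iff (Nat.pow_pos S.β_pos)).mpr h₁
    simp only [Nat.mod_eq_of_lt hlt] at hd
    omega
  · rw [hE] at h0
    simp only [F, decide_eq_true_eq]
    omega

theorem mag_lt (x : Num S) : x.mag < (S.β : ℚ) ^ x.exponent := by
  have h : (x.mant : ℚ) < (S.β : ℚ) ^ (S.p : ℤ) := by
    rw [zpow_natCast]; exact_mod_cast x.mant_lt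
  calc x.mag < (S.β : ℚ) ^ (S.p : ℤ) * (S.β : ℚ) ^ (x.exponent - S.p) :=
        mul_lt_mul_of_pos_right h (zpow_β_pos _)
    _ = _ := by rw [← zpow_β_add]; congr 1; ring

theorem le_mul_zpow {m : ℕ} (h : S.β ^ (S.p - 1) ≤ m) (e : ℤ) :
    (S.β : ℚ) ^ (e - 1) ≤ m * (S.β : ℚ) ^ (e - S.p) := by
  have hp := S.p_pos
  have h' : (S.β : ℚ) ^ ((S.p : ℤ) - 1) ≤ m := by
    rw [show (S.p : ℤ) - 1 = ((S.p - 1 : ℕ) : ℤ) by omega, zpow_natCast]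
    exact_mod_cast h
  calc (S.β : ℚ) ^ (e - 1) = (S.β : ℚ) ^ ((S.p : ℤ) - 1) * (S.β : ℚ) ^ (e - S.p) := by
        rw [← zpow_β_add]; congr 1; ring
    _ ≤ _ := mul_le_mul_of_nonneg_right h' (zpow_β_pos _).le

theorem le_mag (x : Num S) (h : x ≠ zero S) : (S.β : ℚ) ^ (x.exponent - 1) ≤ x.mag :=
  le_mul_zpow (x.le_mant h) _

theorem mag_pos (x : Num S) (h : x ≠ zero S) : 0 < x.mag := (zpow_β_pos _).trans_le (x.le_mag h)

/-- No number lies strictly between two consecutive multiples of a power of the base. -/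
theorem mag_le_or_le {Q : ℕ} (h₁ : S.β ^ (S.p - 1) ≤ Q) (h₂ : Q < S.β ^ S.p) (e : ℤ) (x : Num S) :
    x.mag ≤ Q * (S.β : ℚ) ^ (e - S.p) ∨ (Q + 1) * (S.β : ℚ) ^ (e - S.p) ≤ x.mag := by
  by_cases hx : x = zero S
  · left; rw [hx, mag_zero]; exact mul_nonneg (Nat.cast_nonneg _) (zpow_β_pos _).le
  have hle := le_mul_zpow h₁ e
  rcases lt_trichotomy x.exponent e with h | h | h
  · exact Or.inl ((x.mag_lt.le.trans (zpow_β_le (by omega))).trans hle)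
  · rcases Nat.lt_or_ge Q x.mant with hQ | hQ
    · right
      rw [mag, h]
      exact mul_le_mul_of_nonneg_right (by exact_mod_cast hQ) (zpow_β_pos _).le
    · left
      rw [mag, h]
      exact mul_le_mul_of_nonneg_right (by exact_mod_cast hQ) (zpow_β_pos _).le
  · right
    refine le_trans ?_ ((zpow_β_le (show e ≤ x.exponent - 1 by omega)).trans (x.le_mag hx))
    have h' : ((Q : ℚ) + 1) ≤ (S.β : ℚ) ^ (S.p : ℤ) := by
      rw [zpow_natCast]; exact_mod_cast h₂
    calc ((Q : ℚ) + 1) * (S.β : ℚ) ^ (e - S.p) ≤ (S.β : ℚ) ^ (S.p : ℤ) * (S.β : ℚ) ^ (e - S.p) :=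
          mul_le_mul_of_nonneg_right h' (zpow_β_pos _).le
      _ = _ := by rw [← zpow_β_add]; congr 1; ring

/-- A nonzero number of exponent e has magnitude in [β^(e-1), β^e), and these ranges are disjoint
and increasing in e. -/
theorem exponent_le_of_mag {x y : Num S} (hx : x ≠ zero S) (h : x.mag ≤ y.mag) :
    x.exponent ≤ y.exponent := by
  by_contra! hlt
  have := y.mag_lt.trans_le ((zpow_β_le (show y.exponent ≤ x.exponent - 1 by omega)).trans
    (x.le_mag hx))
  linarith

theorem eq_of_mag {x y : Num S} (h : x.mag = y.mag) (hs : x.sign = y.sign) : x = y := by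
  by_cases hx : x = zero S
  · by_contra hy
    have := y.mag_pos fun h0 => hy (hx.trans h0.symm)
    rw [← h, hx, mag_zero] at this
    exact lt_irrefl _ this
  by_cases hy : y = zero S
  · have := x.mag_pos hx
    rw [h, hy, mag_zero] at this
    exact absurd this (lt_irrefl _)
  have he : x.exponent = y.exponent :=
    le_antisymm (exponent_le_of_mag hx h.le) (exponent_le_of_mag hy h.ge)
  refine ext' hs ?_ he
  rw [mag, mag, he] at h
  exact_mod_cast mul_right_cancel₀ (zpow_β_pos _).ne' h

end Num

end FPSystem

/-! ## Rounding -/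

namespace FPSystem

variable {S : FPSystem} {s : Bool} {u : ℚ} {x y l h : Num S}

variable (S) in
/-- The numbers of sign `s`, and zero. -/
def HasSign (s : Bool) (x : Num S) : Prop := x.sign = s ∨ x = zero S

theorem eq_of_mag_eq (hx : HasSign S s x) (hy : HasSign S s y) (e : x.mag = y.mag) : x = y := by
  by_cases hx' : x = zero S
  · by_contra hy'
    have := y.mag_pos fun h0 => hy' (hx'.trans h0.symm)
    rw [← e, hx', Num.mag_zero] at this
    exact lt_irrefl _ this
  by_cases hy' : y = zero S
  · have := x.mag_pos hx'
    rw [e, hy', Num.mag_zero] at this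
    exact absurd this (lt_irrefl _)
  exact Num.eq_of_mag e ((hx.resolve_right hx').trans (hy.resolve_right hy').symm)

theorem val_of_hasSign (hx : HasSign S s x) : x.val = sgn s * x.mag := by
  rcases hx with rfl | rfl
  · exact x.val_eq
  · rw [Num.val_eq, Num.mag_zero, mul_zero, mul_zero]

theorem dist_of_hasSign (hx : HasSign S s x) : |x.val - sgn s * u| = |x.mag - u| := by
  rw [val_of_hasSign hx, ← mul_sub, abs_mul, abs_sgn, one_mul]

theorem abs_val (x : Num S) : |x.val| = x.mag := by
  rw [Num.val_eq, abs_mul, abs_sgn, one_mul, abs_of_nonneg x.mag_nonneg]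

/-- A nonzero number of the opposite sign is farther away than zero is, so it is never nearest.
Rounding is thereby reduced to comparing magnitudes. -/
theorem dist_of_not_hasSign (hu : 0 ≤ u) (hx : ¬ HasSign S s x) : u < |x.val - sgn s * u| := by
  have hpos := x.mag_pos fun h => hx (Or.inr h)
  have hs : sgn x.sign = - sgn s := by
    have : x.sign ≠ s := fun h => hx (Or.inl h)
    cases h₁ : x.sign <;> cases s <;> simp_all [sgn]
  rw [x.val_eq, hs, show -sgn s * x.mag - sgn s * u = -(sgn s * (x.mag + u)) by ring, abs_neg,
    abs_mul, abs_sgn, one_mul, abs_of_nonneg (by linarith)]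
  linarith

theorem mem_nearest {v : ℚ} : x ∈ nearest S v ↔ ∀ y : Num S, |x.val - v| ≤ |y.val - v| := by
  simp [nearest]

theorem hasSign_of_mem_nearest (hu : 0 ≤ u) (hx : x ∈ nearest S (sgn s * u)) : HasSign S s x := by
  by_contra hx'
  have h₁ := mem_nearest.mp hx (zero S)
  rw [dist_of_hasSign (Or.inr rfl), Num.mag_zero, zero_sub, abs_neg, abs_of_nonneg hu] at h₁
  exact absurd (dist_of_not_hasSign hu hx') (not_lt.mpr h₁)

theorem nearestLow_mem (v : ℚ) : nearestLow S v ∈ nearest S v :=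
  (Classical.choose_spec (Finset.exists_min_image (nearest S v) (fun F => |F.val|)
    (nearest_nonempty S v))).1

theorem nearestHigh_mem (v : ℚ) : nearestHigh S v ∈ nearest S v :=
  (Classical.choose_spec (Finset.exists_max_image (nearest S v) (fun F => |F.val|)
    (nearest_nonempty S v))).1

theorem nearestLow_le {v : ℚ} (hx : x ∈ nearest S v) : (nearestLow S v).mag ≤ x.mag := by
  have := (Classical.choose_spec (Finset.exists_min_image (nearest S v) (fun F => |F.val|)
    (nearest_nonempty S v))).2 x hx
  rwa [abs_val, abs_val] at this

theorem le_nearestHigh {v : ℚ} (hx : x ∈ nearest S v) : x.mag ≤ (nearestHigh S v).mag := by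
  have := (Classical.choose_spec (Finset.exists_max_image (nearest S v) (fun F => |F.val|)
    (nearest_nonempty S v))).2 x hx
  rwa [abs_val, abs_val] at this

theorem mem_nearest_of_hasSign (hu : 0 ≤ u) (hx : HasSign S s x)
    (h : ∀ y, HasSign S s y → |x.mag - u| ≤ |y.mag - u|) : x ∈ nearest S (sgn s * u) := by
  refine mem_nearest.mpr fun y => ?_
  rw [dist_of_hasSign hx]
  by_cases hy : HasSign S s y
  · rw [dist_of_hasSign hy]; exact h y hy
  · have h₀ := h (zero S) (Or.inr rfl)
    rw [Num.mag_zero, zero_sub, abs_neg, abs_of_nonneg hu] at h₀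
    exact h₀.trans (dist_of_not_hasSign hu hy).le

theorem round_eq_of_lt (hu : 0 ≤ u) (hx : HasSign S s x)
    (h : ∀ y, HasSign S s y → y ≠ x → |x.mag - u| < |y.mag - u|) :
    round S (sgn s * u) = x := by
  have hmem : x ∈ nearest S (sgn s * u) := mem_nearest_of_hasSign hu hx fun y hy => by
    by_cases hyx : y = x
    · rw [hyx]
    · exact (h y hy hyx).le
  have key : ∀ y ∈ nearest S (sgn s * u), y = x := fun y hy => by
    by_contra hyx
    have hy' := hasSign_of_mem_nearest hu hy
    have h₁ := mem_nearest.mp hy x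
    rw [dist_of_hasSign hx, dist_of_hasSign hy'] at h₁
    exact absurd (h y hy' hyx) (not_lt.mpr h₁)
  unfold round
  split_ifs
  · exact key _ (nearestLow_mem _)
  · exact key _ (nearestHigh_mem _)

/-- `H` only has to bound the magnitudes above `x` from below and need not be attained. The lemma
therefore also applies at the upper end of the range, where no larger number exists. -/
theorem round_below (hx : HasSign S s x) {H : ℚ}
    (hadj : ∀ y, HasSign S s y → y.mag ≤ x.mag ∨ H ≤ y.mag) (h₁ : x.mag ≤ u)
    (h₂ : u - x.mag < H - u) : round S (sgn s * u) = x := by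
  refine round_eq_of_lt (x.mag_nonneg.trans h₁) hx fun y hy hne => ?_
  rw [abs_of_nonpos (by linarith : x.mag - u ≤ 0)]
  rcases hadj y hy with h | h
  · have : y.mag < x.mag := lt_of_le_of_ne h fun e => hne (eq_of_mag_eq hy hx e)
    rw [abs_of_nonpos (by linarith : y.mag - u ≤ 0)]
    linarith
  · rw [abs_of_nonneg (by linarith : 0 ≤ y.mag - u)]
    linarith

theorem round_above (hx : HasSign S s x) {L : ℚ} (hu : 0 ≤ u)
    (hadj : ∀ y, HasSign S s y → y.mag ≤ L ∨ x.mag ≤ y.mag) (h₁ : u ≤ x.mag)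
    (h₂ : x.mag - u < u - L) : round S (sgn s * u) = x := by
  refine round_eq_of_lt hu hx fun y hy hne => ?_
  rw [abs_of_nonneg (by linarith : 0 ≤ x.mag - u)]
  rcases hadj y hy with h | h
  · rw [abs_of_nonpos (by linarith : y.mag - u ≤ 0)]
    linarith
  · have : x.mag < y.mag := lt_of_le_of_ne h fun e => hne (eq_of_mag_eq hx hy e).symm
    rw [abs_of_nonneg (by linarith : 0 ≤ y.mag - u)]
    linarith

theorem round_tie (hl : HasSign S s l) (hh : HasSign S s h) (hlt : l.mag < h.mag)
    (hadj : ∀ y, HasSign S s y → y.mag ≤ l.mag ∨ h.mag ≤ y.mag) (e : u - l.mag = h.mag - u) :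
    round S (sgn s * u) = if Even l.lastDigit then l else h := by
  have h0 := l.mag_nonneg
  have hu : 0 ≤ u := by linarith
  have hdl : |l.mag - u| = u - l.mag := by rw [abs_of_nonpos (by linarith)]; ring
  have hdh : |h.mag - u| = u - l.mag := by rw [abs_of_nonneg (by linarith)]; linarith
  have hdy : ∀ y, HasSign S s y → u - l.mag ≤ |y.mag - u| ∧
      (|y.mag - u| ≤ u - l.mag → y = l ∨ y = h) := by
    intro y hy
    rcases hadj y hy with hy' | hy'
    · rw [abs_of_nonpos (by linarith : y.mag - u ≤ 0)]
      exact ⟨by linarith, fun h' => Or.inl (eq_of_mag_eq hy hl (by linarith))⟩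
    · rw [abs_of_nonneg (by linarith : 0 ≤ y.mag - u)]
      exact ⟨by linarith, fun h' => Or.inr (eq_of_mag_eq hy hh (by linarith))⟩
  have hml : l ∈ nearest S (sgn s * u) :=
    mem_nearest_of_hasSign hu hl fun y hy => by rw [hdl]; exact (hdy y hy).1
  have hmh : h ∈ nearest S (sgn s * u) :=
    mem_nearest_of_hasSign hu hh fun y hy => by rw [hdh]; exact (hdy y hy).1
  have key : ∀ y ∈ nearest S (sgn s * u), y = l ∨ y = h := fun y hy => by
    have hy' := hasSign_of_mem_nearest hu hy
    refine (hdy y hy').2 ?_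
    rw [← hdl, ← dist_of_hasSign hy', ← dist_of_hasSign hl]
    exact mem_nearest.mp hy l
  have hlow : nearestLow S (sgn s * u) = l := by
    refine (key _ (nearestLow_mem _)).resolve_right fun hk => ?_
    have := nearestLow_le hml
    rw [hk] at this
    linarith
  have hhigh : nearestHigh S (sgn s * u) = h := by
    refine (key _ (nearestHigh_mem _)).resolve_left fun hk => ?_
    have := le_nearestHigh hmh
    rw [hk] at this
    linarith
  unfold round
  rw [hlow, hhigh]

open Classical in
theorem round_between (hl : HasSign S s l) (hh : HasSign S s h) (hlt : l.mag < h.mag)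
    (hadj : ∀ y, HasSign S s y → y.mag ≤ l.mag ∨ h.mag ≤ y.mag) (h₁ : l.mag ≤ u)
    (h₂ : u ≤ h.mag) :
    round S (sgn s * u) =
      if u - l.mag < h.mag - u ∨ (u - l.mag = h.mag - u ∧ Even l.lastDigit) then l else h := by
  rcases lt_trichotomy (u - l.mag) (h.mag - u) with hc | hc | hc
  · rw [if_pos (Or.inl hc)]
    exact round_below hl hadj h₁ hc
  · rw [round_tie hl hh hlt hadj hc]
    simp [hc]
  · rw [if_neg (by rintro (h' | ⟨h', _⟩) <;> linarith)]
    exact round_above hh (l.mag_nonneg.trans h₁) hadj h₂ hc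

theorem maxExp_pos : 1 ≤ S.maxExp := by
  have h : (S.β : ℤ) ^ 1 ≤ (S.β : ℤ) ^ S.q :=
    pow_le_pow_right₀ (by exact_mod_cast S.β_pos) S.q_pos
  have : (2 : ℤ) ≤ S.β := by exact_mod_cast S.two_le_β
  unfold maxExp
  linarith [pow_one (S.β : ℤ)]

theorem pow_p_eq (S : FPSystem) : S.β ^ S.p = S.β ^ (S.p - 1) * S.β := by
  rw [← pow_succ]; congr 1; have := S.p_pos; omega

theorem pow_pred_lt (S : FPSystem) : S.β ^ (S.p - 1) < S.β ^ S.p :=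
  Nat.pow_lt_pow_right (by have := S.two_le_β; omega) (by have := S.p_pos; omega)

/-- The smallest positive magnitude. -/
theorem mag_of_min (hx : x.mant = S.β ^ (S.p - 1)) (e : x.exponent = -S.maxExp) :
    x.mag = (S.β : ℚ) ^ (-S.maxExp - 1) := by
  rw [Num.mag, hx, e]
  push_cast
  rw [← zpow_natCast, ← zpow_β_add]
  congr 1
  have := S.p_pos
  omega

theorem round_zero : round S 0 = zero S := by
  have := round_eq_of_lt (S := S) (s := true) (u := 0) le_rfl (x := zero S) (Or.inr rfl) ?_
  · rwa [mul_zero] at this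
  · intro y _ hy
    rw [Num.mag_zero, sub_zero, sub_zero, abs_zero]
    exact abs_pos.mpr (y.mag_pos hy).ne'

/-- The neighbours are zero and the smallest positive magnitude. In a tie zero wins, since its last
digit is even; hence the strict inequality in the condition. -/
theorem round_underflow {m : Num S} (hs : m.sign = s) (hm : m.mant = S.β ^ (S.p - 1))
    (he : m.exponent = -S.maxExp) (hu : 0 ≤ u) (hu' : u ≤ m.mag) :
    round S (sgn s * u) = if m.mag < 2 * u then m else zero S := by
  have hadj : ∀ y, HasSign S s y → y.mag ≤ (zero S).mag ∨ m.mag ≤ y.mag := by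
    intro y _
    by_cases hy : y = zero S
    · left; rw [hy]
    · right
      rw [mag_of_min hm he]
      refine (zpow_β_le ?_).trans (y.le_mag hy)
      have := (abs_le.mp y.abs_exponent_le).1
      omega
  have hpos : (zero S).mag < m.mag := by
    rw [Num.mag_zero, mag_of_min hm he]; exact zpow_β_pos _
  have := round_between (u := u) (Or.inr rfl : HasSign S s (zero S)) (Or.inl hs) hpos hadj
    (by rw [Num.mag_zero]; exact hu) hu'
  rw [this, Num.mag_zero, Num.lastDigit_eq, Num.mant_zero]
  by_cases h : m.mag < 2 * u
  · rw [if_pos h, if_neg]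
    rintro (h' | ⟨h', _⟩) <;> linarith
  · rw [if_neg h, if_pos]
    rcases lt_or_eq_of_le (not_lt.mp h) with h' | h'
    · left; linarith
    · exact Or.inr ⟨by linarith, by simp⟩

theorem round_overflow {m : Num S} (hs : m.sign = s) (hm : m.mant = S.β ^ S.p - 1)
    (he : m.exponent = S.maxExp) (hu : m.mag ≤ u) : round S (sgn s * u) = m := by
  have hlt := S.pow_pred_lt
  -- No magnitude exceeds that of `m`, so any `H` will do; this one is large enough to make `m` the
  -- nearer side.
  refine round_below (Or.inl hs) (H := u + (u - m.mag) + 1) (fun y _ => Or.inl ?_) hu (by linarith)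
  rcases Num.mag_le_or_le (Q := S.β ^ S.p - 1) (by omega) (by omega) m.exponent y with h | h
  · rwa [← hm] at h
  · exfalso
    have h₂ := y.mag_lt.trans_le (zpow_β_le ((abs_le.mp y.abs_exponent_le).2.trans he.ge))
    have h₃ : ((S.β ^ S.p - 1 : ℕ) : ℚ) + 1 = (S.β : ℚ) ^ (S.p : ℤ) := by
      rw [Nat.cast_sub (by omega)]; push_cast; rw [zpow_natCast]; ring
    rw [h₃, ← zpow_β_add, show (S.p : ℤ) + (m.exponent - S.p) = m.exponent by ring] at h
    linarith

open Classical in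
/-- Rounding in the normal range. `Q` is the truncated fraction and `t` the rest. -/
theorem round_normal {Q : ℕ} (h₁ : S.β ^ (S.p - 1) ≤ Q) (h₂ : Q < S.β ^ S.p) {e : ℤ}
    (he : -S.maxExp ≤ e) (he' : e ≤ S.maxExp) {t : ℚ} (ht : 0 ≤ t) (ht' : t < 1) {Q' : ℕ}
    (hQ' : Q' = Q + if 1 < 2 * t ∨ (2 * t = 1 ∧ ¬ Even (Q % S.β)) then 1 else 0)
    (hx : x = round S (sgn s * ((Q + t) * (S.β : ℚ) ^ (e - S.p)))) :
    x.sign = s ∧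
    (Q' < S.β ^ S.p → x.mant = Q' ∧ x.exponent = e) ∧
    (S.β ^ S.p ≤ Q' → e < S.maxExp → x.mant = S.β ^ (S.p - 1) ∧ x.exponent = e + 1) ∧
    (S.β ^ S.p ≤ Q' → ¬ e < S.maxExp → x.mant = S.β ^ S.p - 1 ∧ x.exponent = e) := by
  obtain ⟨l, hls, hlm, hle⟩ := Num.exists_num s h₁ h₂ (abs_le.mpr ⟨he, he'⟩)
  have hP := zpow_β_pos (S := S) (e - S.p)
  have hl : l.mag = Q * (S.β : ℚ) ^ (e - S.p) := by rw [Num.mag, hlm, hle]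
  have hlu : l.mag ≤ (Q + t) * (S.β : ℚ) ^ (e - S.p) := by
    rw [hl]; exact mul_le_mul_of_nonneg_right (by linarith) hP.le
  have hcase : S.β ^ S.p ≤ Q' → Q + 1 = S.β ^ S.p ∧ Q' = Q + 1 := by
    intro h; rw [hQ'] at h ⊢; split_ifs at h ⊢ <;> omega
  -- This is the only case in which the upper neighbour is missing. Otherwise `Q + 1` is a valid
  -- fraction for the exponent `e`, or it equals β^p and the neighbour is β^(p-1) with exponent e +
  -- 1.
  by_cases hovf : Q + 1 = S.β ^ S.p ∧ ¬ e < S.maxExp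
  · have hm := round_overflow hls (by rw [hlm]; omega) (by rw [hle]; omega) hlu
    rw [hx, hm]
    refine ⟨hls, fun hlt => ⟨?_, hle⟩, fun _ hlt => absurd hlt hovf.2, fun _ _ => ⟨by omega, hle⟩⟩
    rw [hlm, hQ']
    split_ifs with hup
    · rw [hQ', if_pos hup] at hlt; omega
    · rfl
  · obtain ⟨h, hhs, hhm⟩ : ∃ h : Num S, h.sign = s ∧
        ((Q + 1 < S.β ^ S.p ∧ h.mant = Q + 1 ∧ h.exponent = e) ∨
          (Q + 1 = S.β ^ S.p ∧ h.mant = S.β ^ (S.p - 1) ∧ h.exponent = e + 1)) := by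
      rcases Nat.lt_or_ge (Q + 1) (S.β ^ S.p) with hlt | hge
      · obtain ⟨h, e₁, e₂, e₃⟩ := Num.exists_num s (by omega) hlt (abs_le.mpr ⟨he, he'⟩)
        exact ⟨h, e₁, Or.inl ⟨hlt, e₂, e₃⟩⟩
      · have hQe : Q + 1 = S.β ^ S.p := by omega
        have : e < S.maxExp := by by_contra hc; exact hovf ⟨hQe, hc⟩
        obtain ⟨h, e₁, e₂, e₃⟩ := Num.exists_num s le_rfl S.pow_pred_lt
          (abs_le.mpr (⟨by omega, by omega⟩ : -S.maxExp ≤ e + 1 ∧ e + 1 ≤ S.maxExp))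
        exact ⟨h, e₁, Or.inr ⟨hQe, e₂, e₃⟩⟩
    have hh : h.mag = (Q + 1) * (S.β : ℚ) ^ (e - S.p) := by
      rcases hhm with ⟨_, hm, hE⟩ | ⟨hQe, hm, hE⟩
      · rw [Num.mag, hm, hE]; push_cast; rfl
      · have hQe' : (Q : ℚ) + 1 = (S.β : ℚ) ^ (S.p - 1) * S.β := by
          have := hQe.trans S.pow_p_eq
          exact_mod_cast this
        rw [Num.mag, hm, hE, hQe', show e + 1 - (S.p : ℤ) = 1 + (e - S.p) by ring, zpow_β_add,
          zpow_one]
        push_cast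
        ring
    have hbt := round_between (u := (Q + t) * (S.β : ℚ) ^ (e - S.p)) (Or.inl hls : HasSign S s l)
      (Or.inl hhs) (by rw [hl, hh]; exact mul_lt_mul_of_pos_right (by linarith) hP)
      (fun y _ => by rw [hl, hh]; exact Num.mag_le_or_le h₁ h₂ e y) hlu
      (by rw [hh]; exact mul_le_mul_of_nonneg_right (by linarith) hP.le)
    have hcond : ((Q + t) * (S.β : ℚ) ^ (e - S.p) - l.mag <
        h.mag - (Q + t) * (S.β : ℚ) ^ (e - S.p) ∨
        ((Q + t) * (S.β : ℚ) ^ (e - S.p) - l.mag = h.mag - (Q + t) * (S.β : ℚ) ^ (e - S.p) ∧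
          Even l.lastDigit)) ↔ ¬ (1 < 2 * t ∨ (2 * t = 1 ∧ ¬ Even (Q % S.β))) := by
      rw [hl, hh, Num.lastDigit_eq, hlm, ← sub_mul, ← sub_mul, mul_lt_mul_iff_left₀ hP,
        mul_left_inj' hP.ne']
      constructor
      · rintro (h' | ⟨h', h''⟩) (h₃ | ⟨h₃, h₄⟩)
        · linarith
        · linarith
        · linarith
        · exact h₄ h''
      · intro h'
        push Not at h'
        rcases lt_or_eq_of_le h'.1 with h₃ | h₃
        · left; linarith
        · exact Or.inr ⟨by linarith, h'.2 h₃⟩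
    rw [hbt] at hx
    simp only [hcond] at hx
    by_cases hup : 1 < 2 * t ∨ (2 * t = 1 ∧ ¬ Even (Q % S.β))
    · rw [if_neg (not_not.mpr hup)] at hx
      rw [if_pos hup] at hQ'
      subst hx
      refine ⟨hhs, fun hlt => ?_, fun hge hlt => ?_, fun hge hlt => ?_⟩
      · rcases hhm with ⟨_, hm, hE⟩ | ⟨hQe, hm, hE⟩
        · exact ⟨by omega, hE⟩
        · omega
      · rcases hhm with ⟨_, hm, hE⟩ | ⟨hQe, hm, hE⟩
        · omega
        · exact ⟨hm, hE⟩
      · exact absurd ⟨by omega, hlt⟩ hovf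
    · rw [if_pos hup] at hx
      rw [if_neg hup] at hQ'
      subst hx
      exact ⟨hls, fun _ => ⟨by omega, hle⟩, fun hge => by omega, fun hge => by omega⟩

/-- Adding a number of much smaller exponent does not change a number. -/
theorem round_add_of_far (x y : Num S) (h : y.exponent + S.p + 2 ≤ x.exponent) :
    round S (x.val + y.val) = x := by
  have hx : x ≠ zero S := by
    rintro rfl
    rw [Num.exponent_zero] at h
    have := (abs_le.mp y.abs_exponent_le).1
    omega
  have hβ := two_le_β_rat (S := S)
  have hym : 2 * y.mag < (S.β : ℚ) ^ (x.exponent - S.p - 1) := by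
    have h₁ := y.mag_lt.trans_le (zpow_β_le (show y.exponent ≤ x.exponent - S.p - 1 - 1 by omega))
    have h₂ : (S.β : ℚ) ^ (x.exponent - S.p - 1) = S.β * (S.β : ℚ) ^ (x.exponent - S.p - 1 - 1) := by
      rw [← zpow_one_add₀ β_rat_pos.ne']; congr 1; ring
    rw [h₂]
    have := mul_le_mul_of_nonneg_right hβ (zpow_β_pos (S := S) (x.exponent - S.p - 1 - 1)).le
    linarith
  have hle : (S.β : ℚ) ^ (x.exponent - S.p - 1) ≤ x.mag :=
    (zpow_β_le (by have := S.p_pos; omega)).trans (x.le_mag hx)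
  have hy0 := y.mag_nonneg
  obtain ⟨δ, hδ, hv⟩ : ∃ δ : ℚ, |δ| = y.mag ∧ x.val + y.val = sgn x.sign * (x.mag + δ) := by
    refine ⟨sgn x.sign * y.val, by rw [abs_mul, abs_sgn, one_mul, abs_val], ?_⟩
    rw [mul_add, ← mul_assoc, sgn_mul_self, one_mul, ← x.val_eq]
  have hδ' := abs_le.mp hδ.le
  rw [hv]
  refine round_eq_of_lt (by linarith) (Or.inl rfl) fun z hz hne => ?_
  -- The spacing around `x` is smallest just below a power of the base, where the neighbour has
  -- exponent one less; this gives the extra -1. The perturbation is less than half of this gap.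
  have hgap : (S.β : ℚ) ^ (x.exponent - S.p - 1) ≤ |z.mag - x.mag| := by
    by_cases hz0 : z = zero S
    · rw [hz0, Num.mag_zero, zero_sub, abs_neg, abs_of_nonneg x.mag_nonneg]
      exact hle
    rcases lt_trichotomy z.exponent x.exponent with he | he | he
    · refine le_trans ?_ (neg_le_abs _)
      have hm : (z.mant : ℚ) ≤ (S.β : ℚ) ^ (S.p : ℤ) - 1 := by
        have : z.mant + 1 ≤ S.β ^ S.p := z.mant_lt
        rw [zpow_natCast]
        have : ((z.mant + 1 : ℕ) : ℚ) ≤ ((S.β ^ S.p : ℕ) : ℚ) := by exact_mod_cast this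
        push_cast at this
        linarith
      have h₁ : z.mag ≤ ((S.β : ℚ) ^ (S.p : ℤ) - 1) * (S.β : ℚ) ^ (x.exponent - S.p - 1) := by
        refine mul_le_mul hm (zpow_β_le (by omega)) (zpow_β_pos _).le ?_
        exact (Nat.cast_nonneg _).trans hm
      rw [sub_mul, one_mul, ← zpow_β_add,
        show (S.p : ℤ) + (x.exponent - S.p - 1) = x.exponent - 1 by ring] at h₁
      have := x.le_mag hx
      linarith
    · have hm : z.mant ≠ x.mant := fun hm => hne (eq_of_mag_eq hz (Or.inl rfl : HasSign S x.sign x)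
        (by rw [Num.mag, Num.mag, hm, he]))
      rw [Num.mag, Num.mag, he, ← sub_mul, abs_mul, abs_of_pos (zpow_β_pos (S := S) _)]
      have h1 : (1 : ℚ) ≤ |(z.mant : ℚ) - x.mant| := by
        have : (1 : ℤ) ≤ |(z.mant : ℤ) - x.mant| := by
          rw [← Int.zero_add 1, Int.add_one_le_iff, abs_pos]
          intro h0; apply hm; omega
        exact_mod_cast this
      calc (S.β : ℚ) ^ (x.exponent - S.p - 1) ≤ 1 * (S.β : ℚ) ^ (x.exponent - S.p) := by
            rw [one_mul]; exact zpow_β_le (by omega)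
        _ ≤ _ := mul_le_mul_of_nonneg_right h1 (zpow_β_pos _).le
    · refine le_trans ?_ (le_abs_self _)
      have hm : (x.mant : ℚ) ≤ (S.β : ℚ) ^ (S.p : ℤ) - 1 := by
        have : x.mant + 1 ≤ S.β ^ S.p := x.mant_lt
        rw [zpow_natCast]
        have : ((x.mant + 1 : ℕ) : ℚ) ≤ ((S.β ^ S.p : ℕ) : ℚ) := by exact_mod_cast this
        push_cast at this
        linarith
      have h₁ : x.mag ≤ ((S.β : ℚ) ^ (S.p : ℤ) - 1) * (S.β : ℚ) ^ (x.exponent - S.p) :=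
        mul_le_mul_of_nonneg_right hm (zpow_β_pos _).le
      rw [sub_mul, one_mul, ← zpow_β_add,
        show (S.p : ℤ) + (x.exponent - S.p) = x.exponent by ring] at h₁
      have h₂ := (zpow_β_le (S := S) (show x.exponent ≤ z.exponent - 1 by omega)).trans
        (z.le_mag hz0)
      have h₃ := zpow_β_le (S := S) (show x.exponent - S.p - 1 ≤ x.exponent - S.p by omega)
      linarith
  have h₁ : |x.mag - (x.mag + δ)| = y.mag := by
    rw [show x.mag - (x.mag + δ) = -δ by ring, abs_neg, hδ]
  rw [h₁]
  have h₂ : |z.mag - x.mag| ≤ |z.mag - (x.mag + δ)| + |δ| := by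
    have := abs_add_le (z.mag - (x.mag + δ)) δ
    rwa [show z.mag - (x.mag + δ) + δ = z.mag - x.mag by ring] at this
  rw [hδ] at h₂
  linarith

end FPSystem

/-! ### Rounding an integer multiple of a power of the base -/

namespace FPSystem

variable {S : FPSystem} {s : Bool} {x : Num S}

open Classical in
/-- The rounding of a normalized number with `L` digits. -/
theorem round_spec {L : ℕ} (hL : S.p < L) {N : ℕ} (h₁ : S.β ^ (L - 1) ≤ N) (h₂ : N < S.β ^ L)
    {e : ℤ} (hx : x = round S (sgn s * (N * (S.β : ℚ) ^ (e - L)))) {Q' : ℕ}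
    (hQ' : Q' = N / S.β ^ (L - S.p) + if S.β ^ (L - S.p) < 2 * (N % S.β ^ (L - S.p)) ∨
      (2 * (N % S.β ^ (L - S.p)) = S.β ^ (L - S.p) ∧ ¬ Even (N / S.β ^ (L - S.p) % S.β))
      then 1 else 0) :
    (e < -S.maxExp → (e = -S.maxExp - 1 ∧ S.β ^ L < 2 * N) →
      x.sign = s ∧ x.mant = S.β ^ (S.p - 1) ∧ x.exponent = -S.maxExp) ∧
    (e < -S.maxExp → ¬ (e = -S.maxExp - 1 ∧ S.β ^ L < 2 * N) → x = zero S) ∧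
    (S.maxExp < e → x.sign = s ∧ x.mant = S.β ^ S.p - 1 ∧ x.exponent = S.maxExp) ∧
    (-S.maxExp ≤ e → e ≤ S.maxExp → x.sign = s ∧
      (Q' < S.β ^ S.p → x.mant = Q' ∧ x.exponent = e) ∧
      (S.β ^ S.p ≤ Q' → e < S.maxExp → x.mant = S.β ^ (S.p - 1) ∧ x.exponent = e + 1) ∧
      (S.β ^ S.p ≤ Q' → ¬ e < S.maxExp → x.mant = S.β ^ S.p - 1 ∧ x.exponent = e)) := by
  have hE := maxExp_pos (S := S)
  have hβ := two_le_β_rat (S := S)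
  set u : ℚ := N * (S.β : ℚ) ^ (e - L) with hu
  have hP := zpow_β_pos (S := S) (e - L)
  have hu0 : 0 ≤ u := mul_nonneg (Nat.cast_nonneg _) hP.le
  have hpowL : (S.β : ℚ) ^ e = (S.β : ℚ) ^ L * (S.β : ℚ) ^ (e - L) := by
    rw [← zpow_natCast, ← zpow_β_add]; congr 1; ring
  have hult : u < (S.β : ℚ) ^ e := by
    rw [hpowL]
    exact mul_lt_mul_of_pos_right (by exact_mod_cast h₂) hP
  have hule : (S.β : ℚ) ^ (e - 1) ≤ u := by
    have : (S.β : ℚ) ^ (e - 1) = ((S.β ^ (L - 1) : ℕ) : ℚ) * (S.β : ℚ) ^ (e - L) := by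
      push_cast
      rw [← zpow_natCast, ← zpow_β_add]
      congr 1
      omega
    rw [this]
    exact mul_le_mul_of_nonneg_right (by exact_mod_cast h₁) hP.le
  have hunder : e < -S.maxExp → ∃ m : Num S, m.sign = s ∧ m.mant = S.β ^ (S.p - 1) ∧
      m.exponent = -S.maxExp ∧ x = if e = -S.maxExp - 1 ∧ S.β ^ L < 2 * N then m else zero S := by
    intro he
    obtain ⟨m, hms, hmm, hme⟩ := Num.exists_num s le_rfl S.pow_pred_lt
      (abs_le.mpr (⟨le_rfl, by omega⟩ : -S.maxExp ≤ -S.maxExp ∧ -S.maxExp ≤ S.maxExp))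
    refine ⟨m, hms, hmm, hme, ?_⟩
    have hmag := mag_of_min hmm hme
    rw [hx, round_underflow hms hmm hme hu0
      (by rw [hmag]; exact hult.le.trans (zpow_β_le (by omega)))]
    refine if_congr ?_ rfl rfl
    rw [hmag]
    constructor
    · intro h
      -- For smaller `e` one has u < β^e, and β^e is at most half of the smallest positive magnitude
      -- because β ≥ 2.
      have he' : e = -S.maxExp - 1 := by
        by_contra hne
        have h₃ := zpow_β_le (S := S) (show e + 1 ≤ -S.maxExp - 1 by omega)
        rw [zpow_β_add, zpow_one] at h₃
        have := mul_le_mul_of_nonneg_left hβ (zpow_β_pos (S := S) e).le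
        linarith
      refine ⟨he', ?_⟩
      rw [← he', hpowL, hu, ← mul_assoc] at h
      have := lt_of_mul_lt_mul_right h hP.le
      exact_mod_cast this
    · rintro ⟨he', h⟩
      rw [← he', hpowL, hu, ← mul_assoc]
      exact mul_lt_mul_of_pos_right (by exact_mod_cast h) hP
  refine ⟨fun he hc => ?_, fun he hc => ?_, fun he => ?_, fun he he' => ?_⟩
  · obtain ⟨m, hms, hmm, hme, hxm⟩ := hunder he
    rw [if_pos hc] at hxm
    rw [hxm]
    exact ⟨hms, hmm, hme⟩
  · obtain ⟨m, hms, hmm, hme, hxm⟩ := hunder he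
    rwa [if_neg hc] at hxm
  · have hlt := S.pow_pred_lt
    obtain ⟨m, hms, hmm, hme⟩ := Num.exists_num s (m := S.β ^ S.p - 1) (by omega) (by omega)
      (abs_le.mpr (⟨by omega, le_rfl⟩ : -S.maxExp ≤ S.maxExp ∧ S.maxExp ≤ S.maxExp))
    have := round_overflow (u := u) hms hmm hme
      ((m.mag_lt.le.trans (zpow_β_le (by omega))).trans hule)
    rw [hx, this]
    exact ⟨hms, hmm, hme⟩
  · set K := S.β ^ (L - S.p) with hK
    have hKpos : 0 < K := Nat.pow_pos S.β_pos
    have hKq : (0 : ℚ) < K := by exact_mod_cast hKpos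
    have hLp : S.β ^ L = S.β ^ S.p * K := by rw [hK, ← pow_add]; congr 1; omega
    have hLp' : S.β ^ (L - 1) = S.β ^ (S.p - 1) * K := by
      rw [hK, ← pow_add]; congr 1; have := S.p_pos; omega
    have hQ₁ : S.β ^ (S.p - 1) ≤ N / K := (Nat.le_div_iff_mul_le hKpos).mpr (hLp' ▸ h₁)
    have hQ₂ : N / K < S.β ^ S.p := (Nat.div_lt_iff_lt_mul hKpos).mpr (hLp ▸ h₂)
    have ht : ((N % K : ℕ) : ℚ) / K < 1 := by
      rw [div_lt_one hKq]; exact_mod_cast Nat.mod_lt _ hKpos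
    have hc₁ : (1 : ℚ) < 2 * (((N % K : ℕ) : ℚ) / K) ↔ K < 2 * (N % K) := by
      rw [← mul_div_assoc, lt_div_iff₀ hKq, one_mul]; norm_cast
    have hc₂ : 2 * (((N % K : ℕ) : ℚ) / K) = 1 ↔ 2 * (N % K) = K := by
      rw [← mul_div_assoc, div_eq_one_iff_eq hKq.ne']; norm_cast
    refine round_normal (t := ((N % K : ℕ) : ℚ) / K) hQ₁ hQ₂ he he'
      (div_nonneg (Nat.cast_nonneg _) hKq.le) ht (Q' := Q') (by simp only [hc₁, hc₂]; exact hQ') ?_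
    rw [hx, hu]
    congr 2
    have hN : (N : ℚ) = (((N / K : ℕ) : ℚ) + ((N % K : ℕ) : ℚ) / K) * K := by
      rw [add_mul, div_mul_cancel₀ _ hKq.ne', mul_comm]
      exact_mod_cast (Nat.div_add_mod N K).symm
    have hz : (S.β : ℚ) ^ (e - S.p) = K * (S.β : ℚ) ^ (e - L) := by
      rw [hK]
      push_cast
      rw [← zpow_natCast, ← zpow_β_add]
      congr 1
      omega
    rw [hz, ← mul_assoc, ← hN]

end FPSystem

/-! ## Circuits for rounding -/

namespace FPSystem

open BNL

variable {A : Type} {U V : Set (A → Prop)} {S : FPSystem}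

theorem eq_sum_digits {z : ℤ} (h₀ : 0 ≤ z) (h₁ : z < (S.β : ℤ) ^ S.width) :
    z = ∑ j ∈ Finset.range S.width, z / (S.β : ℤ) ^ j % S.β * S.β ^ j := by
  rw [Circuit.sum_digits, Int.emod_eq_of_lt h₀ h₁]

theorem eq_iff_digits {z : ℤ} (h₀ : 0 ≤ z) (h₁ : z < (S.β : ℤ) ^ S.width) {w : ℤ} (h₂ : 0 ≤ w)
    (h₃ : w < (S.β : ℤ) ^ S.width) :
    z = w ↔ ∀ i < S.width, z / (S.β : ℤ) ^ i % S.β = w / (S.β : ℤ) ^ i % S.β := by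
  refine ⟨fun h i _ => by rw [h], fun h => ?_⟩
  rw [eq_sum_digits h₀ h₁, eq_sum_digits h₂ h₃]
  exact Finset.sum_congr rfl fun i hi => by rw [h i (Finset.mem_range.mp hi)]

theorem definable_eq_const {z : A → ℤ} (hz : ∀ f ∈ S.digits z, Definable U 1 f)
    (h₀ : ∀ a, 0 ≤ z a) (h₁ : ∀ a, z a < (S.β : ℤ) ^ S.width) {n : ℤ} (h₂ : 0 ≤ n)
    (h₃ : n < (S.β : ℤ) ^ S.width) : Definable U S.width fun a => z a = n := by
  have := Definable.forall_lt (U := U) (N := S.width) (c := 1)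
    (r := fun i a => z a / (S.β : ℤ) ^ i % S.β = n / (S.β : ℤ) ^ i % S.β) fun i hi => by
      obtain ⟨c, _, hc⟩ := exists_digit (S := S) n i
      exact (hz _ (mem_digits hi c)).of_iff fun a => by rw [hc]
  exact (this.mono (by simp)).of_iff fun a => eq_iff_digits (h₀ a) (h₁ a) h₂ h₃

theorem lt_pow_iff_digits {z : ℤ} (h₀ : 0 ≤ z) (h₁ : z < (S.β : ℤ) ^ S.width) (j : ℕ) :
    z < (S.β : ℤ) ^ j ↔ ∀ i < S.width, j ≤ i → z / (S.β : ℤ) ^ i % S.β = 0 := by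
  constructor
  · intro h i _ hji
    rw [Int.ediv_eq_zero_of_lt h₀ (h.trans_le
      (pow_le_pow_right₀ (by exact_mod_cast S.β_pos) hji)), Int.zero_emod]
  · intro h
    rcases le_total S.width j with hj | hj
    · exact h₁.trans_le (pow_le_pow_right₀ (by exact_mod_cast S.β_pos) hj)
    · have : z = z % (S.β : ℤ) ^ j := by
        conv_lhs => rw [eq_sum_digits h₀ h₁]
        rw [← Circuit.sum_digits]
        symm
        refine Finset.sum_subset (Finset.range_subset_range.mpr hj) fun i hi hij => ?_
        rw [h i (Finset.mem_range.mp hi) (by simpa using hij), zero_mul]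
      rw [this]
      exact Int.emod_lt_of_pos _ (β_pow_pos j)

theorem definable_lt_pow {z : A → ℤ} (hz : ∀ f ∈ S.digits z, Definable U 1 f)
    (h₀ : ∀ a, 0 ≤ z a) (h₁ : ∀ a, z a < (S.β : ℤ) ^ S.width) (j : ℕ) :
    Definable U S.width fun a => z a < (S.β : ℤ) ^ j := by
  have := Definable.forall_lt (U := U) (N := S.width) (c := 1)
    (r := fun i a => j ≤ i → z a / (S.β : ℤ) ^ i % S.β = 0) fun i hi => by
      by_cases hji : j ≤ i
      · exact (hz _ (mem_digits hi 0)).of_iff fun a => by simp [hji]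
      · exact (Definable.trivial True).of_iff fun a => by simp [hji]
  exact (this.mono (by simp)).of_iff fun a => lt_pow_iff_digits (h₀ a) (h₁ a) j

/-- The number of digits of `M` in base `β`. -/
def len (S : FPSystem) (M : ℕ) : ℕ := if M = 0 then 0 else Nat.log S.β M + 1

theorem lt_pow_iff_len_le {M j : ℕ} : M < S.β ^ j ↔ S.len M ≤ j := by
  have hβ : 1 < S.β := S.two_le_β
  unfold len
  split_ifs with h
  · subst h; simp [Nat.pow_pos S.β_pos]
  · rw [← Nat.log_lt_iff_lt_pow hβ h]; rfl

theorem len_spec {L M : ℕ} (h : M < S.β ^ L) (h0 : M ≠ 0) :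
    S.β ^ (L - 1) ≤ M * S.β ^ (L - S.len M) ∧ M * S.β ^ (L - S.len M) < S.β ^ L := by
  have hlen := lt_pow_iff_len_le.mp h
  have hpos : 1 ≤ S.len M := by unfold len; rw [if_neg h0]; omega
  have h₁ : M < S.β ^ S.len M := lt_pow_iff_len_le.mpr le_rfl
  have h₂ : S.β ^ (S.len M - 1) ≤ M := by
    by_contra! hc
    have := lt_pow_iff_len_le.mp hc
    omega
  have hp : 0 < S.β ^ (L - S.len M) := Nat.pow_pos S.β_pos
  constructor
  · calc S.β ^ (L - 1) = S.β ^ (S.len M - 1) * S.β ^ (L - S.len M) := by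
          rw [← pow_add]; congr 1; omega
      _ ≤ _ := Nat.mul_le_mul_right _ h₂
  · calc M * S.β ^ (L - S.len M) < S.β ^ S.len M * S.β ^ (L - S.len M) :=
          Nat.mul_lt_mul_of_pos_right h₁ hp
      _ = _ := by rw [← pow_add]; congr 1; omega

variable (S) in
/-- The number of digits of an exact sum or product. -/
def prec : ℕ := 2 * S.p + 3

theorem prec_le_width (S : FPSystem) : S.prec + 10 ≤ S.width := by
  have := S.p_pos
  have := le_max_left S.p S.q
  unfold prec width
  omega

/-- Both `p` and the largest exponent are below β^r with r = max p q, so the left side is less than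
32β^r ≤ β^(r+5). All exponent comparisons below stay within this range. -/
theorem exp_bound (S : FPSystem) :
    3 * S.maxExp + 4 * S.p + 10 < (S.β : ℤ) ^ (S.width - 1) := by
  have hβ : (1 : ℤ) ≤ S.β := by exact_mod_cast S.β_pos
  have hβ2 : (2 : ℤ) ≤ S.β := by exact_mod_cast S.two_le_β
  set r := max S.p S.q with hr
  have hp : (S.p : ℤ) < (S.β : ℤ) ^ r := by
    have h₁ : S.p < 2 ^ S.p := Nat.lt_two_pow_self
    have h₂ : 2 ^ S.p ≤ S.β ^ S.p := Nat.pow_le_pow_left S.two_le_β _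
    have h₃ : S.β ^ S.p ≤ S.β ^ r := Nat.pow_le_pow_right S.β_pos (le_max_left _ _)
    exact_mod_cast h₁.trans_le (h₂.trans h₃)
  have hE : S.maxExp < (S.β : ℤ) ^ r := by
    have : (S.β : ℤ) ^ S.q ≤ (S.β : ℤ) ^ r := pow_le_pow_right₀ hβ (le_max_right _ _)
    unfold maxExp
    linarith
  have h5 : (S.β : ℤ) ^ r * 2 ^ 5 ≤ (S.β : ℤ) ^ (S.width - 1) := by
    calc (S.β : ℤ) ^ r * 2 ^ 5 ≤ (S.β : ℤ) ^ r * (S.β : ℤ) ^ 5 :=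
          mul_le_mul_of_nonneg_left (pow_le_pow_left₀ (by norm_num) hβ2 5) (by positivity)
      _ = (S.β : ℤ) ^ (r + 5) := by rw [pow_add]
      _ ≤ _ := pow_le_pow_right₀ hβ (by
        have := S.p_pos
        have := le_max_left S.p S.q
        unfold width; omega)
  have hpos := S.p_pos
  omega

theorem β_pow_lt {i j : ℕ} (h : i < j) : (S.β : ℤ) ^ i < (S.β : ℤ) ^ j :=
  pow_lt_pow_right₀ (by exact_mod_cast S.two_le_β) h

theorem pow_prec_lt (S : FPSystem) : (S.β : ℤ) ^ S.prec < (S.β : ℤ) ^ (S.width - 1) :=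
  β_pow_lt (by have := S.prec_le_width; omega)

theorem pow_prec_le (S : FPSystem) : (S.β : ℤ) ^ S.prec < (S.β : ℤ) ^ S.width :=
  β_pow_lt (by have := S.prec_le_width; omega)

variable (S) in
/-- The predicates describing a floating-point number: sign, digits of the fraction as an integer,
digits of the exponent as an integer. -/
def parts (x : A → Num S) : Set (A → Prop) :=
  {fun a => (x a).sign = true} ∪ S.digits (fun a => ((x a).mant : ℤ)) ∪
    S.digits fun a => (x a).exponent

namespace Circuit

variable {k k' k'' d d' d'' : ℕ}

/-- The length is found without a sequential search: it equals `j` exactly when the threshold β^j is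
respected and β^(j-1) is not, and each threshold test is a conjunction over the high digits. -/
theorem len_digits {M : A → ℕ} (hM : ∀ f ∈ S.digits (fun a => (M a : ℤ)), Definable U 1 f)
    (hb : ∀ a, M a < S.β ^ S.prec) :
    Computes U {f | ∃ j < S.prec + 1, f = fun a => S.len (M a) = j} (3 * S.unit) 1 := by
  have h₀ : ∀ a, (0 : ℤ) ≤ M a := fun a => Int.natCast_nonneg _
  have h₁ : ∀ a, (M a : ℤ) < (S.β : ℤ) ^ S.width := fun a =>
    lt_trans (by exact_mod_cast hb a) S.pow_prec_le
  have hlt : ∀ j, Definable U S.width fun a => S.len (M a) ≤ j := fun j =>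
    (definable_lt_pow hM h₀ h₁ j).of_iff fun a => by
      rw [← lt_pow_iff_len_le]; norm_cast
  have hlayer := Computes.layer (U := U) (κ := Fin (S.prec + 1)) (c := S.width + S.width)
    (fun j a => S.len (M a) = j) fun j => by
      by_cases hj : (j : ℕ) = 0
      · exact ((hlt 0).mono (by omega)).of_iff fun a => by rw [hj]; omega
      · exact ((hlt j).and (hlt (j - 1)).not).of_iff fun a => by omega
  refine (hlayer.mono ?_ le_rfl).subset ?_
  · rw [Fintype.card_fin]
    have hW := S.prec_le_width
    have h4 : S.width * S.width ≤ S.unit := by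
      have : S.width ^ 2 ≤ S.width ^ 4 := Nat.pow_le_pow_right S.width_pos (by norm_num)
      rw [← sq]; unfold unit; omega
    calc (S.prec + 1) * (S.width + S.width + 1) ≤ S.width * (3 * S.width) :=
          Nat.mul_le_mul (by omega) (by omega)
      _ ≤ _ := by rw [mul_left_comm]; exact Nat.mul_le_mul_left 3 h4
  · rintro f ⟨j, hj, rfl⟩
    exact ⟨⟨j, hj⟩, rfl⟩

/-- Each of the `prec + 1` possible shifts is free, so a variable shift is a single selection
controlled by the length. Together with the computation of the length this has depth 2. -/
theorem normalize {M N : A → ℕ} (hM : S.Circuit U (S.digits fun a => (M a : ℤ)) k d)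
    (hb : ∀ a, M a < S.β ^ S.prec) (hN : ∀ a, N a = M a * S.β ^ (S.prec - S.len (M a))) :
    S.Circuit U (S.digits (fun a => (N a : ℤ)) ∪ S.digits fun a => (S.len (M a) : ℤ))
      (k + 12) (d + 2) := by
  have h₁ := len_digits (S := S) (M := M) (fun f hf => .var hf) hb
  have hW := S.prec_le_width
  have hcost : S.width * S.β * ((S.prec + 1) * 2 + 1) ≤ 4 * S.unit := by
    have := S.width_mul_β_le
    calc S.width * S.β * ((S.prec + 1) * 2 + 1) ≤ S.width * S.β * (4 * S.width) :=
          Nat.mul_le_mul_left _ (by omega)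
      _ = 4 * (S.width ^ 2 * S.β) := by ring
      _ ≤ _ := by omega
  have hcover : ∀ a, ∃ j < S.prec + 1, S.len (M a) = j := fun a =>
    ⟨_, Nat.lt_succ_of_le (lt_pow_iff_len_le.mp (hb a)), rfl⟩
  have h₂ : Computes (S.digits (fun a => (M a : ℤ)) ∪
      {f | ∃ j < S.prec + 1, f = fun a => S.len (M a) = j})
      (S.digits (fun a => (N a : ℤ)) ∪ S.digits fun a => (S.len (M a) : ℤ)) (8 * S.unit) 1 := by
    refine (Computes.union (computes_select (n := S.prec + 1) (s := fun j a => S.len (M a) = j)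
      (x := fun j a => M a * (S.β : ℤ) ^ (S.prec - j)) (fun j hj => .var (Or.inr ⟨j, hj, rfl⟩))
      (fun j _ => literal_mul_pow (fun f hf => .var (Or.inl hf)) fun _ => rfl) hcover ?_)
      (computes_select (n := S.prec + 1) (s := fun j a => S.len (M a) = j)
      (x := fun j _ => (j : ℤ)) (fun j hj => .var (Or.inr ⟨j, hj, rfl⟩))
      (fun j _ => literal_of_lt fun i _ c _ => .trivial ((j : ℤ) / (S.β : ℤ) ^ i % S.β = (c : ℕ)))
      hcover ?_)).mono (by omega) (by simp)
    · rintro a j _ hj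
      rw [hN, hj]; push_cast; rfl
    · rintro a j _ hj
      rw [hj]
  exact (hM.trans_computes (h₁.trans_union h₂) (k' := 11) (by omega)).mono (by omega) le_rfl
    |>.subset Set.subset_union_right

end Circuit

end FPSystem

/-! ### The rounding circuit -/

namespace FPSystem

open BNL

variable {A : Type} {U V : Set (A → Prop)} {S : FPSystem}

open Classical in
/-- Sign, fraction and exponent of a rounded number. -/
theorem round_parts {M N Q' : ℕ} {e e₀ : ℤ} {s : Bool} {x : Num S} {isz ovr ovf : Prop}
    (hb : M < S.β ^ S.prec) (hx : x = round S (sgn s * (M * (S.β : ℚ) ^ e)))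
    (hN : N = M * S.β ^ (S.prec - S.len M)) (he₀ : e₀ = e + S.len M)
    (hQ' : Q' = N / S.β ^ (S.p + 3) + if S.β ^ (S.p + 3) < 2 * (N % S.β ^ (S.p + 3)) ∨
      (2 * (N % S.β ^ (S.p + 3)) = S.β ^ (S.p + 3) ∧ ¬ Even (N / S.β ^ (S.p + 3) % S.β))
      then 1 else 0)
    (hz : isz ↔ M = 0 ∨ (e₀ < -S.maxExp ∧ ¬ (e₀ = -S.maxExp - 1 ∧ S.β ^ S.prec < 2 * N)))
    (hovf : ovf ↔ ¬ Q' < S.β ^ S.p) (hover : ovr ↔ S.maxExp < e₀ ∨ (ovf ∧ ¬ e₀ < S.maxExp)) :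
    (x.sign = true ↔ isz ∨ s = true) ∧
    ((x.mant : ℤ) = if isz then 0 else if e₀ < -S.maxExp then (S.β : ℤ) ^ (S.p - 1) else
      if ovr then (S.β : ℤ) ^ S.p - 1 else if ovf then (S.β : ℤ) ^ (S.p - 1) else Q') ∧
    x.exponent = if isz ∨ e₀ < -S.maxExp then -S.maxExp else if ovr then S.maxExp else
      if ovf then e₀ + 1 else e₀ := by
  have hzero : x = zero S → isz → (x.sign = true ↔ isz ∨ s = true) ∧
    ((x.mant : ℤ) = if isz then 0 else if e₀ < -S.maxExp then (S.β : ℤ) ^ (S.p - 1) else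
      if ovr then (S.β : ℤ) ^ S.p - 1 else if ovf then (S.β : ℤ) ^ (S.p - 1) else Q') ∧
    x.exponent = if isz ∨ e₀ < -S.maxExp then -S.maxExp else if ovr then S.maxExp else
      if ovf then e₀ + 1 else e₀ := by
    rintro rfl hi
    rw [if_pos hi, if_pos (Or.inl hi), Num.mant_zero]
    exact ⟨⟨fun _ => Or.inl hi, fun _ => rfl⟩, rfl, Num.exponent_zero⟩
  by_cases hM : M = 0
  · refine hzero ?_ (hz.mpr (Or.inl hM))
    rw [hx, hM]
    simp only [Nat.cast_zero, zero_mul, mul_zero]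
    exact round_zero
  have hlen : S.len M ≤ S.prec := lt_pow_iff_len_le.mp hb
  obtain ⟨hN₁, hN₂⟩ := hN ▸ len_spec hb hM
  have hk : S.prec - S.p = S.p + 3 := by unfold prec; omega
  have hx' : x = round S (sgn s * (N * (S.β : ℚ) ^ (e₀ - S.prec))) := by
    rw [hx, hN]
    congr 2
    push_cast
    rw [mul_assoc, ← zpow_natCast, ← zpow_β_add]
    congr 2
    push_cast [hlen]
    omega
  obtain ⟨c₁, c₂, c₃, c₄⟩ := round_spec (by unfold prec; omega) hN₁ hN₂ hx' (Q' := Q')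
    (by rw [hk]; exact hQ')
  have hE := maxExp_pos (S := S)
  have hpp : ((S.β ^ S.p - 1 : ℕ) : ℤ) = (S.β : ℤ) ^ S.p - 1 := by
    rw [Nat.cast_sub (Nat.one_le_pow _ _ S.β_pos)]; push_cast; rfl
  by_cases hu : e₀ < -S.maxExp
  · by_cases hnb : e₀ = -S.maxExp - 1 ∧ S.β ^ S.prec < 2 * N
    · obtain ⟨hs, hm, hex⟩ := c₁ hu hnb
      have hi : ¬ isz := fun h => (hz.mp h).elim hM fun h => h.2 hnb
      rw [if_neg hi, if_pos hu, if_pos (Or.inr hu), hs, hm]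
      exact ⟨by simp [hi], by push_cast; rfl, hex⟩
    · exact hzero (c₂ hu hnb) (hz.mpr (Or.inr ⟨hu, hnb⟩))
  · have hi : ¬ isz := fun h => (hz.mp h).elim hM fun h => hu h.1
    have hiu : ¬ (isz ∨ e₀ < -S.maxExp) := fun h => h.elim hi hu
    rw [if_neg hi, if_neg hu, if_neg hiu]
    by_cases ho : S.maxExp < e₀
    · obtain ⟨hs, hm, hex⟩ := c₃ ho
      have hov : ovr := hover.mpr (Or.inl ho)
      rw [if_pos hov, if_pos hov, hs, hm]
      exact ⟨by simp [hi], hpp, hex⟩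
    · obtain ⟨hs, b₁, b₂, b₃⟩ := c₄ (by omega) (by omega)
      rw [hs]
      refine ⟨by simp [hi], ?_⟩
      by_cases hov : ovf
      · have hov' : S.β ^ S.p ≤ Q' := not_lt.mp (hovf.mp hov)
        by_cases hlt : e₀ < S.maxExp
        · have hno : ¬ ovr := fun h => (hover.mp h).elim ho fun h => h.2 hlt
          obtain ⟨hm, hex⟩ := b₂ hov' hlt
          rw [if_neg hno, if_neg hno, if_pos hov, if_pos hov, hm]
          exact ⟨by push_cast; rfl, hex⟩
        · have hyo : ovr := hover.mpr (Or.inr ⟨hov, hlt⟩)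
          obtain ⟨hm, hex⟩ := b₃ hov' hlt
          rw [if_pos hyo, if_pos hyo, hm]
          exact ⟨hpp, by omega⟩
      · have hno : ¬ ovr := fun h => (hover.mp h).elim ho fun h => hov h.1
        obtain ⟨hm, hex⟩ := b₁ (not_not.mp fun h => hov (hovf.mpr h))
        rw [if_neg hno, if_neg hno, if_neg hov, if_neg hov, hm]
        exact ⟨rfl, hex⟩

namespace Circuit

variable {k k' k'' d d' d'' : ℕ}

theorem odd_digit {z : A → ℕ} (hz : S.Circuit U (S.digits fun a => (z a : ℤ)) k d) :
    S.Circuit U {fun a => ¬ Even (z a % S.β)} (k + 1) (d + 1) := by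
  have hW := S.width_pos
  have h := Definable.exists_lt (U := S.digits fun a => (z a : ℤ)) (N := S.β) (c := 1)
    (r := fun c a => ¬ Even c ∧ (z a : ℤ) / (S.β : ℤ) ^ 0 % S.β = (c : ℕ)) fun c _ =>
      ((Definable.const (¬ Even c)).and (.var (mem_digits (by omega) c))).mono (by simp)
  refine hz.single (h.of_iff fun a => ?_) ?_
  · simp only [pow_zero, Int.ediv_one]
    constructor
    · intro h
      exact ⟨z a % S.β, Nat.mod_lt _ S.β_pos, h, by push_cast; rfl⟩
    · rintro ⟨c, _, hc, he⟩
      have : z a % S.β = c := by exact_mod_cast he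
      rwa [this]
  · have h₁ := S.prec_le_width
    have h₂ := S.width_β_le
    have h₃ : 2 * S.β ≤ S.width * S.β := Nat.mul_le_mul_right _ (by omega)
    have := S.β_pos
    omega

theorem parts_of {x : A → Num S} (h₁ : S.Circuit U {fun a => (x a).sign = true} k d)
    (h₂ : S.Circuit U (S.digits fun a => ((x a).mant : ℤ)) k' d')
    (h₃ : S.Circuit U (S.digits fun a => (x a).exponent) k'' d'') :
    S.Circuit U (S.parts x) (k + k' + k'') (max (max d d') d'') := (h₁.union h₂).union h₃

theorem abs_sub_lt_of_nonneg {x y b : ℤ} (hx : 0 ≤ x) (hx' : x < b) (hy : 0 ≤ y) (hy' : y < b) :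
    |x - y| < b := by rw [abs_lt]; constructor <;> linarith

-- After normalization, the truncated fraction and the remainder are digit ranges of `N`. What is
-- left is a bounded number of comparisons, one increment and the case distinction of `round_parts`,
-- so both size (in units) and depth are absolute constants. The bound on `e` accommodates products,
-- whose exponent is a sum of two exponents minus 2p.
open Classical in
theorem round_aux {M : A → ℕ} {e : A → ℤ} {σ : A → Prop} {x : A → Num S}
    (hb : ∀ a, M a < S.β ^ S.prec) (heb : ∀ a, |e a| ≤ 2 * S.maxExp + 2 * S.p)
    (hx : ∀ a s, (s = true ↔ σ a) → x a = round S (sgn s * (M a * (S.β : ℚ) ^ (e a)))) :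
    S.Circuit ({σ} ∪ S.digits (fun a => (M a : ℤ)) ∪ S.digits e) (S.parts x) 5000 40 := by
  set V : Set (A → Prop) := {σ} ∪ S.digits (fun a => (M a : ℤ)) ∪ S.digits e with hV
  have hE := maxExp_pos (S := S)
  have hEb := S.exp_bound
  have hW := S.prec_le_width
  have hp := S.p_pos
  have hσ : S.Circuit V {σ} 0 0 := of_subset fun f hf => Or.inl (Or.inl hf)
  have hM : S.Circuit V (S.digits fun a => (M a : ℤ)) 0 0 :=
    of_subset fun f hf => Or.inl (Or.inr hf)
  have he : S.Circuit V (S.digits e) 0 0 := of_subset fun f hf => Or.inr hf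
  let N : A → ℕ := fun a => M a * S.β ^ (S.prec - S.len (M a))
  have hnorm := hM.normalize hb (N := N) fun _ => rfl
  have hNc : S.Circuit V (S.digits fun a => (N a : ℤ)) 12 2 := hnorm.subset Set.subset_union_left
  have hlc : S.Circuit V (S.digits fun a => (S.len (M a) : ℤ)) 12 2 :=
    hnorm.subset Set.subset_union_right
  have hNlt : ∀ a, N a < S.β ^ S.prec := fun a => by
    by_cases h : M a = 0
    · simp only [N, h, zero_mul]; exact Nat.pow_pos S.β_pos
    · exact (len_spec (hb a) h).2
  have hlen : ∀ a, S.len (M a) ≤ S.prec := fun a => lt_pow_iff_len_le.mp (hb a)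
  let e₀ : A → ℤ := fun a => e a + S.len (M a)
  have he₀ : S.Circuit V (S.digits e₀) 52 5 := he.add hlc fun _ => rfl
  have he₀b : ∀ a, |e₀ a| ≤ 2 * S.maxExp + 4 * S.p + 3 := fun a => by
    have h₁ := abs_le.mp (heb a)
    have h₂ := hlen a
    unfold prec at h₂
    rw [abs_le]
    simp only [e₀]
    constructor <;> omega
  have he₀c : ∀ c : ℤ, |c| ≤ S.maxExp + 1 → ∀ a, |e₀ a - c| < (S.β : ℤ) ^ (S.width - 1) := by
    intro c hc a
    have h₁ := abs_le.mp (he₀b a)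
    have h₂ := abs_le.mp hc
    rw [abs_lt]
    constructor <;> omega
  have hNz : ∀ a, (0 : ℤ) ≤ N a := fun a => Int.natCast_nonneg _
  have hNw : ∀ a, (N a : ℤ) < (S.β : ℤ) ^ S.width := fun a =>
    lt_trans (by exact_mod_cast hNlt a) S.pow_prec_le
  let Q : A → ℕ := fun a => N a / S.β ^ (S.p + 3)
  let R : A → ℕ := fun a => N a % S.β ^ (S.p + 3)
  have hQ : S.Circuit V (S.digits fun a => (Q a : ℤ)) 12 2 :=
    hNc.div_pow (n := S.p + 3) hNz hNw fun a => by simp only [Q]; push_cast; rfl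
  have hR : S.Circuit V (S.digits fun a => (R a : ℤ)) 12 2 :=
    hNc.mod_pow (n := S.p + 3) fun a => by simp only [R]; push_cast; rfl
  have hR2 : S.Circuit V (S.digits fun a => ((2 * R a : ℕ) : ℤ)) 64 5 :=
    hR.add hR fun a => by omega
  have hRlt : ∀ a, R a < S.β ^ (S.p + 3) := fun a => Nat.mod_lt _ (Nat.pow_pos S.β_pos)
  have h2pow : ∀ {i : ℕ}, i + 1 < S.width → 2 * (S.β : ℤ) ^ i ≤ (S.β : ℤ) ^ (S.width - 1) := by
    intro i hi
    have hβ : (2 : ℤ) ≤ S.β := by exact_mod_cast S.two_le_β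
    calc 2 * (S.β : ℤ) ^ i ≤ S.β * (S.β : ℤ) ^ i := mul_le_mul_of_nonneg_right hβ (β_pow_pos i).le
      _ = (S.β : ℤ) ^ (i + 1) := by rw [pow_succ']
      _ ≤ _ := pow_le_pow_right₀ (by linarith) (by omega)
  have hp3 : S.p + 3 + 1 < S.width := by unfold prec at hW; omega
  have hRb : ∀ a, |((2 * R a : ℕ) : ℤ) - (S.β : ℤ) ^ (S.p + 3)| < (S.β : ℤ) ^ (S.width - 1) :=
    fun a => by
      have h₁ : (R a : ℤ) < (S.β : ℤ) ^ (S.p + 3) := by exact_mod_cast hRlt a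
      have h₂ := h2pow hp3
      have h₃ := β_pow_pos (S := S) (S.p + 3)
      push_cast
      exact abs_sub_lt_of_nonneg (by positivity) (by linarith) h₃.le (by linarith)
  have hK : S.Circuit V (S.digits fun _ => (S.β : ℤ) ^ (S.p + 3)) 0 0 := const _ fun _ => rfl
  have hgt : S.Circuit V {fun a => S.β ^ (S.p + 3) < 2 * R a} 104 8 :=
    (hK.lt hR2 (fun a => by rw [abs_sub_comm]; exact hRb a) fun a => by
      norm_cast).mono (by norm_num) (by norm_num)
  have heq : S.Circuit V {fun a => 2 * R a = S.β ^ (S.p + 3)} 209 9 :=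
    (hR2.eq hK hRb fun a => by norm_cast).mono (by norm_num) (by norm_num)
  let up : A → Prop := fun a => S.β ^ (S.p + 3) < 2 * R a ∨
    (2 * R a = S.β ^ (S.p + 3) ∧ ¬ Even (Q a % S.β))
  have hup : S.Circuit V {up} 328 11 :=
    (hgt.or (heq.and hQ.odd_digit (r := fun a => 2 * R a = S.β ^ (S.p + 3) ∧ ¬ Even (Q a % S.β))
      fun _ => Iff.rfl) fun _ => Iff.rfl).mono (by norm_num) (by norm_num)
  let Q' : A → ℕ := fun a => Q a + if up a then 1 else 0
  have hQ' : S.Circuit V (S.digits fun a => (Q' a : ℤ)) 380 14 :=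
    (hQ.add_carry (const (k := 0) (d := 0) (z := fun _ => 0) 0 fun _ => rfl) hup fun a => by
      simp [Q']).mono (by norm_num) (by norm_num)
  have hpK : S.prec = S.p + (S.p + 3) := by unfold prec; omega
  have hQlt : ∀ a, Q a < S.β ^ S.p := fun a => by
    refine (Nat.div_lt_iff_lt_mul (Nat.pow_pos S.β_pos)).mpr ?_
    rw [← pow_add, ← hpK]; exact hNlt a
  let ovf : A → Prop := fun a => ¬ Q' a < S.β ^ S.p
  have hovf : S.Circuit V {ovf} 420 17 := by
    have h := hQ'.lt (const (k := 0) (d := 0) (z := fun _ => (S.β : ℤ) ^ S.p) _ fun _ => rfl)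
      (p := fun a => Q' a < S.β ^ S.p) (fun a => ?_) fun a => by norm_cast
    · exact (h.not fun _ => Iff.rfl).mono (by norm_num) (by norm_num)
    · have h₁ : (Q' a : ℤ) ≤ (S.β : ℤ) ^ S.p := by
        have := hQlt a
        have : Q' a ≤ S.β ^ S.p := by simp only [Q']; split_ifs <;> omega
        exact_mod_cast this
      have h₂ := h2pow (show S.p + 1 < S.width by omega)
      have h₃ := β_pow_pos (S := S) S.p
      exact abs_sub_lt_of_nonneg (Int.natCast_nonneg _) (by linarith) h₃.le (by linarith)
  have hcst : ∀ n : ℤ, S.Circuit V (S.digits fun _ => n) 0 0 := fun n => const n fun _ => rfl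
  have hunder : S.Circuit V {fun a => e₀ a < -S.maxExp} 92 8 :=
    (he₀.lt (hcst (-S.maxExp)) (he₀c _ (by rw [abs_neg, abs_of_pos (by omega)]; omega))
      fun _ => Iff.rfl).mono (by norm_num) (by norm_num)
  have hnear : S.Circuit V {fun a => e₀ a = -S.maxExp - 1} 185 9 :=
    (he₀.eq (hcst (-S.maxExp - 1)) (he₀c _ (by rw [abs_le]; constructor <;> omega))
      fun _ => Iff.rfl).mono (by norm_num) (by norm_num)
  have hover₁ : S.Circuit V {fun a => S.maxExp < e₀ a} 92 8 :=
    ((hcst S.maxExp).lt he₀ (fun a => by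
      rw [abs_sub_comm]; exact he₀c _ (by rw [abs_of_pos (by omega)]; omega) a)
      fun _ => Iff.rfl).mono (by norm_num) (by norm_num)
  have hbelow : S.Circuit V {fun a => ¬ e₀ a < S.maxExp} 92 8 :=
    ((he₀.lt (hcst S.maxExp) (he₀c _ (by rw [abs_of_pos (by omega)]; omega))
      (p := fun a => e₀ a < S.maxExp) fun _ => Iff.rfl).not fun _ => Iff.rfl).mono
      (by norm_num) (by norm_num)
  have hbig : S.Circuit V {fun a => S.β ^ S.prec < 2 * N a} 104 8 := by
    have hN2 : S.Circuit V (S.digits fun a => ((2 * N a : ℕ) : ℤ)) 64 5 :=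
      hNc.add hNc fun a => by omega
    refine ((hcst ((S.β : ℤ) ^ S.prec)).lt hN2 (fun a => ?_) fun a => by norm_cast).mono
      (by norm_num) (by norm_num)
    have h₁ : (N a : ℤ) < (S.β : ℤ) ^ S.prec := by exact_mod_cast hNlt a
    have h₂ := h2pow (show S.prec + 1 < S.width by omega)
    have h₃ := β_pow_pos (S := S) S.prec
    push_cast
    exact abs_sub_lt_of_nonneg h₃.le (by linarith) (by positivity) (by linarith)
  have hM0 : S.Circuit V {fun a => M a = 0} 40 3 := by
    refine (hM.lt (hcst 1) (fun a => ?_) fun a => by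
      omega).mono (by norm_num) (by norm_num)
    have h₁ : (M a : ℤ) < (S.β : ℤ) ^ S.prec := by exact_mod_cast hb a
    have h₂ := S.pow_prec_lt
    exact abs_sub_lt_of_nonneg (Int.natCast_nonneg _) (by linarith) (by norm_num) (by linarith)
  let isz : A → Prop := fun a => M a = 0 ∨ (e₀ a < -S.maxExp ∧
    ¬ (e₀ a = -S.maxExp - 1 ∧ S.β ^ S.prec < 2 * N a))
  have hisz : S.Circuit V {isz} 424 12 :=
    (hM0.or (hunder.and ((hnear.and hbig
      (r := fun a => e₀ a = -S.maxExp - 1 ∧ S.β ^ S.prec < 2 * N a) fun _ => Iff.rfl).not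
      (q := fun a => ¬ (e₀ a = -S.maxExp - 1 ∧ S.β ^ S.prec < 2 * N a)) fun _ => Iff.rfl)
      (r := fun a => e₀ a < -S.maxExp ∧ ¬ (e₀ a = -S.maxExp - 1 ∧ S.β ^ S.prec < 2 * N a))
      fun _ => Iff.rfl) fun _ => Iff.rfl).mono (by norm_num) (by norm_num)
  let ovr : A → Prop := fun a => S.maxExp < e₀ a ∨ (ovf a ∧ ¬ e₀ a < S.maxExp)
  have hover : S.Circuit V {ovr} 606 19 :=
    (hover₁.or (hovf.and hbelow (r := fun a => ovf a ∧ ¬ e₀ a < S.maxExp) fun _ => Iff.rfl)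
      fun _ => Iff.rfl).mono (by norm_num) (by norm_num)
  have key := fun a => round_parts (isz := isz a) (ovr := ovr a) (ovf := ovf a) (hb a)
    (hx a (decide (σ a)) (by simp)) (N := N a) rfl (e₀ := e₀ a) rfl (Q' := Q' a) rfl Iff.rfl
    Iff.rfl Iff.rfl
  have hsign : S.Circuit V {fun a => (x a).sign = true} 425 13 :=
    (hisz.or hσ fun a => by rw [(key a).1, decide_eq_true_eq]).mono (by norm_num) (by norm_num)
  have m₁ : S.Circuit V (S.digits fun a => if ovf a then (S.β : ℤ) ^ (S.p - 1) else Q' a) 805 18 :=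
    (hovf.ite (hcst _) hQ' (fun a h => if_pos h) fun a h => if_neg h).mono
      (by norm_num) (by norm_num)
  have m₂ : S.Circuit V (S.digits fun a => if ovr a then (S.β : ℤ) ^ S.p - 1 else
      if ovf a then (S.β : ℤ) ^ (S.p - 1) else Q' a) 1416 20 :=
    (hover.ite (hcst _) m₁ (fun a h => if_pos h) fun a h => if_neg h).mono
      (by norm_num) (by norm_num)
  have m₃ : S.Circuit V (S.digits fun a => if e₀ a < -S.maxExp then (S.β : ℤ) ^ (S.p - 1) else
      if ovr a then (S.β : ℤ) ^ S.p - 1 else if ovf a then (S.β : ℤ) ^ (S.p - 1) else Q' a)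
      1513 21 :=
    (hunder.ite (hcst _) m₂ (fun a h => if_pos h) fun a h => if_neg h).mono
      (by norm_num) (by norm_num)
  have hmant : S.Circuit V (S.digits fun a => ((x a).mant : ℤ)) 1942 22 :=
    (hisz.ite (hcst 0) m₃ (fun a h => by rw [(key a).2.1, if_pos h])
      fun a h => by rw [(key a).2.1, if_neg h]; congr).mono (by norm_num) (by norm_num)
  have x₁ : S.Circuit V (S.digits fun a => if ovf a then e₀ a + 1 else e₀ a) 569 18 :=
    (hovf.ite (he₀.add (hcst 1) (y := fun a => e₀ a + 1) fun _ => rfl) he₀ (fun a h => if_pos h)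
      fun a h => if_neg h).mono (by norm_num) (by norm_num)
  have x₂ : S.Circuit V (S.digits fun a => if ovr a then S.maxExp else
      if ovf a then e₀ a + 1 else e₀ a) 1180 20 :=
    (hover.ite (hcst _) x₁ (fun a h => if_pos h) fun a h => if_neg h).mono
      (by norm_num) (by norm_num)
  have hexp : S.Circuit V (S.digits fun a => (x a).exponent) 1702 21 :=
    ((hisz.or hunder (r := fun a => isz a ∨ e₀ a < -S.maxExp) fun _ => Iff.rfl).ite
      (hcst (-S.maxExp)) x₂ (fun a h => by rw [(key a).2.2, if_pos h])
      fun a h => by rw [(key a).2.2, if_neg h]; congr).mono (by norm_num) (by norm_num)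
  exact (hsign.parts_of hmant hexp).mono (by norm_num) (by norm_num)

theorem round {M : A → ℕ} {e : A → ℤ} {σ : A → Prop} {x : A → Num S}
    (hσ : S.Circuit U {σ} k d) (hM : S.Circuit U (S.digits fun a => (M a : ℤ)) k' d')
    (he : S.Circuit U (S.digits e) k'' d'')
    (hb : ∀ a, M a < S.β ^ S.prec) (heb : ∀ a, |e a| ≤ 2 * S.maxExp + 2 * S.p)
    (hx : ∀ a s, (s = true ↔ σ a) → x a = FPSystem.round S (sgn s * (M a * (S.β : ℚ) ^ (e a)))) :
    S.Circuit U (S.parts x) (k + k' + k'' + 5000) (max (max d d') d'' + 40) :=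
  ((hσ.union hM).union he).trans (round_aux hb heb hx)

end Circuit

end FPSystem

/-! ## Circuits for the arithmetic operations -/

namespace FPSystem

open BNL

variable {A : Type} {U V : Set (A → Prop)} {S : FPSystem}

theorem sgn_of_iff {s s₁ s₂ : Bool} (h : s = true ↔ (s₁ = true ↔ s₂ = true)) :
    sgn s = sgn s₁ * sgn s₂ := by
  cases s <;> cases s₁ <;> cases s₂ <;> simp_all [sgn]

theorem add_comm' (x y : Num S) : add x y = add y x := by
  unfold add
  rw [_root_.add_comm]

namespace Circuit

variable {k k' k'' d d' d'' : ℕ} {x y : A → Num S}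

theorem sign_of_parts (h : S.Circuit U (S.parts x) k d) :
    S.Circuit U {fun a => (x a).sign = true} k d := h.subset fun _ hf => Or.inl (Or.inl hf)

theorem mant_of_parts (h : S.Circuit U (S.parts x) k d) :
    S.Circuit U (S.digits fun a => ((x a).mant : ℤ)) k d := h.subset fun _ hf => Or.inl (Or.inr hf)

theorem exponent_of_parts (h : S.Circuit U (S.parts x) k d) :
    S.Circuit U (S.digits fun a => (x a).exponent) k d := h.subset fun _ hf => Or.inr hf

theorem mant_lt_cast (x : Num S) : (x.mant : ℤ) < (S.β : ℤ) ^ S.p := by exact_mod_cast x.mant_lt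

theorem p_lt_width (S : FPSystem) : 2 * S.p + 13 ≤ S.width := S.prec_le_width

/-- The exact product is the product of the integer fractions times the base to the power
`x.exponent + y.exponent - 2p`. Only the integer product has logarithmic depth. -/
theorem mul_num (hx : S.Circuit U (S.parts x) k d) (hy : S.Circuit U (S.parts y) k' d') :
    S.Circuit U (S.parts fun a => FPSystem.mul (x a) (y a)) (k + k' + 6000)
      (max d d' + (3 * S.logDepth + 60)) := by
  have hW := p_lt_width S
  set V : Set (A → Prop) := S.parts x ∪ S.parts y
  have hxV : S.Circuit V (S.parts x) 0 0 := of_subset Set.subset_union_left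
  have hyV : S.Circuit V (S.parts y) 0 0 := of_subset Set.subset_union_right
  have hσ : S.Circuit V {fun a => (x a).sign = true ↔ (y a).sign = true} 1 1 := by
    refine (hxV.sign_of_parts.union hyV.sign_of_parts).trans_computes (k' := 1)
      (Computes.single (c := 4) ?_) ?_ |>.mono (by norm_num) (by norm_num)
    · have h₁ : Definable ({fun a => (x a).sign = true} ∪ {fun a => (y a).sign = true}) 1
        fun a => (x a).sign = true := .var (Or.inl rfl)
      have h₂ : Definable ({fun a => (x a).sign = true} ∪ {fun a => (y a).sign = true}) 1
        fun a => (y a).sign = true := .var (Or.inr rfl)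
      exact ((h₁.and h₂).or (h₁.not.and h₂.not)).of_iff fun a => by tauto
    · have := S.width_le_unit
      omega
  have hM : S.Circuit V (S.digits fun a => (((x a).mant * (y a).mant : ℕ) : ℤ)) 203
      (3 * S.logDepth + 1) :=
    (hxV.mant_of_parts.mul hyV.mant_of_parts (fun a => Int.natCast_nonneg _) (fun a =>
      (mant_lt_cast (y a)).trans (β_pow_lt (by omega))) fun a => by push_cast; rfl).mono
      (by norm_num) (by omega)
  have he : S.Circuit V (S.digits fun a => (x a).exponent + (y a).exponent - 2 * S.p) 80 6 :=
    ((hxV.exponent_of_parts.add hyV.exponent_of_parts (y := fun a => (x a).exponent +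
      (y a).exponent) fun _ => rfl).sub (const (k := 0) (d := 0) (z := fun _ => 2 * (S.p : ℤ)) _
      fun _ => rfl) fun _ => rfl).mono (by norm_num) (by norm_num)
  refine ((hx.union hy).trans (Circuit.round hσ hM he (fun a => ?_) (fun a => ?_)
    fun a s hs => ?_)).mono (by omega) (by omega)
  · have h₁ := Nat.mul_lt_mul'' (x a).mant_lt (y a).mant_lt
    rw [← pow_add] at h₁
    exact h₁.trans_le (Nat.pow_le_pow_right S.β_pos (by unfold prec; omega))
  · have h₁ := abs_le.mp (x a).abs_exponent_le
    have h₂ := abs_le.mp (y a).abs_exponent_le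
    rw [abs_le]
    constructor <;> omega
  · rw [FPSystem.mul, (x a).val_eq, (y a).val_eq, sgn_of_iff hs]
    congr 1
    rw [Num.mag, Num.mag, show (x a).exponent + (y a).exponent - 2 * (S.p : ℤ) =
      ((x a).exponent - S.p) + ((y a).exponent - S.p) by ring, zpow_β_add]
    push_cast
    ring

theorem ite_num {c : A → Prop} {z : A → Num S} (hc : S.Circuit U {c} k'' d'')
    (hx : S.Circuit U (S.parts x) k d) (hy : S.Circuit U (S.parts y) k' d')
    (h₁ : ∀ a, c a → z a = x a) (h₂ : ∀ a, ¬ c a → z a = y a) :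
    S.Circuit U (S.parts z) (k + k' + k'' + 20) (max (max d d') d'' + 1) := by
  set V : Set (A → Prop) := {c} ∪ S.parts x ∪ S.parts y
  have hcV : S.Circuit V {c} 0 0 := of_subset fun f hf => Or.inl (Or.inl hf)
  have hxV : S.Circuit V (S.parts x) 0 0 := of_subset fun f hf => Or.inl (Or.inr hf)
  have hyV : S.Circuit V (S.parts y) 0 0 := of_subset fun f hf => Or.inr hf
  have hs : S.Circuit V {fun a => (z a).sign = true} 1 1 := by
    refine ((hcV.union hxV.sign_of_parts).union hyV.sign_of_parts).trans_computes (k' := 1)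
      (Computes.single (c := 4) ?_) ?_ |>.mono (by norm_num) (by norm_num)
    · have h₀ : Definable ({c} ∪ {fun a => (x a).sign = true} ∪ {fun a => (y a).sign = true}) 1
        c := .var (Or.inl (Or.inl rfl))
      have h₁ : Definable ({c} ∪ {fun a => (x a).sign = true} ∪ {fun a => (y a).sign = true}) 1
        fun a => (x a).sign = true := .var (Or.inl (Or.inr rfl))
      have h₂ : Definable ({c} ∪ {fun a => (x a).sign = true} ∪ {fun a => (y a).sign = true}) 1
        fun a => (y a).sign = true := .var (Or.inr rfl)
      refine ((h₀.and h₁).or (h₀.not.and h₂)).of_iff fun a => ?_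
      by_cases h : c a <;> simp [*]
    · have := S.width_le_unit
      have := p_lt_width S
      omega
  have hm : S.Circuit V (S.digits fun a => ((z a).mant : ℤ)) 5 1 :=
    (hcV.ite hxV.mant_of_parts hyV.mant_of_parts (fun a h => by rw [h₁ a h])
      fun a h => by rw [h₂ a h]).mono (by norm_num) (by norm_num)
  have he : S.Circuit V (S.digits fun a => (z a).exponent) 5 1 :=
    (hcV.ite hxV.exponent_of_parts hyV.exponent_of_parts (fun a h => by rw [h₁ a h])
      fun a h => by rw [h₂ a h]).mono (by norm_num) (by norm_num)
  exact (((hc.union hx).union hy).trans (hs.parts_of hm he)).mono (by omega) (by omega)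

theorem cond_neg {c : A → Prop} {z w : A → ℤ} (hc : S.Circuit U {c} k d)
    (hz : S.Circuit U (S.digits z) k' d') (h₁ : ∀ a, c a → w a = z a)
    (h₂ : ∀ a, ¬ c a → w a = -z a) :
    S.Circuit U (S.digits w) (k + 2 * k' + 45) (max d d' + 4) :=
  (hc.ite hz ((const (k := 0) (d := 0) (z := fun _ => 0) 0 fun _ => rfl).sub hz
    (y := fun a => -z a) fun a => by simp) h₁ h₂).mono (by omega) (by omega)

theorem abs_exponent_sub (x y : Num S) :
    |x.exponent - y.exponent| < (S.β : ℤ) ^ (S.width - 1) := by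
  have h₁ := abs_le.mp x.abs_exponent_le
  have h₂ := abs_le.mp y.abs_exponent_le
  have h₃ := S.exp_bound
  have := maxExp_pos (S := S)
  rw [abs_lt]
  constructor <;> omega

/-- Multiplication by a power of the base that is given by a difference of exponents. -/
theorem shift {z δ w : A → ℤ} {far : A → Prop} {n : ℕ} (hn : n < S.width)
    (hz : S.Circuit U (S.digits z) k d) (hδ : S.Circuit U (S.digits δ) k' d')
    (hfar : S.Circuit U {far} k'' d'') (h₀ : ∀ a, 0 ≤ δ a) (h₁ : ∀ a, δ a < (S.β : ℤ) ^ S.width)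
    (hf : ∀ a, ¬ far a ↔ δ a < n) (hw : ∀ a, ¬ far a → w a = z a * (S.β : ℤ) ^ (δ a).toNat)
    (hw' : ∀ a, far a → w a = 0) :
    S.Circuit U (S.digits w) (k + k' + k'' + 8) (max (max d d') d'' + 2) := by
  set V : Set (A → Prop) := S.digits z ∪ S.digits δ ∪ {far}
  have hunit : S.width * S.width ≤ S.unit := by
    have : S.width ^ 2 ≤ S.width ^ 4 := Nat.pow_le_pow_right S.width_pos (by norm_num)
    rw [← sq]; unfold unit; omega
  have hnb : (n : ℤ) < (S.β : ℤ) ^ S.width := by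
    have h : S.width < S.β ^ S.width := Nat.lt_pow_self S.two_le_β
    exact_mod_cast hn.trans h
  have c₁ : Computes V (Set.range fun (j : Fin n) a => δ a = (j : ℕ)) (2 * S.unit) 1 := by
    refine (Computes.layer (c := S.width) (fun (j : Fin n) a => δ a = (j : ℕ)) fun j =>
      definable_eq_const (fun f hf => .var (Or.inl (Or.inr hf))) h₀ h₁ (Int.natCast_nonneg _) ?_).mono
      ?_ le_rfl
    · have hj : ((j : ℕ) : ℤ) < n := by exact_mod_cast j.2
      exact hj.trans hnb
    · rw [Fintype.card_fin]
      have hW := S.width_pos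
      calc n * (S.width + 1) ≤ S.width * (2 * S.width) := Nat.mul_le_mul hn.le (by omega)
        _ = 2 * (S.width * S.width) := by ring
        _ ≤ _ := by omega
  have c₂ : Computes (V ∪ Set.range fun (j : Fin n) a => δ a = (j : ℕ)) (S.digits w)
      (4 * S.unit) 1 := by
    refine (computes_select (n := n + 1) (s := fun j a => if j < n then δ a = (j : ℕ) else far a)
      (x := fun j a => if j < n then z a * (S.β : ℤ) ^ j else 0) ?_ ?_ ?_ ?_).mono ?_ le_rfl
    · intro j _
      by_cases hj : j < n
      · simp only [hj, if_true]
        exact .var (Or.inr ⟨⟨j, hj⟩, rfl⟩)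
      · simp only [hj, if_false]
        exact .var (Or.inl (Or.inr rfl))
    · intro j _
      by_cases hj : j < n
      · simp only [hj, if_true]
        exact literal_mul_pow (fun f hf => .var (Or.inl (Or.inl (Or.inl hf)))) fun _ => rfl
      · simp only [hj, if_false]
        exact literal_of_lt fun i _ c _ =>
          .trivial ((0 : ℤ) / (S.β : ℤ) ^ i % S.β = (c : ℕ))
    · intro a
      by_cases h : far a
      · exact ⟨n, by omega, by simpa using h⟩
      · have := (hf a).mp h
        have h0 := h₀ a
        refine ⟨(δ a).toNat, by omega, ?_⟩
        rw [if_pos (by omega)]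
        omega
    · intro a j _ hj
      by_cases h : j < n
      · simp only [h, if_true] at hj ⊢
        have hnf : ¬ far a := (hf a).mpr (by omega)
        rw [hw a hnf, hj, Int.toNat_natCast]
      · simp only [h, if_false] at hj ⊢
        exact hw' a hj
    · have := S.width_mul_β_le
      have hW := S.width_pos
      calc S.width * S.β * ((n + 1) * 2 + 1) ≤ S.width * S.β * (4 * S.width) :=
            Nat.mul_le_mul_left _ (by
              have := p_lt_width S
              omega)
        _ = 4 * (S.width ^ 2 * S.β) := by ring
        _ ≤ _ := by omega
  have c₃ := (c₁.trans_union c₂).subset (Set.subset_union_right)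
  exact (((hz.union hδ).union hfar).trans_computes c₃ (k' := 6) (by omega)).mono
    (by omega) (by omega)

theorem val_add_val (b c : Num S) (h : c.exponent ≤ b.exponent) :
    b.val + c.val = (((if b.sign = true then 1 else -1) *
      (b.mant * (S.β : ℤ) ^ (b.exponent - c.exponent).toNat) +
      (if c.sign = true then 1 else -1) * c.mant : ℤ) : ℚ) * (S.β : ℚ) ^ (c.exponent - S.p) := by
  have e : (S.β : ℚ) ^ (b.exponent - S.p) =
      (S.β : ℚ) ^ (b.exponent - c.exponent).toNat * (S.β : ℚ) ^ (c.exponent - S.p) := by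
    rw [← zpow_natCast, ← zpow_β_add]
    congr 1
    omega
  rw [b.val_eq, c.val_eq, Num.mag, Num.mag, e, sgn, sgn]
  push_cast
  cases b.sign <;> cases c.sign <;> simp <;> ring

-- With `b` of the larger exponent there are two cases. If the exponents are at least p + 2 apart,
-- the result is `b` itself by `round_add_of_far`. Otherwise the fraction of `b` is shifted left by
-- fewer than p + 2 places to the exponent of `c`, and the exact signed integer sum is rounded.
open Classical in
theorem add_aux {b c : A → Num S} (hbc : ∀ a, (c a).exponent ≤ (b a).exponent) :
    S.Circuit (S.parts b ∪ S.parts c) (S.parts fun a => FPSystem.add (b a) (c a)) 7000 80 := by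
  have hW := p_lt_width S
  have hEb := S.exp_bound
  have hE := maxExp_pos (S := S)
  set V : Set (A → Prop) := S.parts b ∪ S.parts c
  have hb : S.Circuit V (S.parts b) 0 0 := of_subset Set.subset_union_left
  have hc : S.Circuit V (S.parts c) 0 0 := of_subset Set.subset_union_right
  have hcst : ∀ n : ℤ, S.Circuit V (S.digits fun _ => n) 0 0 := fun n => const n fun _ => rfl
  let δ : A → ℤ := fun a => (b a).exponent - (c a).exponent
  have hδ : S.Circuit V (S.digits δ) 40 3 := hb.exponent_of_parts.sub hc.exponent_of_parts
    fun _ => rfl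
  have hδ0 : ∀ a, 0 ≤ δ a := fun a => sub_nonneg.mpr (hbc a)
  have hδb : ∀ a, δ a ≤ 2 * S.maxExp := fun a => by
    have h₁ := abs_le.mp (b a).abs_exponent_le
    have h₂ := abs_le.mp (c a).abs_exponent_le
    simp only [δ]
    omega
  have hpw : (S.β : ℤ) ^ (S.width - 1) < (S.β : ℤ) ^ S.width := β_pow_lt (by omega)
  let far : A → Prop := fun a => ¬ δ a < ((S.p + 2 : ℕ) : ℤ)
  have hfar : S.Circuit V {far} 80 6 := by
    refine ((hδ.lt (hcst ((S.p + 2 : ℕ) : ℤ)) (fun a => ?_)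
      (p := fun a => δ a < ((S.p + 2 : ℕ) : ℤ)) fun _ => Iff.rfl).not fun _ => Iff.rfl).mono
      (by norm_num) (by norm_num)
    have := hδ0 a
    have := hδb a
    push_cast
    rw [abs_lt]
    constructor <;> omega
  -- In the far case the value is discarded later; the default 0 keeps the integers within the range
  -- required for comparisons and rounding.
  let w : A → ℤ := fun a => if far a then 0 else (b a).mant * (S.β : ℤ) ^ (δ a).toNat
  have hw : S.Circuit V (S.digits w) 128 8 :=
    (hb.mant_of_parts.shift (n := S.p + 2) (by omega) hδ hfar hδ0
      (fun a => by have := hδb a; omega) (fun a => not_not) (fun a h => if_neg h)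
      fun a h => if_pos h).mono (by norm_num) (by norm_num)
  have hw0 : ∀ a, 0 ≤ w a ∧ w a < (S.β : ℤ) ^ (2 * S.p + 1) := fun a => by
    simp only [w]
    split_ifs with h
    · exact ⟨le_rfl, β_pow_pos _⟩
    · have h' : δ a < ((S.p + 2 : ℕ) : ℤ) := not_not.mp h
      refine ⟨mul_nonneg (Int.natCast_nonneg _) (β_pow_pos _).le, ?_⟩
      calc ((b a).mant : ℤ) * (S.β : ℤ) ^ (δ a).toNat < (S.β : ℤ) ^ S.p * (S.β : ℤ) ^ (δ a).toNat :=
            mul_lt_mul_of_pos_right (mant_lt_cast _) (β_pow_pos _)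
        _ = (S.β : ℤ) ^ (S.p + (δ a).toNat) := by rw [pow_add]
        _ ≤ _ := pow_le_pow_right₀ (by exact_mod_cast S.β_pos) (by omega)
  let zb : A → ℤ := fun a => if (b a).sign = true then w a else -w a
  have hzb : S.Circuit V (S.digits zb) 301 12 :=
    (hb.sign_of_parts.cond_neg hw (fun a h => if_pos h) fun a h => if_neg h).mono (by norm_num) (by norm_num)
  let zc : A → ℤ := fun a => if (c a).sign = true then ((c a).mant : ℤ) else -((c a).mant : ℤ)
  have hzc : S.Circuit V (S.digits zc) 45 4 :=
    (hc.sign_of_parts.cond_neg hc.mant_of_parts (fun a h => if_pos h) fun a h => if_neg h).mono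
      (by norm_num) (by norm_num)
  let Z : A → ℤ := fun a => zb a + zc a
  have hZ : S.Circuit V (S.digits Z) 386 15 :=
    (hzb.add hzc fun _ => rfl).mono (by norm_num) (by norm_num)
  -- The shift is by at most p + 1 places, so both summands are below β^(2p+1), and their sum is
  -- below β^(2p+2). This is what `prec`, that is 2p + 3, has to accommodate.
  have hZb : ∀ a, |Z a| < (S.β : ℤ) ^ S.prec := fun a => by
    have h₁ : |zb a| < (S.β : ℤ) ^ (2 * S.p + 1) := by
      have := hw0 a
      simp only [zb]
      split_ifs
      · rw [abs_of_nonneg this.1]; exact this.2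
      · rw [abs_neg, abs_of_nonneg this.1]; exact this.2
    have h₂ : |zc a| < (S.β : ℤ) ^ (2 * S.p + 1) := by
      have := mant_lt_cast (c a)
      have h' := β_pow_lt (S := S) (show S.p < 2 * S.p + 1 by omega)
      simp only [zc]
      split_ifs
      · rw [Nat.abs_cast]; linarith
      · rw [abs_neg, Nat.abs_cast]; linarith
    have h₃ : 2 * (S.β : ℤ) ^ (2 * S.p + 1) ≤ (S.β : ℤ) ^ (2 * S.p + 2) := by
      rw [pow_succ' _ (2 * S.p + 1)]
      exact mul_le_mul_of_nonneg_right (by exact_mod_cast S.two_le_β) (β_pow_pos _).le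
    have h₄ := β_pow_lt (S := S) (show 2 * S.p + 2 < S.prec by unfold prec; omega)
    have := abs_add_le (zb a) (zc a)
    simp only [Z]
    linarith
  have hσ : S.Circuit V {fun a => ¬ Z a < 0} 426 18 := by
    refine ((hZ.lt (hcst 0) (fun a => ?_) (p := fun a => Z a < 0) fun _ => Iff.rfl).not
      fun _ => Iff.rfl).mono (by norm_num) (by norm_num)
    rw [sub_zero]
    exact (hZb a).trans S.pow_prec_lt
  have hM : S.Circuit V (S.digits fun a => ((Z a).natAbs : ℤ)) 1243 22 :=
    (hσ.cond_neg hZ (fun a h => by omega) fun a h => by omega).mono (by norm_num) (by norm_num)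
  have he : S.Circuit V (S.digits fun a => (c a).exponent - S.p) 40 3 :=
    hc.exponent_of_parts.sub (hcst _) fun _ => rfl
  let y : A → Num S := fun a => FPSystem.round S (sgn (decide (¬ Z a < 0)) *
    ((Z a).natAbs * (S.β : ℚ) ^ ((c a).exponent - S.p)))
  have hy : S.Circuit V (S.parts y) 6709 62 := by
    refine (Circuit.round hσ hM he (fun a => ?_) (fun a => ?_) fun a s hs => ?_).mono
      (by norm_num) (by norm_num)
    · have := hZb a
      rw [Int.abs_eq_natAbs] at this
      exact_mod_cast this
    · have h₁ := abs_le.mp (c a).abs_exponent_le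
      rw [abs_le]
      constructor <;> omega
    · have : s = decide (¬ Z a < 0) := by rw [Bool.eq_iff_iff, hs, decide_eq_true_eq]
      rw [this]
  refine (hfar.ite_num hb hy (fun a h => ?_) fun a h => ?_).mono (by norm_num) (by norm_num)
  · exact round_add_of_far _ _ (by
      have h' : ¬ δ a < ((S.p + 2 : ℕ) : ℤ) := h
      simp only [δ] at h'
      push_cast at h'
      omega)
  · rw [FPSystem.add, val_add_val _ _ (hbc a)]
    have hZe : ((if (b a).sign = true then 1 else -1) *
        ((b a).mant * (S.β : ℤ) ^ ((b a).exponent - (c a).exponent).toNat) +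
        (if (c a).sign = true then 1 else -1) * (c a).mant : ℤ) = Z a := by
      simp only [Z, zb, zc, w, δ, if_neg h]
      split_ifs <;> ring
    rw [hZe]
    simp only [y]
    rw [← mul_assoc]
    congr 2
    by_cases hneg : Z a < 0
    · have : ((Z a).natAbs : ℤ) = - Z a := by omega
      have h' : ((Z a).natAbs : ℚ) = -(Z a : ℚ) := by
        rw [← Int.cast_natCast, this]; push_cast; rfl
      simp [hneg, sgn, h']
    · have : ((Z a).natAbs : ℤ) = Z a := by omega
      have h' : ((Z a).natAbs : ℚ) = (Z a : ℚ) := by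
        rw [← Int.cast_natCast, this]
      simp [hneg, sgn, h']

-- Since addition is commutative, the operands may be exchanged by a comparison of exponents to
-- reach the situation of `add_aux`.
open Classical in
theorem add_num (hx : S.Circuit U (S.parts x) k d) (hy : S.Circuit U (S.parts y) k' d') :
    S.Circuit U (S.parts fun a => FPSystem.add (x a) (y a)) (k + k' + 7200)
      (max d d' + 90) := by
  set V : Set (A → Prop) := S.parts x ∪ S.parts y
  have hxV : S.Circuit V (S.parts x) 0 0 := of_subset Set.subset_union_left
  have hyV : S.Circuit V (S.parts y) 0 0 := of_subset Set.subset_union_right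
  let p : A → Prop := fun a => (x a).exponent < (y a).exponent
  have hp : S.Circuit V {p} 40 3 := hxV.exponent_of_parts.lt hyV.exponent_of_parts
    (fun a => abs_exponent_sub _ _) fun _ => Iff.rfl
  let b : A → Num S := fun a => if p a then y a else x a
  let c : A → Num S := fun a => if p a then x a else y a
  have hb : S.Circuit V (S.parts b) _ _ :=
    hp.ite_num hyV hxV (fun a h => if_pos h) fun a h => if_neg h
  have hc : S.Circuit V (S.parts c) _ _ :=
    hp.ite_num hxV hyV (fun a h => if_pos h) fun a h => if_neg h
  have h := (hb.union hc).trans (add_aux fun a => ?_)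
  · refine ((hx.union hy).trans h |>.mono (by omega) (by omega)).subset ?_
    have : (fun a => FPSystem.add (x a) (y a)) = fun a => FPSystem.add (b a) (c a) := by
      funext a
      simp only [b, c]
      split_ifs
      · exact add_comm' _ _
      · rfl
    rw [this]
  · simp only [b, c]
    split_ifs with h
    · exact le_of_lt h
    · exact not_lt.mp h

end Circuit

end FPSystem

/-! ## Circuits for piecewise polynomial functions -/

theorem FPSystem.pairUp_map {A B : Type} (f : A → B) {op : A → A → A} {op' : B → B → B}
    (h : ∀ x y, f (op x y) = op' (f x) (f y)) :
    ∀ l : List A, (pairUp op l).map f = pairUp op' (l.map f)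
  | a :: b :: l => by simp [pairUp, h, pairUp_map f h l]
  | [a] => rfl
  | [] => rfl

theorem FPSystem.iterate_pairUp_map {A B : Type} (f : A → B) {op : A → A → A} {op' : B → B → B}
    (h : ∀ x y, f (op x y) = op' (f x) (f y)) (n : ℕ) (l : List A) :
    ((pairUp op)^[n] l).map f = (pairUp op')^[n] (l.map f) := by
  induction n generalizing l with
  | zero => rfl
  | succ n ih => rw [Function.iterate_succ_apply, Function.iterate_succ_apply, ih, pairUp_map f h]

theorem FPSystem.length_pairUp {A : Type} (op : A → A → A) :
    ∀ l : List A, (pairUp op l).length = (l.length + 1) / 2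
  | a :: b :: l => by simp only [pairUp, List.length_cons, length_pairUp op l]; omega
  | [a] => by simp [pairUp]
  | [] => by simp [pairUp]

namespace FPSystem

open BNL

variable {A : Type} {U V : Set (A → Prop)} {S : FPSystem}

/-- The predicates that describe the numbers in a list. -/
def listParts (l : List (A → Num S)) : Set (A → Prop) := {f | ∃ x ∈ l, f ∈ S.parts x}

namespace Circuit

variable {k k' k'' d d' d'' : ℕ} {x y : A → Num S}

theorem list_union {l : List (A → Num S)} (h : ∀ x ∈ l, S.Circuit U (S.parts x) k d) :
    S.Circuit U (listParts l) (l.length * k) d := by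
  induction l with
  | nil => exact (of_subset (V := listParts ([] : List (A → Num S)))
      (by rintro f ⟨x, hx, -⟩; simp at hx)).mono (Nat.zero_le _) (Nat.zero_le _)
  | cons y l ih =>
    refine (((h y (by simp)).union (ih fun x hx => h x (by simp [hx]))).subset ?_).mono
      (by rw [List.length_cons, Nat.succ_mul]; omega) (by simp)
    rintro f ⟨x, hx, hf⟩
    rcases List.mem_cons.mp hx with rfl | hx
    · exact Or.inl hf
    · exact Or.inr ⟨x, hx, hf⟩

theorem pairUp {op : (A → Num S) → (A → Num S) → A → Num S}
    (h : ∀ x y, S.Circuit (S.parts x ∪ S.parts y) (S.parts (op x y)) k d) :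
    ∀ l : List (A → Num S), S.Circuit (listParts l) (listParts (FPSystem.pairUp op l))
      (l.length / 2 * k) d
  | x :: y :: l => by
    have h₁ : S.Circuit (listParts (x :: y :: l)) (S.parts (op x y)) k d :=
      ((of_subset (S := S) (V := S.parts x ∪ S.parts y) (by
        rintro f (hf | hf)
        · exact ⟨x, by simp, hf⟩
        · exact ⟨y, by simp, hf⟩)).trans (h x y)).mono (by omega) (by omega)
    have h₂ : S.Circuit (listParts (x :: y :: l)) (listParts (FPSystem.pairUp op l))
        (l.length / 2 * k) d :=
      ((of_subset (S := S) (V := listParts l) (by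
        rintro f ⟨z, hz, hf⟩
        exact ⟨z, by simp [hz], hf⟩)).trans (pairUp h l)).mono (by omega) (by omega)
    refine ((h₁.union h₂).subset ?_).mono ?_ (by simp)
    · rintro f ⟨z, hz, hf⟩
      rcases List.mem_cons.mp hz with rfl | hz
      · exact Or.inl hf
      · exact Or.inr ⟨z, hz, hf⟩
    · rw [List.length_cons, List.length_cons, show (l.length + 1 + 1) / 2 = l.length / 2 + 1 by omega,
        Nat.succ_mul]
      omega
  | [x] => (of_subset le_rfl).mono (Nat.zero_le _) (Nat.zero_le _)
  | [] => (of_subset le_rfl).mono (Nat.zero_le _) (Nat.zero_le _)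

/-- A level uses ⌊l/2⌋ operations and leaves ⌈l/2⌉ entries, so by induction `l.length` operations
suffice in total. Levels beyond `m` leave the single remaining entry unchanged and cost nothing. -/
theorem iterate_pairUp {op : (A → Num S) → (A → Num S) → A → Num S}
    (h : ∀ x y, S.Circuit (S.parts x ∪ S.parts y) (S.parts (op x y)) k d) (m : ℕ) :
    ∀ (l : List (A → Num S)) (n : ℕ), l ≠ [] → l.length ≤ 2 ^ m → m ≤ n →
      ∃ x, (FPSystem.pairUp op)^[n] l = [x] ∧
        S.Circuit (listParts l) (S.parts x) (l.length * k) (m * d) := by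
  induction m with
  | zero =>
    intro l n hl hm _
    obtain ⟨x, rfl⟩ : ∃ x, l = [x] := List.length_eq_one_iff.mp
      (le_antisymm (by simpa using hm) (List.length_pos_iff.mpr hl))
    have h₀ : S.Circuit (listParts [x]) (S.parts x) 0 0 := of_subset fun f hf => ⟨x, by simp, hf⟩
    exact ⟨x, Function.iterate_fixed rfl n, h₀.mono (Nat.zero_le _) (Nat.zero_le _)⟩
  | succ m ih =>
    intro l n hl hm hn
    obtain ⟨n, rfl⟩ : ∃ n', n = n' + 1 := ⟨n - 1, by omega⟩
    have hlen := length_pairUp op l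
    have h0 := List.length_pos_iff.mpr hl
    obtain ⟨x, e, hx⟩ := ih (FPSystem.pairUp op l) n
      (List.length_pos_iff.mp (by omega)) (by rw [pow_succ] at hm; omega) (by omega)
    refine ⟨x, e, ((pairUp h l).trans hx).mono ?_ ?_⟩
    · rw [hlen, ← Nat.add_mul]
      exact Nat.mul_le_mul_right _ (by omega)
    · rw [Nat.succ_mul]; omega

/-- The circuit works on a list of number-valued functions. Pairing up commutes with evaluation at a
point (`iterate_pairUp_map`), which identifies the result with the fold of the values. -/
theorem treeFold {op : Num S → Num S → Num S}
    (h : ∀ x y : A → Num S, S.Circuit (S.parts x ∪ S.parts y)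
      (S.parts fun a => op (x a) (y a)) k d)
    (l : List (A → Num S)) (hl : l ≠ []) (c : Num S) :
    S.Circuit (listParts l) (S.parts fun a => FPSystem.treeFold op c (l.map fun x => x a))
      (l.length * k) (Nat.clog 2 l.length * d) := by
  obtain ⟨x, e, hx⟩ := iterate_pairUp (op := fun x y a => op (x a) (y a)) h (Nat.clog 2 l.length) l
    l.length hl (Nat.le_pow_clog (by norm_num) _)
    (Nat.clog_le_of_le_pow Nat.lt_two_pow_self.le)
  convert hx using 3 with a
  rw [FPSystem.treeFold, List.length_map, ← iterate_pairUp_map (fun x : A → Num S => x a)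
    (op := fun x y a => op (x a) (y a)) fun _ _ => rfl, e]
  rfl

theorem const_num (c : Num S) : S.Circuit U (S.parts fun _ => c) 0 0 :=
  (parts_of (k := 0) (d := 0) (const_prop _ fun _ => Iff.rfl) (const (k := 0) (d := 0) _ fun _ => rfl)
    (const (k := 0) (d := 0) _ fun _ => rfl)).mono le_rfl (by simp)

theorem monomial (hx : S.Circuit U (S.parts x) k d) (c : Num S) (i : ℕ) :
    S.Circuit U (S.parts fun a => FPSystem.monomial c i (x a)) (k + (i + 1) * 6000)
      (d + Nat.clog 2 (i + 1) * (3 * S.logDepth + 60)) := by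
  have h := treeFold (op := FPSystem.mul) (k := 6000) (d := 3 * S.logDepth + 60)
    (fun x y => (mul_num (of_subset Set.subset_union_left) (of_subset Set.subset_union_right)).mono
      (by norm_num) (by simp)) ((fun _ => c) :: List.replicate i x) (by simp) (zero S)
  have h₀ : S.Circuit (S.parts x) (listParts ((fun _ => c) :: List.replicate i x)) 0 0 :=
    (list_union (k := 0) (d := 0) fun y hy => by
      rcases List.mem_cons.mp hy with rfl | hy
      · exact const_num c
      · rw [List.eq_of_mem_replicate hy]
        exact of_subset le_rfl).mono (by simp) le_rfl
  refine (hx.trans (h₀.trans h)).mono (by simp) (by simp) |>.subset ?_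
  simp [FPSystem.monomial]

/-- All `n + 1` terms are computed in parallel, each with at most `n + 1` charged multiplications;
this is the source of the factor Ω². The trees of products and the tree of sums follow each other,
so their logarithmic depths add. -/
theorem evalPoly (hx : S.Circuit U (S.parts x) k d) {n : ℕ} (c : Fin (n + 1) → Num S) :
    S.Circuit U (S.parts fun a => FPSystem.evalPoly c (x a)) (k + (n + 1) * ((n + 1) * 6000 + 7200))
      (d + Nat.clog 2 (n + 1) * (3 * S.logDepth + 150)) := by
  have h := treeFold (op := FPSystem.add) (k := 7200) (d := 90)
    (fun x y => (add_num (of_subset Set.subset_union_left) (of_subset Set.subset_union_right)).mono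
      (by norm_num) (by simp))
    (List.ofFn fun (i : Fin (n + 1)) a => FPSystem.monomial (c i) i (x a)).reverse (by simp)
    (zero S)
  have h₀ : S.Circuit (S.parts x)
      (listParts (List.ofFn fun (i : Fin (n + 1)) a => FPSystem.monomial (c i) i (x a)).reverse)
      ((n + 1) * ((n + 1) * 6000)) (Nat.clog 2 (n + 1) * (3 * S.logDepth + 60)) :=
    (list_union (k := (n + 1) * 6000) (d := Nat.clog 2 (n + 1) * (3 * S.logDepth + 60))
      fun y hy => by
        obtain ⟨i, rfl⟩ := List.mem_ofFn.mp (List.mem_reverse.mp hy)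
        have hi := i.2
        exact (monomial (of_subset le_rfl) _ _).mono
          (by rw [Nat.zero_add]; exact Nat.mul_le_mul_right _ (by omega))
          (by
            rw [Nat.zero_add]
            exact Nat.mul_le_mul_right _ (Nat.clog_mono_right _ (by omega)))).mono
      (by simp) le_rfl
  refine (hx.trans (h₀.trans h)).mono ?_ ?_ |>.subset ?_
  · simp only [List.length_reverse, List.length_ofFn]
    rw [Nat.mul_add]
  · simp only [List.length_reverse, List.length_ofFn]
    rw [← Nat.mul_add]
  · simp only [FPSystem.evalPoly, List.map_reverse, List.map_ofFn]
    rfl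

end Circuit

/-! ### A monotone integer key for numbers, and circuits for the pieces -/

namespace Num

/-- The position of the absolute value of a number in the increasing enumeration. -/
def absKey (x : Num S) : ℤ := (x.exponent + S.maxExp) * (S.β : ℤ) ^ S.p + x.mant

/-- An integer that depends on a number in a strictly increasing way. -/
def key (x : Num S) : ℤ := if x.sign = true then x.absKey else -x.absKey

theorem absKey_nonneg (x : Num S) : 0 ≤ x.absKey := by
  have := abs_le.mp x.abs_exponent_le
  exact add_nonneg (mul_nonneg (by linarith) (β_pow_pos _).le) (Int.natCast_nonneg _)

theorem absKey_zero : (zero S).absKey = 0 := by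
  simp [absKey, exponent_zero, mant_zero]

theorem absKey_lt (x : Num S) : x.absKey < 2 * (S.β : ℤ) ^ (S.p + S.q) := by
  have h₁ := abs_le.mp x.abs_exponent_le
  have h₂ := Circuit.mant_lt_cast x
  have h₃ := β_pow_pos (S := S) S.p
  have h₄ : (x.exponent + S.maxExp + 1) * (S.β : ℤ) ^ S.p ≤ (2 * (S.β : ℤ) ^ S.q) * (S.β : ℤ) ^ S.p :=
    mul_le_mul_of_nonneg_right (by unfold maxExp at *; linarith) h₃.le
  rw [absKey, pow_add]
  linarith

/-- Magnitudes are ordered lexicographically, by exponent and then by fraction, and the key packs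
the two into one integer with the fraction in the low `p` digits. Zero fits in because it has the
smallest exponent and fraction 0, hence key 0. -/
theorem absKey_le_of_mag_le {x y : Num S} (h : x.mag ≤ y.mag) : x.absKey ≤ y.absKey := by
  by_cases hx : x = zero S
  · rw [hx, absKey_zero]; exact y.absKey_nonneg
  have h₁ := Circuit.mant_lt_cast x
  have h₃ := β_pow_pos (S := S) S.p
  rcases (exponent_le_of_mag hx h).lt_or_eq with he | he
  · have : (x.exponent + S.maxExp + 1) * (S.β : ℤ) ^ S.p ≤ (y.exponent + S.maxExp) * (S.β : ℤ) ^ S.p :=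
      mul_le_mul_of_nonneg_right (by linarith) h₃.le
    have := Int.natCast_nonneg y.mant
    unfold absKey
    linarith
  · rw [mag, mag, he] at h
    have := (mul_le_mul_iff_left₀ (zpow_β_pos _)).mp h
    have : (x.mant : ℤ) ≤ y.mant := by exact_mod_cast this
    rw [absKey, absKey, he]
    linarith

/-- For the converse, fraction and exponent are recovered from the key as remainder and quotient
modulo β^p, so equal keys force equal magnitudes. -/
theorem mag_le_iff {x y : Num S} : x.mag ≤ y.mag ↔ x.absKey ≤ y.absKey := by
  refine ⟨absKey_le_of_mag_le, fun h => not_lt.mp fun hlt => hlt.ne' ?_⟩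
  have e : x.absKey = y.absKey := le_antisymm h (absKey_le_of_mag_le hlt.le)
  have h₃ := β_pow_pos (S := S) S.p
  have key : ∀ z : Num S, z.absKey % (S.β : ℤ) ^ S.p = z.mant ∧
      z.absKey / (S.β : ℤ) ^ S.p = z.exponent + S.maxExp := fun z => by
    have h₁ := Circuit.mant_lt_cast z
    have h₂ := Int.natCast_nonneg z.mant
    rw [absKey, _root_.add_comm]
    exact ⟨by rw [Int.add_mul_emod_self_right, Int.emod_eq_of_lt h₂ h₁],
      by rw [Int.add_mul_ediv_right _ _ h₃.ne', Int.ediv_eq_zero_of_lt h₂ h₁, zero_add]⟩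
  have h₁ : (x.mant : ℤ) = y.mant := by rw [← (key x).1, ← (key y).1, e]
  have h₂ : x.exponent = y.exponent := by
    have := (key x).2.symm.trans ((congrArg (· / (S.β : ℤ) ^ S.p) e).trans (key y).2)
    linarith
  rw [mag, mag, h₂, show x.mant = y.mant by exact_mod_cast h₁]

/-- For equal signs this is the comparison of magnitudes, possibly reversed. For different signs
only the question whether both numbers are zero can matter. -/
theorem val_le_iff {x y : Num S} : x.val ≤ y.val ↔ x.key ≤ y.key := by
  have h₀ : ∀ z : Num S, z.mag ≤ 0 ↔ z.absKey ≤ 0 := fun z => by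
    rw [← mag_zero (S := S), ← absKey_zero (S := S), mag_le_iff]
  have hx := x.absKey_nonneg
  have hy := y.absKey_nonneg
  have hx' := x.mag_nonneg
  have hy' := y.mag_nonneg
  have hx₀ := h₀ x
  have hy₀ := h₀ y
  rw [val_eq, val_eq, key, key]
  cases hs : x.sign <;> cases ht : y.sign <;> simp only [sgn, if_true, one_mul, neg_one_mul,
    Bool.false_eq_true, if_false, neg_le_neg_iff]
  · exact mag_le_iff
  · exact iff_of_true (by linarith) (by linarith)
  · refine ⟨fun h => ?_, fun h => ?_⟩
    · have := hx₀.mp (by linarith)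
      have := hy₀.mp (by linarith)
      linarith
    · have := hx₀.mpr (by linarith)
      have := hy₀.mpr (by linarith)
      linarith
  · exact mag_le_iff

theorem abs_key (x : Num S) : |x.key| < 2 * (S.β : ℤ) ^ (S.p + S.q) := by
  have h₁ := x.absKey_nonneg
  have h₂ := x.absKey_lt
  unfold key
  split_ifs
  · rwa [abs_of_nonneg h₁]
  · rwa [abs_neg, abs_of_nonneg h₁]

theorem abs_key_sub (x y : Num S) : |x.key - y.key| < (S.β : ℤ) ^ (S.width - 1) := by
  have h₁ := abs_sub x.key y.key
  have h₂ := x.abs_key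
  have h₃ := y.abs_key
  have h₄ : (S.β : ℤ) ^ (S.p + S.q + 2) ≤ (S.β : ℤ) ^ (S.width - 1) :=
    pow_le_pow_right₀ (by exact_mod_cast S.β_pos) (by
      have := S.p_pos
      unfold width
      omega)
  have h₅ : 2 * 2 * (S.β : ℤ) ^ (S.p + S.q) ≤ (S.β : ℤ) ^ (S.p + S.q + 2) := by
    have h : (2 : ℤ) ≤ S.β := by exact_mod_cast S.two_le_β
    rw [pow_add _ _ 2, sq, _root_.mul_comm ((S.β : ℤ) ^ (S.p + S.q))]
    exact mul_le_mul_of_nonneg_right (mul_le_mul h h (by norm_num) (by linarith)) (β_pow_pos _).le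
  linarith

/-- An interval contains only finitely many numbers of the system. Its real endpoints may be
replaced by the least and the greatest of these, which turns membership into two comparisons with
constants. -/
theorem mem_ordConnected_iff {I : Set ℝ} (hI : I.OrdConnected) :
    (∀ x : Num S, (x.val : ℝ) ∉ I) ∨
      ∃ a b : Num S, ∀ x : Num S, (x.val : ℝ) ∈ I ↔ a.key ≤ x.key ∧ x.key ≤ b.key := by
  classical
  by_cases h : ∀ x : Num S, (x.val : ℝ) ∉ I
  · exact Or.inl h
  · push Not at h
    obtain ⟨x₀, hx₀⟩ := h
    have hne : (Finset.univ.filter fun x : Num S => (x.val : ℝ) ∈ I).Nonempty :=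
      ⟨x₀, by simpa using hx₀⟩
    obtain ⟨a, ha, ha'⟩ := Finset.exists_min_image _ Num.key hne
    obtain ⟨b, hb, hb'⟩ := Finset.exists_max_image _ Num.key hne
    simp only [Finset.mem_filter, Finset.mem_univ, true_and] at ha ha' hb hb'
    refine Or.inr ⟨a, b, fun x => ⟨fun hx => ⟨ha' x hx, hb' x hx⟩, fun hx => hI.out ha hb ⟨?_, ?_⟩⟩⟩
    · exact_mod_cast val_le_iff.mpr hx.1
    · exact_mod_cast val_le_iff.mpr hx.2

end Num

namespace Circuit

variable {k k' k'' d d' d'' : ℕ} {x y : A → Num S}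

theorem key (hx : S.Circuit U (S.parts x) k d) :
    S.Circuit U (S.digits fun a => (x a).key) (k + 205) (d + 10) := by
  have hV : S.Circuit (S.parts x) (S.parts x) 0 0 := of_subset le_rfl
  have h₁ : S.Circuit (S.parts x) (S.digits fun a => (x a).absKey) 80 6 :=
    (((hV.exponent_of_parts.add (const (k := 0) (d := 0) (z := fun _ => S.maxExp) _ fun _ => rfl)
      (y := fun a => (x a).exponent + S.maxExp) fun _ => rfl).mul_pow (n := S.p) fun _ => rfl).add
      hV.mant_of_parts fun _ => rfl).mono (by norm_num) (by norm_num)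
  exact (hx.trans (hV.sign_of_parts.cond_neg h₁ (fun a h => if_pos h) fun a h => if_neg h)).mono
    (by omega) (by omega)

theorem mem_interval (hx : S.Circuit U (S.parts x) k d) {I : Set ℝ} (hI : I.OrdConnected) :
    S.Circuit U {fun a => ((x a).val : ℝ) ∈ I} (k + 500) (d + 20) := by
  rcases Num.mem_ordConnected_iff (S := S) hI with h | ⟨b, c, h⟩
  · exact const_prop False fun a => iff_of_false (h _) id
  · have hk := (of_subset (S := S) (le_refl (S.parts x))).key
    have h₁ := (hk.lt (const (k := 0) (d := 0) (z := fun _ => b.key) _ fun _ => rfl)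
      (fun a => Num.abs_key_sub _ _) fun _ => Iff.rfl).not (q := fun a => ¬ (x a).key < b.key)
      fun _ => Iff.rfl
    have h₂ := ((const (S := S) (U := S.parts x) (k := 0) (d := 0) (z := fun _ => c.key) _
      fun _ => rfl).lt hk (fun a => Num.abs_key_sub _ _) fun _ => Iff.rfl).not
      (q := fun a => ¬ c.key < (x a).key) fun _ => Iff.rfl
    have h₃ := h₁.and h₂ (r := fun a => ((x a).val : ℝ) ∈ I) fun a => by
      rw [h, not_lt, not_lt]
    exact (hx.trans h₃).mono (by omega) (by omega)

/-- All membership tests and all polynomials are computed side by side, so the depth does not depend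
on `P`. As the pieces cover the system, the memberships can select sign, fraction and exponent of
the result. -/
theorem piecewise {P : ℕ} (D : S.PiecewisePoly P) {α : Num S → Num S} (hα : D.Defines α)
    (hx : S.Circuit U (S.parts x) k d) :
    S.Circuit U (S.parts fun a => α (x a))
      (k + (P * ((D.maxOrder + 1) * ((D.maxOrder + 1) * 6000 + 7200) + 510) + 5))
      (d + (Nat.clog 2 (D.maxOrder + 1) * (3 * S.logDepth + 150) + 21)) := by
  set V : Set (A → Prop) := S.parts x
  set n := D.maxOrder with hn
  set K := (n + 1) * ((n + 1) * 6000 + 7200) with hK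
  set E := Nat.clog 2 (n + 1) * (3 * S.logDepth + 150)
  let s : ℕ → A → Prop := fun j a => ∃ h : j < P, ((x a).val : ℝ) ∈ D.piece ⟨j, h⟩
  let y : ℕ → A → Num S := fun j a =>
    if h : j < P then FPSystem.evalPoly (D.coeff ⟨j, h⟩) (x a) else zero S
  have hV : S.Circuit V V 0 0 := of_subset le_rfl
  have hord : ∀ i, D.order i ≤ n := fun i =>
    (Finset.le_sup (Finset.mem_univ i)).trans (le_max_right _ _)
  have h₁ : S.Circuit V {f | ∃ j < P, f ∈ {s j} ∪ S.parts (y j)} (P * (K + 500)) (E + 20) := by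
    have h := Computes.exists_lt (U := V) (N := P) (Z := fun j => {s j} ∪ S.parts (y j))
      (s := (K + 500) * S.unit) (d := E + 20) fun j hj => by
        have hs : S.Circuit V {s j} 500 20 :=
          ((hV.mem_interval (D.isInterval ⟨j, hj⟩)).of_singleton fun a =>
            ⟨fun h => h.2, fun h => ⟨hj, h⟩⟩).mono (by norm_num) (by norm_num)
        have hy : S.Circuit V (S.parts (y j)) K E := by
          have e : y j = fun a => FPSystem.evalPoly (D.coeff ⟨j, hj⟩) (x a) := by
            funext a
            simp only [y, hj, dite_true]
          have h := Nat.succ_le_succ (hord ⟨j, hj⟩)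
          rw [e]
          refine (hV.evalPoly (D.coeff ⟨j, hj⟩)).mono ?_ ?_
          · rw [Nat.zero_add]
            exact Nat.mul_le_mul h (Nat.add_le_add_right (Nat.mul_le_mul_right _ h) _)
          · rw [Nat.zero_add]
            exact Nat.mul_le_mul_right _ (Nat.clog_mono_right _ h)
        exact (hs.union hy).mono (by omega) (max_le (by omega) (by omega))
    rw [← Nat.mul_assoc] at h
    exact h
  set W : Set (A → Prop) := {f | ∃ j < P, f ∈ {s j} ∪ S.parts (y j)}
  have hs : ∀ j < P, Definable W 1 (s j) := fun j hj => .var ⟨j, hj, Or.inl rfl⟩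
  have hcover : ∀ a, ∃ j < P, s j a := fun a => by
    obtain ⟨i, hi, -⟩ := D.cover (x a)
    exact ⟨i, i.2, i.2, hi⟩
  have hval : ∀ a, ∀ j < P, s j a → α (x a) = y j a := fun a j hj hsj => by
    obtain ⟨h, hm⟩ := hsj
    simp only [y, hj, dite_true]
    exact hα _ _ hm
  have hsel : ∀ z : Num S → ℤ, (∀ j < P, ∀ f ∈ S.digits fun a => z (y j a), f ∈ W) →
      S.Circuit W (S.digits fun a => z (α (x a))) (2 * P + 1) 1 := fun z hz =>
    of_computes (computes_select hs (fun j hj f hf => .var (hz j hj f hf)) hcover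
      fun a j hj h => by rw [hval a j hj h]) (by
        rw [_root_.mul_comm, _root_.mul_comm P]
        exact Nat.mul_le_mul_left _ S.width_β_le)
  have hsign : S.Circuit W {fun a => (α (x a)).sign = true} (2 * P + 1) 1 := by
    refine of_computes (Computes.single (c := P * 2) ?_) ?_
    · refine (Definable.exists_lt (r := fun j a => s j a ∧ (y j a).sign = true) fun j hj =>
        (hs j hj).and (Definable.var ⟨j, hj, Or.inr (Or.inl (Or.inl rfl))⟩)).of_iff fun a => ?_
      refine ⟨fun h => ?_, fun ⟨j, hj, h₁, h₂⟩ => ?_⟩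
      · obtain ⟨j, hj, hsj⟩ := hcover a
        exact ⟨j, hj, hsj, by rw [← hval a j hj hsj]; exact h⟩
      · rw [hval a j hj h₁]; exact h₂
    · rw [_root_.mul_comm P]
      exact Nat.le_mul_of_pos_right _ S.unit_pos
  have hres := hsign.parts_of
    (hsel (fun w => (w.mant : ℤ)) fun j hj f hf => ⟨j, hj, Or.inr (Or.inl (Or.inr hf))⟩)
    (hsel Num.exponent fun j hj f hf => ⟨j, hj, Or.inr (Or.inr hf)⟩)
  refine (hx.trans (h₁.trans hres)).mono ?_ ?_
  · have : P * (K + 510) = P * (K + 500) + P * 10 := by ring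
    omega
  · omega

end Circuit

end FPSystem

/-! ## The one-hot representation -/

namespace FPSystem

open BNL

variable {A : Type} {U V : Set (A → Prop)} {S : FPSystem}

namespace Rep

theorem length_oneHot {b : ℕ} (d : Fin b) : (oneHot d).length = b := List.length_ofFn

theorem length_flatMap_oneHot {b : ℕ} (l : List (Fin b)) :
    (l.flatMap oneHot).length = b * l.length := by
  induction l with
  | nil => rfl
  | cons x l ih => rw [List.flatMap_cons, List.length_append, ih, length_oneHot, List.length_cons]; ring

theorem getD_flatMap_oneHot {b : ℕ} (c : Fin b) :
    ∀ (l : List (Fin b)) (i : ℕ) (hi : i < l.length),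
      (l.flatMap oneHot).getD (b * i + c) false = decide (c = l[i])
  | x :: l, 0, _ => by
    rw [List.flatMap_cons, List.getD_append _ _ _ _ (by rw [length_oneHot]; simp)]
    simp [oneHot, List.getD_eq_getElem?_getD]
  | x :: l, i + 1, hi => by
    have h : b * (i + 1) + (c : ℕ) - (oneHot x).length = b * i + c := by
      rw [length_oneHot, Nat.mul_succ]; omega
    rw [List.flatMap_cons, List.getD_append_right _ _ _ _
      (by rw [length_oneHot, Nat.mul_succ]; omega), h,
      getD_flatMap_oneHot c l i (by simpa using hi)]
    simp

theorem length_encode (F : Rep S) : F.encode.length = 2 + S.β * (S.p + S.q) := by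
  simp only [encode, List.length_cons, List.length_append, length_flatMap_oneHot, List.length_ofFn]
  ring

theorem getD_encode_exp (F : Rep S) (i : Fin S.q) (c : Fin S.β) :
    F.encode.getD (2 + (S.β * i + c)) false = decide (c = F.exp i) := by
  have hlt : S.β * (i : ℕ) + c < S.β * S.q := by
    have := Nat.mul_le_mul_left S.β i.2
    rw [Nat.mul_succ] at this
    omega
  rw [encode, _root_.add_comm 2, List.getD_cons_succ, List.getD_cons_succ,
    List.getD_append _ _ _ _ (by rwa [length_flatMap_oneHot, List.length_ofFn]),
    getD_flatMap_oneHot c _ i (by simp)]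
  simp

theorem getD_encode_frac (F : Rep S) (i : Fin S.p) (c : Fin S.β) :
    F.encode.getD (2 + (S.β * S.q + (S.β * i + c))) false = decide (c = F.frac i) := by
  have h : S.β * S.q + (S.β * i + c) - ((List.ofFn F.exp).flatMap oneHot).length = S.β * i + c := by
    rw [length_flatMap_oneHot, List.length_ofFn]; omega
  rw [encode, _root_.add_comm 2, List.getD_cons_succ, List.getD_cons_succ,
    List.getD_append_right _ _ _ _ (by rw [length_flatMap_oneHot, List.length_ofFn]; omega), h,
    getD_flatMap_oneHot c _ i (by simp)]
  simp

theorem exists_block {b n j : ℕ} (hj : j < b * n) : ∃ (i : Fin n) (c : Fin b), j = b * i + c := by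
  have hb : 0 < b := Nat.pos_of_mul_pos_right (Nat.zero_lt_of_lt hj)
  exact ⟨⟨j / b, Nat.div_lt_of_lt_mul hj⟩, ⟨j % b, Nat.mod_lt _ hb⟩, (Nat.div_add_mod j b).symm⟩

end Rep

/-- The bits of the one-hot representation. -/
def bits (x : A → Num S) (j : Fin (2 + S.β * (S.p + S.q))) (a : A) : Prop :=
  (x a).1.encode.getD j false = true

/-- The one-hot bits of a block are exactly the digit predicates in reversed order of positions, and
the predicates for positions from `n` on are constant. No gate is needed. -/
theorem literal_ofDigits {n : ℕ} {f : A → Fin n → Fin S.β}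
    (h : ∀ i c, Definable U 1 fun a => c = f a i) :
    ∀ g ∈ S.digits fun a => (ofDigits (f a) : ℤ), Definable U 1 g := by
  refine literal_of_lt fun i _ c hc => ?_
  by_cases hi : i < n
  · refine (h (Fin.rev ⟨i, hi⟩) ⟨c, hc⟩).of_iff fun a => ?_
    have := ofDigits_digit (f a) ⟨i, hi⟩
    rw [Fin.ext_iff, ← this]
    norm_cast
    exact eq_comm
  · refine (Definable.trivial (0 = c)).of_iff fun a => ?_
    have h₁ : ofDigits (f a) / S.β ^ i = 0 := Nat.div_eq_of_lt
      ((ofDigits_lt _).trans_le (Nat.pow_le_pow_right S.β_pos (not_lt.mp hi)))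
    norm_cast
    rw [h₁, Nat.zero_mod]

theorem definable_of_digits {n : ℕ} (hn : n ≤ S.width) {f : A → Fin n → Fin S.β}
    (h : S.digits (fun a => (ofDigits (f a) : ℤ)) ⊆ U) (i : Fin n) (c : Fin S.β) :
    Definable U 1 fun a => c = f a i := by
  refine (Definable.var (h (mem_digits (i := i.rev) (i.rev.2.trans_le hn) c))).of_iff fun a => ?_
  have := ofDigits_digit (f a) i.rev
  rw [Fin.rev_rev] at this
  rw [Fin.ext_iff, ← this]
  norm_cast
  exact eq_comm

namespace Circuit

variable {k k' k'' d d' d'' : ℕ} {x y : A → Num S}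

/-- Sign and fraction are read off directly. The only work is to pass from sign and absolute value
of the exponent to its complement form. -/
theorem decode (x : A → Num S) : S.Circuit (Set.range (bits x)) (S.parts x) 50 10 := by
  have hbit : ∀ (j : ℕ), j < 2 + S.β * (S.p + S.q) →
      (fun a => (x a).1.encode.getD j false = true) ∈ Set.range (bits x) := fun j hj => ⟨⟨j, hj⟩, rfl⟩
  have hblock : ∀ {n : ℕ} (i : Fin n) (c : Fin S.β), S.β * (i : ℕ) + c < S.β * n := fun {n} i c => by
    have := Nat.mul_le_mul_left S.β i.2
    rw [Nat.mul_succ] at this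
    omega
  have hs : S.Circuit (Set.range (bits x)) {fun a => (x a).sign = true} 0 0 :=
    of_subset fun f hf => by
      rw [Set.mem_singleton_iff.mp hf]
      exact hbit 1 (by omega)
  have he : S.Circuit (Set.range (bits x)) {fun a => (x a).1.expSign = true} 0 0 :=
    of_subset fun f hf => by
      rw [Set.mem_singleton_iff.mp hf]
      exact hbit 0 (by omega)
  have hm : S.Circuit (Set.range (bits x)) (S.digits fun a => ((x a).mant : ℤ)) 0 0 :=
    Computes.of_literal (literal_ofDigits (f := fun a => (x a).1.frac) fun i c =>
      (Definable.var (hbit (2 + (S.β * S.q + (S.β * i + c))) (by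
        have := hblock i c
        rw [Nat.mul_add]
        omega))).of_iff fun a => by rw [Rep.getD_encode_frac, decide_eq_true_eq])
  have hn : S.Circuit (Set.range (bits x)) (S.digits fun a => (ofDigits (x a).1.exp : ℤ)) 0 0 :=
    Computes.of_literal (literal_ofDigits (f := fun a => (x a).1.exp) fun i c =>
      (Definable.var (hbit (2 + (S.β * i + c)) (by
        have := hblock i c
        rw [Nat.mul_add]
        omega))).of_iff fun a => by rw [Rep.getD_encode_exp, decide_eq_true_eq])
  have hexp : ∀ a, (x a).exponent =
      if (x a).1.expSign = true then (ofDigits (x a).1.exp : ℤ) else -(ofDigits (x a).1.exp : ℤ) :=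
    fun a => by
      rw [← expNat_eq]
      rfl
  exact (hs.parts_of hm (he.cond_neg hn (w := fun a => (x a).exponent)
    (fun a h => by rw [hexp, if_pos h]) fun a h => by rw [hexp, if_neg h])).mono
    (by norm_num) (by norm_num)

/-- The converse passage: the sign bit of the exponent is a comparison with 0, its digits are those
of the absolute value, and all output bits are then literals. -/
theorem encode (hx : S.Circuit U (S.parts x) k d) :
    S.Circuit U (Set.range (bits x)) (k + 150) (d + 10) := by
  have hV : S.Circuit (S.parts x) (S.parts x) 0 0 := of_subset le_rfl
  have hexp : ∀ a, (ofDigits (x a).1.exp : ℤ) = |(x a).exponent| := fun a => by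
    rw [← expNat_eq, Num.expNat_eq_natAbs, Int.abs_eq_natAbs]
  have he : S.Circuit (S.parts x) {fun a => (x a).1.expSign = true} 40 3 :=
    (hV.exponent_of_parts.lt (const (k := 0) (d := 0) (z := fun _ => 0) _ fun _ => rfl)
      (fun a => by
        have h₁ := (x a).abs_exponent_le
        have h₂ := S.exp_bound
        have h₃ := maxExp_pos (S := S)
        rw [sub_zero]
        linarith) (p := fun a => (x a).exponent < 0) fun _ => Iff.rfl).not fun a => by
      rw [Num.expSign_eq, decide_eq_true_eq, not_lt]
  have hn : S.Circuit (S.parts x) (S.digits fun a => (ofDigits (x a).1.exp : ℤ)) 85 7 :=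
    (he.cond_neg hV.exponent_of_parts (fun a h => by
      rw [Num.expSign_eq, decide_eq_true_eq] at h
      rw [hexp, abs_of_nonneg h]) fun a h => by
      rw [Num.expSign_eq, decide_eq_true_eq] at h
      rw [hexp, abs_of_neg (not_le.mp h)]).mono (by norm_num) (by norm_num)
  have hall := (hV.union he).union hn
  refine (hx.trans (hall.literal ?_)).mono (by omega) (by omega)
  have hw := S.prec_le_width
  have hpw : S.p ≤ S.width ∧ S.q ≤ S.width := by unfold width; omega
  rintro _ ⟨⟨j, hj⟩, rfl⟩
  rcases lt_or_ge j 2 with h | h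
  · interval_cases j
    · exact .var (Or.inl (Or.inr rfl))
    · exact .var (Or.inl (Or.inl (Or.inl (Or.inl rfl))))
  · obtain ⟨j, rfl⟩ := Nat.exists_eq_add_of_le h
    rcases lt_or_ge j (S.β * S.q) with h' | h'
    · obtain ⟨i, c, rfl⟩ := Rep.exists_block h'
      refine (definable_of_digits hpw.2 (f := fun a => (x a).1.exp) (fun f hf => Or.inr hf)
        i c).of_iff fun a => ?_
      rw [bits, Rep.getD_encode_exp, decide_eq_true_eq]
    · obtain ⟨j, rfl⟩ := Nat.exists_eq_add_of_le h'
      obtain ⟨i, c, rfl⟩ := Rep.exists_block (b := S.β) (n := S.p) (j := j) (by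
        rw [Nat.mul_add] at hj
        omega)
      refine (definable_of_digits hpw.1 (f := fun a => (x a).1.frac)
        (fun f hf => Or.inl (Or.inl (Or.inl (Or.inr hf)))) i c).of_iff fun a => ?_
      rw [bits, Rep.getD_encode_frac, decide_eq_true_eq]

end Circuit

/-- The circuit is decoding, piecewise evaluation and encoding, over the numbers themselves as the
set of arguments. The additive terms in the size are absorbed by the product, since `P`, the order
and the unit are all at least 1. -/
theorem exists_simulation {P : ℕ} (D : S.PiecewisePoly P) {α : Num S → Num S} (hα : D.Defines α) :
    ∃ (T : Finset ℕ) (Λ : Program T), Λ.IsHalting ∧ Λ.Simulates α ∧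
      Λ.size ≤ 300000 * (P * D.maxOrder ^ 2 * S.unit) ∧
      Λ.transientTime ≤ Nat.clog 2 (D.maxOrder + 1) * (3 * S.logDepth + 150) + 42 := by
  have hmain := ((Circuit.decode (S := S) id).piecewise D hα).encode
  obtain ⟨T, Λ, h₁, h₂, h₃, h₄, h₅, h₆⟩ := Computes.exists_program hmain
  refine ⟨T, Λ, h₁, ⟨h₁, h₂, h₃, fun F => ?_⟩, h₅.trans ?_, h₆.trans (by omega)⟩
  · exact h₄ F _ _ (Rep.length_encode _) (Rep.length_encode _) (fun j => Iff.rfl) fun j => Iff.rfl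
  · have hP : 1 ≤ P := by
      obtain ⟨i, -⟩ := D.cover (zero S)
      have := i.2
      omega
    have hΩ : 1 ≤ D.maxOrder := le_max_left _ _
    generalize D.maxOrder = n at *
    have hu : 1 ≤ S.unit := unit_pos
    have hin : 2 + S.β * (S.p + S.q) ≤ S.unit := by
      refine le_trans ?_ S.width_β_le
      have h₁ : S.p + S.q ≤ 2 * max S.p S.q := by omega
      have h₂ := Nat.mul_le_mul_left S.β h₁
      have h₃ := Nat.mul_le_mul S.two_le_β (S.p_pos.trans (le_max_left S.p S.q))
      rw [width, show 16 * max S.p S.q * S.β = 16 * (S.β * max S.p S.q) by ring]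
      rw [show S.β * (2 * max S.p S.q) = 2 * (S.β * max S.p S.q) by ring] at h₂
      omega
    have hlog : S.logDepth ≤ 2 * S.unit := by
      have h₁ : Nat.clog 2 S.β ≤ S.β := Nat.clog_le_of_le_pow Nat.lt_two_pow_self.le
      have h₂ : Nat.clog 2 S.width ≤ S.width := Nat.clog_le_of_le_pow Nat.lt_two_pow_self.le
      have h₃ := S.width_le_unit
      have h₄ : S.β ≤ S.unit :=
        (Nat.le_mul_of_pos_left _ S.width_pos).trans S.width_β_le
      unfold logDepth
      omega
    have hclog : Nat.clog 2 (n + 1) ≤ n := Nat.clog_le_of_le_pow Nat.lt_two_pow_self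
    have hd : Nat.clog 2 (n + 1) * (3 * S.logDepth + 150) ≤ 156 * (n * S.unit) := by
      calc _ ≤ n * (156 * S.unit) := Nat.mul_le_mul hclog (by omega)
        _ = _ := by ring
    have hk : (n + 1) * ((n + 1) * 6000 + 7200) ≤ 38400 * n ^ 2 := by
      calc _ ≤ (2 * n) * (19200 * n) := Nat.mul_le_mul (by omega) (by omega)
        _ = _ := by ring
    have hPn : 1 ≤ P * n ^ 2 := Nat.mul_pos hP (pow_pos hΩ 2)
    have hk' : P * ((n + 1) * ((n + 1) * 6000 + 7200) + 510) ≤ 38910 * (P * n ^ 2) := by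
      have : 1 ≤ n ^ 2 := Nat.one_le_pow _ _ hΩ
      have : (n + 1) * ((n + 1) * 6000 + 7200) + 510 ≤ 38910 * n ^ 2 := by linarith
      calc _ ≤ P * (38910 * n ^ 2) := Nat.mul_le_mul_left _ this
        _ = _ := by ring
    have hnP : n ≤ P * n ^ 2 := (Nat.le_self_pow two_ne_zero n).trans (Nat.le_mul_of_pos_left _ hP)
    have h₁ : S.unit ≤ P * n ^ 2 * S.unit := Nat.le_mul_of_pos_left _ hPn
    have h₂ : n * S.unit ≤ P * n ^ 2 * S.unit := Nat.mul_le_mul_right _ hnP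
    have h₃ : (50 + (P * ((n + 1) * ((n + 1) * 6000 + 7200) + 510) + 5) + 150) * S.unit ≤
        40000 * (P * n ^ 2 * S.unit) := by
      rw [← Nat.mul_assoc]
      exact Nat.mul_le_mul_right _ (by omega)
    omega

end FPSystem

/-! ## The bounds -/

theorem clog_two_mul_log_le {m : ℕ} (hm : 1 ≤ m) :
    (Nat.clog 2 m : ℝ) * Real.log 2 ≤ Real.log m + Real.log 2 := by
  have h2 : 0 < Real.log 2 := Real.log_pos (by norm_num)
  rcases hm.eq_or_lt with rfl | hm
  · simp [h2.le]
  · have h := Nat.pow_pred_clog_lt_self one_lt_two hm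
    have h' : ((2 : ℝ) ^ (Nat.clog 2 m - 1)) ≤ m := by exact_mod_cast h.le
    have h₃ := Real.log_le_log (by positivity) h'
    rw [Real.log_pow, Nat.cast_pred (Nat.clog_pos one_lt_two hm)] at h₃
    linarith

/-- The width is 16r, and the largest power of it in the unit is the fourth: 16⁴ = 65536. -/
theorem FPSystem.unit_le (S : FPSystem) :
    (S.unit : ℝ) ≤ 65536 * ((max S.p S.q : ℕ) ^ 4 + (max S.p S.q : ℕ) ^ 3 * (S.β : ℝ) ^ 2 +
      (max S.p S.q : ℕ) * (S.β : ℝ) ^ 4) := by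
  unfold FPSystem.unit FPSystem.width
  generalize max S.p S.q = r
  have h₁ : (0 : ℝ) ≤ (r : ℝ) ^ 3 * (S.β : ℝ) ^ 2 := by positivity
  have h₂ : (0 : ℝ) ≤ (r : ℝ) * (S.β : ℝ) ^ 4 := by positivity
  push_cast
  nlinarith

/-- Additive constants can be absorbed into the product because log r + log β is at least log 2 and
log Ω + 1 is at least 1. -/
theorem FPSystem.time_le (S : FPSystem) {n : ℕ} (hn : 1 ≤ n) :
    ((Nat.clog 2 (n + 1) * (3 * S.logDepth + 150) + 42 : ℕ) : ℝ) ≤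
      1000 * ((Real.log n + 1) * (Real.log (max S.p S.q : ℕ) + Real.log S.β)) := by
  have hr : 1 ≤ max S.p S.q := S.p_pos.trans (le_max_left _ _)
  have hw : Real.log S.width = 4 * Real.log 2 + Real.log (max S.p S.q : ℕ) := by
    have hr' : ((max S.p S.q : ℕ) : ℝ) ≠ 0 := by
      exact_mod_cast (Nat.one_le_iff_ne_zero.mp hr)
    rw [FPSystem.width, Nat.cast_mul, Real.log_mul (by norm_num) hr',
      show ((16 : ℕ) : ℝ) = 2 ^ 4 by norm_num, Real.log_pow]
    norm_num
  have c₁ := clog_two_mul_log_le S.β_pos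
  have c₂ := clog_two_mul_log_le S.width_pos
  have c₃ := clog_two_mul_log_le (Nat.succ_pos n)
  have l₁ : Real.log 2 ≤ Real.log S.β :=
    Real.log_le_log (by norm_num) (by exact_mod_cast S.two_le_β)
  have l₂ : 0 ≤ Real.log (max S.p S.q : ℕ) := Real.log_nonneg (by exact_mod_cast hr)
  have l₃ : 0 ≤ Real.log n := Real.log_nonneg (by exact_mod_cast hn)
  have l₄ : Real.log ((n + 1 : ℕ) : ℝ) ≤ Real.log n + Real.log 2 := by
    rw [← Real.log_mul (by positivity) (by norm_num)]
    refine Real.log_le_log (by positivity) ?_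
    have : (1 : ℝ) ≤ n := by exact_mod_cast hn
    push_cast
    linarith
  have g := Real.log_two_gt_d9
  rw [hw] at c₂
  generalize max S.p S.q = r at *
  push_cast at c₃ l₄ ⊢
  set L := Real.log r + Real.log S.β with hL
  have hL2 : Real.log 2 ≤ L := by linarith
  -- The two rounded logarithms times log 2 sum to at most L + 6 log 2 ≤ 7L: each rounding costs one
  -- log 2 and the factor 16 in the width four more. Division by log 2 > 0.69 leaves less than 12L.
  have d₁ : (S.logDepth : ℝ) ≤ 12 * L := by
    unfold FPSystem.logDepth
    push_cast
    nlinarith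
  have d₂ : (Nat.clog 2 (n + 1) : ℝ) ≤ 3 * (Real.log n + 1) := by
    nlinarith
  have d₃ : 3 * (S.logDepth : ℝ) + 150 ≤ 270 * L := by linarith
  have d₄ : (42 : ℝ) ≤ 70 * ((Real.log n + 1) * L) := by nlinarith
  have d₅ := mul_le_mul d₂ d₃ (by positivity) (by linarith)
  nlinarith

theorem mainTheorem6 :
    ∃ C : ℝ, 0 < C ∧
      ∀ (S : FPSystem) (P : ℕ) (D : S.PiecewisePoly P) (α : S.Num → S.Num), D.Defines α →
        ∃ (T : Finset ℕ) (Λ : BNL.Program T),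
          Λ.IsHalting ∧ Λ.Simulates α ∧
          (Λ.size : ℝ) ≤
            C * (P * (D.maxOrder : ℝ) ^ 2 *
              ((max S.p S.q : ℕ) ^ 4 + (max S.p S.q : ℕ) ^ 3 * (S.β : ℝ) ^ 2 +
                (max S.p S.q : ℕ) * (S.β : ℝ) ^ 4)) ∧
          (Λ.transientTime : ℝ) ≤
            C * ((Real.log D.maxOrder + 1) *
              (Real.log (max S.p S.q : ℕ) + Real.log S.β)) := by
  refine ⟨300000 * 65536, by norm_num, fun S P D α hα => ?_⟩
  obtain ⟨T, Λ, h₁, h₂, h₃, h₄⟩ := FPSystem.exists_simulation D hα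
  refine ⟨T, Λ, h₁, h₂, ?_, ?_⟩
  · have h : (Λ.size : ℝ) ≤ 300000 * (P * (D.maxOrder : ℝ) ^ 2 * S.unit) := by exact_mod_cast h₃
    have hu := mul_le_mul_of_nonneg_left S.unit_le
      (by positivity : (0 : ℝ) ≤ P * (D.maxOrder : ℝ) ^ 2)
    linarith
  · have h : (Λ.transientTime : ℝ) ≤ _ := (Nat.cast_le.mpr h₄).trans
      (S.time_le (le_max_left 1 (Finset.univ.sup D.order)))
    refine h.trans (mul_le_mul_of_nonneg_right (by norm_num) ?_)
    have l₁ : 0 ≤ Real.log (max S.p S.q : ℕ) := Real.log_natCast_nonneg _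
    have l₂ : 0 ≤ Real.log S.β := Real.log_natCast_nonneg _
    have l₃ : 0 ≤ Real.log D.maxOrder := Real.log_natCast_nonneg _
    positivity
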